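/- Let $N\ge 1$, let $\Omega\subset\mathbb{R}^N$ be a bounded open set, let $0<s<1$ and $1<p<\frac{2N}{N+2s}$, and put $\nu+1=\frac{N(2-p)}{ps}$. Write $D_\Omega=(\mathbb{R}^N\times\mathbb{R}^N)\setminus(\Omega^c\times\Omega^c)$ and $d\mu=\frac{dx\,dy}{|x-y|^{N+ps}}$. Let $W^{s,p}_0(\Omega)$ be the completion of $C_c^\infty(\Omega)$ (functions extended by $0$ to $\mathbb{R}^N$) in the norm $\|w\|_{L^p}+\big(\iint_{D_\Omega}|w(x)-w(y)|^p\,d\mu\big)^{1/p}$, and let $W^{-s,p'}(\Omega)$ be its dual, $p'=\frac{p}{p-1}$. For $T>0$ and $u_0\in L^2(\Omega)$, an energy solution on $(0,T)$ of $$u_t+(-\Delta)^s_p u=0\ \text{ in }\Omega\times(0,T),\qquad u=0\ \text{ in }(\mathbb{R}^N\setminus\Omega)\times(0,T),\qquad u(\cdot,0)=u_0\ \text{ in }\Omega,$$ is a function $u\in L^p(0,T;W^{s,p}_0(\Omega))\cap C([0,T];L^2(\Omega))$, each $u(\cdot,t)$ being extended by $0$ outside $\Omega$, with $u_t\in L^{p'}(0,T;W^{-s,p'}(\Omega))$,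 $u(\cdot,t)\to u_0$ in $L^2(\Omega)$ as $t\to0^+$, and $$\int_0^T\langle u_t,v\rangle\,dt+\frac12\int_0^T\iint_{D_\Omega}|u(x,t)-u(y,t)|^{p-2}(u(x,t)-u(y,t))(v(x,t)-v(y,t))\,d\mu\,dt=0$$ for all $v\in L^p(0,T;W^{s,p}_0(\Omega))$. Theorem. Let $u_0\in L^{\nu+1}(\Omega)\cap L^2(\Omega)$. Then there exists $T^*\in(0,\infty)$, depending only on $N,s,p,\Omega,u_0$, such that for every $T>0$, every nonnegative energy solution $u$ on $(0,T)$ with initial datum $u_0$ satisfies $u(\cdot,t)=0$ a.e. in $\mathbb{R}^N$ for all $t\in[T^*,T]$. In particular, a nonnegative solution that is defined for all times vanishes identically for all $t\ge T^*$. -/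

import Mathlib

open MeasureTheory Filter Topology Set
open scoped ENNReal ContDiff

namespace FracPLap

noncomputable section

/-- The set `D_Ω = (ℝᴺ × ℝᴺ) \ (Ωᶜ × Ωᶜ)`. -/
def interactionDomain {N : ℕ} (Ω : Set (EuclideanSpace ℝ (Fin N))) :
    Set (EuclideanSpace ℝ (Fin N) × EuclideanSpace ℝ (Fin N)) :=
  {z | z.1 ∈ Ω ∨ z.2 ∈ Ω}

/-- The `p`-th power of the Gagliardo seminorm:
`∬_{D_Ω} |w(x) - w(y)|^p / |x - y|^(N + p s) dx dy`, with values in `[0, ∞]`. -/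
def gagliardo {N : ℕ} (Ω : Set (EuclideanSpace ℝ (Fin N))) (s p : ℝ)
    (w : EuclideanSpace ℝ (Fin N) → ℝ) : ℝ≥0∞ :=
  ∫⁻ z in interactionDomain Ω,
    ENNReal.ofReal (|w z.1 - w z.2| ^ p / ‖z.1 - z.2‖ ^ ((N : ℝ) + p * s))

/-- Membership in `W₀^{s,p}(Ω)`, the completion of `C_c^∞(Ω)`, realised as a space of functions
on `ℝᴺ` that vanish a.e. outside `Ω` and are limits of functions in `C_c^∞(Ω)` in the norm
`‖w‖_{L^p} + (∬_{D_Ω} |w(x) - w(y)|^p / |x - y|^(N + p s) dx dy)^{1/p}`. -/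
structure MemW0 {N : ℕ} (Ω : Set (EuclideanSpace ℝ (Fin N))) (s p : ℝ)
    (w : EuclideanSpace ℝ (Fin N) → ℝ) : Prop where
  memLp : MemLp w (ENNReal.ofReal p) volume
  eq_zero_outside : ∀ᵐ x ∂(volume.restrict Ωᶜ), w x = 0
  approx : ∃ φ : ℕ → EuclideanSpace ℝ (Fin N) → ℝ,
    (∀ n, ContDiff ℝ ∞ (φ n) ∧ HasCompactSupport (φ n) ∧ tsupport (φ n) ⊆ Ω) ∧
    Tendsto (fun n => eLpNorm (w - φ n) (ENNReal.ofReal p) volume) atTop (𝓝 0) ∧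
    Tendsto (fun n => gagliardo Ω s p (w - φ n)) atTop (𝓝 0)

/-- Membership in `L^p(0,T; W₀^{s,p}(Ω))`; functions of `(t, x)` are written in curried form. -/
structure MemParabolic {N : ℕ} (Ω : Set (EuclideanSpace ℝ (Fin N))) (s p T : ℝ)
    (v : ℝ → EuclideanSpace ℝ (Fin N) → ℝ) : Prop where
  memLp : MemLp (Function.uncurry v) (ENNReal.ofReal p)
    ((volume.restrict (Ioo 0 T)).prod volume)
  memW0 : ∀ᵐ t ∂(volume.restrict (Ioo 0 T)), MemW0 Ω s p (v t)
  finite : ∫⁻ t in Ioo 0 T, gagliardo Ω s p (v t) < ⊤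

/-- The norm of `L^p(0,T; W₀^{s,p}(Ω))`. -/
def parabolicNorm {N : ℕ} (Ω : Set (EuclideanSpace ℝ (Fin N))) (s p T : ℝ)
    (v : ℝ → EuclideanSpace ℝ (Fin N) → ℝ) : ℝ :=
  (∫⁻ t in Ioo 0 T, gagliardo Ω s p (v t)).toReal ^ (1 / p)

/-- `ξ` is (the restriction to `L^p(0,T; W₀^{s,p}(Ω))` of `ξ` is) a bounded linear functional,
that is, an element of the dual space `L^{p'}(0,T; W^{-s,p'}(Ω))`. -/
structure IsDualElement {N : ℕ} (Ω : Set (EuclideanSpace ℝ (Fin N))) (s p T : ℝ)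
    (ξ : (ℝ → EuclideanSpace ℝ (Fin N) → ℝ) → ℝ) : Prop where
  map_add : ∀ v w, MemParabolic Ω s p T v → MemParabolic Ω s p T w → ξ (v + w) = ξ v + ξ w
  map_smul : ∀ (c : ℝ) (v), MemParabolic Ω s p T v → ξ (c • v) = c * ξ v
  bounded : ∃ C : ℝ, ∀ v, MemParabolic Ω s p T v → |ξ v| ≤ C * parabolicNorm Ω s p T v

/-- `ξ` is the distributional time derivative `u_t` of `u` on `Ω × (0,T)`: it acts on every
`φ ∈ C_c^∞(Ω × (0,T))` by `⟨ξ, φ⟩ = - ∬ u φ_t dx dt`. -/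
def IsTimeDeriv {N : ℕ} (Ω : Set (EuclideanSpace ℝ (Fin N))) (T : ℝ)
    (u : ℝ → EuclideanSpace ℝ (Fin N) → ℝ)
    (ξ : (ℝ → EuclideanSpace ℝ (Fin N) → ℝ) → ℝ) : Prop :=
  ∀ φ : ℝ → EuclideanSpace ℝ (Fin N) → ℝ,
    ContDiff ℝ ∞ (Function.uncurry φ) → HasCompactSupport (Function.uncurry φ) →
    tsupport (Function.uncurry φ) ⊆ Ioo 0 T ×ˢ Ω →
    ξ φ = - ∫ t in Ioo 0 T, ∫ x in Ω, u t x * deriv (fun τ => φ τ x) t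

/-- `⟨(-Δ)^s_p w, v⟩ =
½ ∬_{D_Ω} |w(x)-w(y)|^{p-2} (w(x)-w(y)) (v(x)-v(y)) / |x-y|^(N+ps) dx dy`. -/
def fracPLapForm {N : ℕ} (Ω : Set (EuclideanSpace ℝ (Fin N))) (s p : ℝ)
    (w v : EuclideanSpace ℝ (Fin N) → ℝ) : ℝ :=
  (1 / 2) * ∫ z in interactionDomain Ω,
    |w z.1 - w z.2| ^ (p - 2) * (w z.1 - w z.2) * (v z.1 - v z.2) /
      ‖z.1 - z.2‖ ^ ((N : ℝ) + p * s)

/-- `u` is an energy solution on `(0,T)` of `u_t + (-Δ)^s_p u = 0` in `Ω × (0,T)`, `u = 0` outside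
`Ω`, `u(·,0) = u₀` in `Ω`. -/
structure IsEnergySolution {N : ℕ} (Ω : Set (EuclideanSpace ℝ (Fin N))) (s p T : ℝ)
    (u₀ : EuclideanSpace ℝ (Fin N) → ℝ) (u : ℝ → EuclideanSpace ℝ (Fin N) → ℝ) : Prop where
  memParabolic : MemParabolic Ω s p T u
  eq_zero_outside : ∀ t ∈ Icc 0 T, ∀ᵐ x ∂(volume.restrict Ωᶜ), u t x = 0
  /-- `u ∈ C([0,T]; L²(Ω))` -/
  memL2 : ∀ t ∈ Icc 0 T, MemLp (u t) 2 (volume.restrict Ω)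
  continuous : ∀ t₀ ∈ Icc 0 T,
    Tendsto (fun t => eLpNorm (u t - u t₀) 2 (volume.restrict Ω)) (𝓝[Icc 0 T] t₀) (𝓝 0)
  /-- `u(·,t) → u₀` in `L²(Ω)` as `t → 0⁺` -/
  initial : Tendsto (fun t => eLpNorm (u t - u₀) 2 (volume.restrict Ω)) (𝓝[>] 0) (𝓝 0)
  /-- `u_t ∈ L^{p'}(0,T; W^{-s,p'}(Ω))`, and the equation holds tested with every
  `v ∈ L^p(0,T; W₀^{s,p}(Ω))` -/
  equation : ∃ ξ : (ℝ → EuclideanSpace ℝ (Fin N) → ℝ) → ℝ,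
    IsDualElement Ω s p T ξ ∧ IsTimeDeriv Ω T u ξ ∧
    ∀ v, MemParabolic Ω s p T v →
      ξ v + ∫ t in Ioo 0 T, fracPLapForm Ω s p (u t) (v t) = 0

end

end FracPLap

/-! Testing the equation with `|u|^(ν-1) u` gives a differential inequality that forces extinction.
Let `y(t) = ∫_Ω |u(t)|^(ν+1)`. The elementary inequality `|f(a) - f(b)|^p ≤ |a - b|^(p-2) (a - b)
(h(a) - h(b))`, valid when `f' = (h')^(1/p)`, bounds the nonlocal term below by the Gagliardo energy
of a multiple of `|u|^((ν-1)/p) u`. The fractional Sobolev inequality has exponent `p/θ` with `θ = 1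
- ps/N`, and the value of ν is the one for which `((ν-1)/p + 1) · p/θ = ν + 1`. Hence the
dissipation controls a power of `y` itself: `y' + c y^θ ≤ 0` with `0 < θ < 1`, and such a `y`
reaches zero in a time determined by `c`, θ and a bound for `y`. The condition `p < 2N/(N+2s)` says
exactly that `ν > 1`.

Two points need care. The power is not an admissible test function, so `h' = ν|r|^(ν-1)` is replaced
by smooth compactly supported even functions `cutoffPow ν k`. Then `h` is bounded, Lipschitz and
smooth, the energy `∫ G(u)` with `G' = h` is continuous on `L²`, and `k → ∞` is taken at the end by
dominated convergence and Fatou (`IsEnergySolution.powerEnergy_decay`).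

Moreover `u` has only a weak time derivative. For almost every `t` the function `h(u(t))` is used as
a test function frozen in time on `(t-δ, t)` (`IsEnergySolution.sub_eq_of_comp`). Convexity of `G`
bounds `E(t) - E(t-δ)` by the pairing of `u(t) - u(t-δ)` with `h(u(t))`, where `E(t) = ∫_Ω G(u(t))`.
Integrating in `t`, dividing by δ and letting `δ → 0`, with continuity of translations in `L^{p'}`,
yields `IsEnergySolution.energy_le`. The remaining pillars are `exists_sobolev_const` and
`exists_extinction_time`. -/

namespace FracPLap

noncomputable section

/-! ### Weighted difference quotients and the fractional Sobolev inequality -/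

section Sobolev

/-- The weighted difference quotient `(w(x) - w(y)) / |x - y|^((N + p s) / p)` on `D_Ω`, extended
by zero. -/
def wdiff {N : ℕ} (Ω : Set (EuclideanSpace ℝ (Fin N))) (s p : ℝ)
    (w : EuclideanSpace ℝ (Fin N) → ℝ) :
    EuclideanSpace ℝ (Fin N) × EuclideanSpace ℝ (Fin N) → ℝ :=
  (interactionDomain Ω).indicator
    fun z => (w z.1 - w z.2) / ‖z.1 - z.2‖ ^ (((N : ℝ) + p * s) / p)

/-- The signed power `|a|^(p-2) a`. -/
def signedPow (p a : ℝ) : ℝ := |a| ^ (p - 2) * a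

variable {N : ℕ} {Ω : Set (EuclideanSpace ℝ (Fin N))} {s p : ℝ}
  {w v : EuclideanSpace ℝ (Fin N) → ℝ}

theorem measurableSet_interactionDomain (hΩ : MeasurableSet Ω) :
    MeasurableSet (interactionDomain Ω) :=
  (measurable_fst hΩ).union (measurable_snd hΩ)

theorem enorm_rpow_eq_ofReal {a : ℝ} (hp : 0 ≤ p) : ‖a‖ₑ ^ p = ENNReal.ofReal (|a| ^ p) := by
  rw [Real.enorm_eq_ofReal_abs, ENNReal.ofReal_rpow_of_nonneg (abs_nonneg _) hp]

theorem abs_div_rpow_rpow {a d α : ℝ} (hp : 0 < p) (hd : 0 ≤ d) :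
    |a / d ^ (α / p)| ^ p = |a| ^ p / d ^ α := by
  rw [abs_div, Real.div_rpow (abs_nonneg _) (abs_nonneg _),
    abs_of_nonneg (Real.rpow_nonneg hd _), ← Real.rpow_mul hd, div_mul_cancel₀ _ hp.ne']

/-- Putting the `p`-th root of the kernel into the difference quotient turns the seminorm into an
ordinary `L^p` norm for Lebesgue measure on pairs, so that the Hölder and convergence theorems of
`L^p` apply directly. -/
theorem gagliardo_eq_lintegral_wdiff (hΩ : MeasurableSet Ω) (hp : 0 < p) :
    gagliardo Ω s p w = ∫⁻ z, ‖wdiff Ω s p w z‖ₑ ^ p := by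
  rw [gagliardo, ← lintegral_indicator (measurableSet_interactionDomain hΩ)]
  refine lintegral_congr fun z => ?_
  by_cases hz : z ∈ interactionDomain Ω
  · simp only [wdiff, indicator_of_mem hz]
    rw [enorm_rpow_eq_ofReal hp.le, abs_div_rpow_rpow hp (norm_nonneg _)]
  · simp [wdiff, indicator_of_notMem hz, hp]

theorem abs_signedPow {a : ℝ} (hp : 1 < p) : |signedPow p a| = |a| ^ (p - 1) := by
  rcases eq_or_ne a 0 with rfl | ha
  · rw [signedPow, mul_zero, abs_zero, Real.zero_rpow (by linarith)]
  · have ha' : 0 < |a| := abs_pos.2 ha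
    rw [signedPow, abs_mul, abs_of_nonneg (Real.rpow_nonneg ha'.le _)]
    nth_rewrite 2 [← Real.rpow_one |a|]
    rw [← Real.rpow_add ha']
    congr 1
    ring

theorem measurable_signedPow : Measurable (signedPow p) := by
  unfold signedPow
  fun_prop

/-- The kernel splits as its power `(p-1)/p`, absorbed by the signed power, times its power `1/p`,
absorbed by the test function. This is the duality pairing of `L^{p'}` with `L^p`. -/
theorem fracPLapForm_eq_integral_wdiff (hΩ : MeasurableSet Ω) (hp : 0 < p) :
    fracPLapForm Ω s p w v
      = (1 / 2) * ∫ z, signedPow p (wdiff Ω s p w z) * wdiff Ω s p v z := by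
  rw [fracPLapForm, ← integral_indicator (measurableSet_interactionDomain hΩ)]
  congr 1
  refine integral_congr_ae (Eventually.of_forall fun z => ?_)
  by_cases hz : z ∈ interactionDomain Ω
  · simp only [wdiff, indicator_of_mem hz, signedPow]
    rcases (norm_nonneg (z.1 - z.2)).eq_or_lt with h0 | h0
    · have : z.1 = z.2 := sub_eq_zero.1 (norm_eq_zero.1 h0.symm)
      simp [this]
    · set d := ‖z.1 - z.2‖
      set α := (N : ℝ) + p * s
      have hd : 0 < d ^ (α / p) := Real.rpow_pos_of_pos h0 _
      have e : d ^ α = d ^ (α / p * (p - 2)) * (d ^ (α / p) * d ^ (α / p)) := by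
        rw [← Real.rpow_add h0, ← Real.rpow_add h0]
        congr 1
        field_simp
        ring
      rw [abs_div, Real.div_rpow (abs_nonneg _) (abs_nonneg _), abs_of_pos hd,
        ← Real.rpow_mul h0.le, e]
      have := (Real.rpow_pos_of_pos h0 (α / p * (p - 2))).ne'
      field_simp
  · simp [wdiff, indicator_of_notMem hz, signedPow]

theorem aestronglyMeasurable_wdiff (hΩ : MeasurableSet Ω)
    (hw : AEStronglyMeasurable w volume) : AEStronglyMeasurable (wdiff Ω s p w) volume := by
  refine AEStronglyMeasurable.indicator ?_ (measurableSet_interactionDomain hΩ)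
  have h1 : AEStronglyMeasurable
      (fun z : EuclideanSpace ℝ (Fin N) × EuclideanSpace ℝ (Fin N) => w z.1) volume :=
    hw.comp_fst
  have h2 : AEStronglyMeasurable
      (fun z : EuclideanSpace ℝ (Fin N) × EuclideanSpace ℝ (Fin N) => w z.2) volume :=
    hw.comp_snd
  have h3 : Measurable (fun z : EuclideanSpace ℝ (Fin N) × EuclideanSpace ℝ (Fin N) =>
      (‖z.1 - z.2‖ ^ (((N : ℝ) + p * s) / p))⁻¹) := by fun_prop
  have h4 := (h1.sub h2).mul h3.aestronglyMeasurable
  refine h4.congr (Eventually.of_forall fun z => ?_)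
  simp [div_eq_mul_inv]

/-- Optimisation over the scale `ρ` of an interpolation inequality. -/
theorem le_of_forall_scale {W K g B θ : ℝ} (hB : 0 < B) (hg : 0 ≤ g)
    (hK : 0 ≤ K) (hθ : 0 < θ)
    (h : ∀ ρ : ℝ, 0 < ρ → W ≤ K * (ρ ^ (1 - θ) * g + ρ ^ (-θ) * B)) :
    W ≤ 2 * K * (B ^ (1 - θ) * g ^ θ) := by
  -- The optimal scale `B / g` is unavailable when `g = 0`, so it is taken for each `g' > g`, and
  -- `g'` then decreases to `g`.
  have key : ∀ g' : ℝ, g < g' → W ≤ 2 * K * (B ^ (1 - θ) * g' ^ θ) := by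
    intro g' hg'
    have hg0 : 0 < g' := hg.trans_lt hg'
    have h1 := h (B / g') (div_pos hB hg0)
    have e1 : (B / g') ^ (1 - θ) * g' = B ^ (1 - θ) * g' ^ θ := by
      rw [Real.div_rpow hB.le hg0.le, Real.rpow_sub hg0, Real.rpow_one]
      field_simp
    have e2 : (B / g') ^ (-θ) * B = B ^ (1 - θ) * g' ^ θ := by
      rw [Real.div_rpow hB.le hg0.le, Real.rpow_neg hB.le, Real.rpow_neg hg0.le,
        Real.rpow_sub hB, Real.rpow_one]
      field_simp
    have h2 : (B / g') ^ (1 - θ) * g ≤ B ^ (1 - θ) * g' ^ θ := by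
      rw [← e1]
      gcongr
    calc W ≤ K * ((B / g') ^ (1 - θ) * g + (B / g') ^ (-θ) * B) := h1
      _ ≤ K * (B ^ (1 - θ) * g' ^ θ + B ^ (1 - θ) * g' ^ θ) := by
          rw [e2]
          gcongr
      _ = _ := by ring
  have hc : ContinuousWithinAt (fun g' : ℝ => 2 * K * (B ^ (1 - θ) * g' ^ θ)) (Ioi g) g := by
    refine ContinuousAt.continuousWithinAt ?_
    have := Real.continuousAt_rpow_const g θ (Or.inr hθ.le)
    fun_prop
  exact ge_of_tendsto hc (eventually_nhdsWithin_of_forall key)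

/-- Averaging over a ball. -/
theorem volume_ball_mul_enorm_rpow_le (hp : 1 ≤ p) (hs : 0 ≤ s)
    (hw : AEStronglyMeasurable w volume) (x : EuclideanSpace ℝ (Fin N)) {r : ℝ} (hr : 0 < r) :
    volume (Metric.ball x r) * ‖w x‖ₑ ^ p ≤ 2 ^ (p - 1) *
      (ENNReal.ofReal (r ^ ((N : ℝ) + p * s)) *
        (∫⁻ y, ENNReal.ofReal (|w x - w y| ^ p / ‖x - y‖ ^ ((N : ℝ) + p * s)))
        + ∫⁻ y in Metric.ball x r, ‖w y‖ₑ ^ p) := by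
  have hp0 : 0 ≤ p := by linarith
  have hα : 0 ≤ (N : ℝ) + p * s := by positivity
  have hm : AEMeasurable (fun y => ‖w y‖ₑ ^ p) (volume.restrict (Metric.ball x r)) :=
    (hw.enorm.pow_const p).restrict
  calc volume (Metric.ball x r) * ‖w x‖ₑ ^ p
      = ∫⁻ y in Metric.ball x r, ‖w x‖ₑ ^ p := by
        rw [setLIntegral_const, mul_comm]
    _ ≤ ∫⁻ y in Metric.ball x r, 2 ^ (p - 1) *
          (ENNReal.ofReal (r ^ ((N : ℝ) + p * s)) *
            ENNReal.ofReal (|w x - w y| ^ p / ‖x - y‖ ^ ((N : ℝ) + p * s)) + ‖w y‖ₑ ^ p) := by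
        refine setLIntegral_mono_ae' measurableSet_ball (Eventually.of_forall fun y hy => ?_)
        have h1 : ‖w x‖ₑ ^ p ≤ (‖w x - w y‖ₑ + ‖w y‖ₑ) ^ p := by
          refine ENNReal.rpow_le_rpow ?_ hp0
          calc ‖w x‖ₑ = ‖(w x - w y) + w y‖ₑ := by rw [sub_add_cancel]
            _ ≤ _ := enorm_add_le _ _
        refine h1.trans ((ENNReal.rpow_add_le_mul_rpow_add_rpow _ _ hp).trans ?_)
        gcongr
        rw [enorm_rpow_eq_ofReal hp0, ← ENNReal.ofReal_mul (by positivity)]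
        refine ENNReal.ofReal_le_ofReal ?_
        rcases (norm_nonneg (x - y)).eq_or_lt with h0 | h0
        · have : x = y := sub_eq_zero.1 (norm_eq_zero.1 h0.symm)
          subst this
          rw [sub_self, abs_zero, Real.zero_rpow (by linarith)]
          positivity
        · rw [Metric.mem_ball, dist_comm, dist_eq_norm] at hy
          have h2 : ‖x - y‖ ^ ((N : ℝ) + p * s) ≤ r ^ ((N : ℝ) + p * s) :=
            Real.rpow_le_rpow h0.le hy.le hα
          have h3 : 0 < ‖x - y‖ ^ ((N : ℝ) + p * s) := Real.rpow_pos_of_pos h0 _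
          rw [mul_div_assoc', le_div_iff₀ h3, mul_comm]
          gcongr
    _ = 2 ^ (p - 1) * (ENNReal.ofReal (r ^ ((N : ℝ) + p * s)) *
          (∫⁻ y in Metric.ball x r,
            ENNReal.ofReal (|w x - w y| ^ p / ‖x - y‖ ^ ((N : ℝ) + p * s)))
          + ∫⁻ y in Metric.ball x r, ‖w y‖ₑ ^ p) := by
        rw [lintegral_const_mul' _ _ (by simp), lintegral_add_right' _ hm,
          lintegral_const_mul' _ _ ENNReal.ofReal_ne_top]
    _ ≤ _ := by
        gcongr
        exact Measure.restrict_le_self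

theorem setLIntegral_le_rpow_mul_measure_rpow {X : Type*} [MeasurableSpace X] {μ : Measure X}
    {f : X → ℝ≥0∞} (hf : AEMeasurable f μ) {θ : ℝ} (hθ0 : 0 < θ) (hθ1 : θ < 1) (A : Set X) :
    ∫⁻ x in A, f x ∂μ ≤ (∫⁻ x, f x ^ (1 / θ) ∂μ) ^ θ * μ A ^ (1 - θ) := by
  have hc : (1 / θ).HolderConjugate (1 / (1 - θ)) := by
    rw [Real.holderConjugate_iff]
    refine ⟨by rw [lt_div_iff₀ hθ0]; linarith, ?_⟩
    simp
  have h := ENNReal.lintegral_mul_le_Lp_mul_Lq (μ.restrict A) hc hf.restrict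
    (aemeasurable_const (b := (1 : ℝ≥0∞)))
  simp only [Pi.mul_apply, mul_one, ENNReal.one_rpow, lintegral_const, one_div_one_div, one_mul,
    Measure.restrict_apply_univ] at h
  refine h.trans ?_
  gcongr
  exact Measure.restrict_le_self

/-- The fractional Sobolev inequality. -/
theorem exists_sobolev_const (hs : 0 < s) (hp : 1 ≤ p) (hN : p * s < N) :
    ∃ C : ℝ, 0 < C ∧ ∀ (Ω : Set (EuclideanSpace ℝ (Fin N))) (w : EuclideanSpace ℝ (Fin N) → ℝ),
      MeasurableSet Ω → AEStronglyMeasurable w volume →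
      (∀ᵐ x ∂(volume.restrict Ωᶜ), w x = 0) →
      ∫⁻ x, ‖w x‖ₑ ^ (p / (1 - p * s / N)) ≠ ⊤ →
      (∫⁻ x, ‖w x‖ₑ ^ (p / (1 - p * s / N))) ^ (1 - p * s / N)
        ≤ ENNReal.ofReal C * gagliardo Ω s p w := by
  have hp0 : 0 < p := by linarith
  have hps : 0 < p * s := by positivity
  have hN0 : (0 : ℝ) < N := hps.trans hN
  set θ : ℝ := 1 - p * s / N with hθ
  have hθ0 : 0 < θ := by
    rw [hθ, sub_pos, div_lt_one hN0]; exact hN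
  have hθ1 : θ < 1 := by
    rw [hθ]; have := div_pos hps hN0; linarith
  have hNne : NeZero N := ⟨by rintro rfl; simp at hN0⟩
  set V : ℝ := volume.real (Metric.ball (0 : EuclideanSpace ℝ (Fin N)) 1) with hV
  have hV0 : 0 < V := by
    rw [hV, Measure.real, ENNReal.toReal_pos_iff]
    exact ⟨Metric.measure_ball_pos _ _ one_pos, measure_ball_lt_top⟩
  -- After division by the volume `ρV` of the ball, the oscillation term carries `1/V` and the
  -- Hölder term `1/V^θ`; the sum serves for both.
  set K : ℝ := 2 ^ (p - 1) * (1 / V + 1 / V ^ θ) with hK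
  have hK0 : 0 < K := by positivity
  refine ⟨(2 * K) ^ (1 / θ), by positivity, ?_⟩
  intro Ω w hΩ hw hw0 hfin
  set I := ∫⁻ x, ‖w x‖ₑ ^ (p / θ) with hI
  rcases eq_or_ne I 0 with hI0 | hI0
  · rw [hI0, ENNReal.zero_rpow_of_pos hθ0]; exact zero_le
  set α : ℝ := (N : ℝ) + p * s with hα
  set g : EuclideanSpace ℝ (Fin N) → ℝ≥0∞ :=
    fun x => ∫⁻ y, ENNReal.ofReal (|w x - w y| ^ p / ‖x - y‖ ^ α) with hg
  set B : ℝ := (I ^ θ).toReal with hB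
  have hIθ : I ^ θ ≠ ⊤ := ENNReal.rpow_ne_top_of_nonneg hθ0.le hfin
  have hB0 : 0 < B := ENNReal.toReal_pos (by simp [hI0, hfin]) hIθ
  -- pointwise estimate
  have hpt : ∀ x, ‖w x‖ₑ ^ (p / θ)
      ≤ ENNReal.ofReal ((2 * K) ^ (1 / θ) * B ^ ((1 - θ) / θ)) * g x := by
    intro x
    rcases eq_or_ne (g x) ⊤ with hgx | hgx
    · rw [hgx, ENNReal.mul_top]
      · exact le_top
      · rw [Ne, ENNReal.ofReal_eq_zero, not_le]; positivity
    have hre : |w x| ^ p ≤ 2 * K * (B ^ (1 - θ) * (g x).toReal ^ θ) := by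
      refine le_of_forall_scale hB0 ENNReal.toReal_nonneg hK0.le hθ0 fun ρ hρ => ?_
      -- Scales are measured by `ρ = r^N`, so the ball has volume `ρV` and `r^(N+ps) = ρ · ρ^(1-θ)`.
      set r : ℝ := ρ ^ (1 / (N : ℝ)) with hr
      have hr0 : 0 < r := Real.rpow_pos_of_pos hρ _
      have hrN : r ^ N = ρ := by
        rw [hr, ← Real.rpow_natCast, ← Real.rpow_mul hρ.le, one_div_mul_cancel hN0.ne',
          Real.rpow_one]
      have hrα : r ^ α = ρ * ρ ^ (1 - θ) := by
        rw [hr, ← Real.rpow_mul hρ.le]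
        nth_rewrite 2 [← Real.rpow_one ρ]
        rw [← Real.rpow_add hρ]
        congr 1
        rw [hα, hθ]; field_simp; ring
      have h1 := volume_ball_mul_enorm_rpow_le hp hs.le hw x hr0
      have h2 := setLIntegral_le_rpow_mul_measure_rpow (μ := volume)
        (hw.enorm.pow_const p) hθ0 hθ1 (Metric.ball x r)
      have e : ∀ y, (‖w y‖ₑ ^ p) ^ (1 / θ) = ‖w y‖ₑ ^ (p / θ) := fun y => by
        rw [← ENNReal.rpow_mul, mul_one_div]
      simp only [e] at h2
      have hvol : volume (Metric.ball x r) = ENNReal.ofReal (ρ * V) := by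
        rw [Measure.addHaar_ball _ _ hr0.le, finrank_euclideanSpace, Fintype.card_fin, hrN,
          ENNReal.ofReal_mul hρ.le, hV, ofReal_measureReal]
      have h3 := h1.trans (mul_le_mul_right (add_le_add_right h2 _) _)
      rw [hvol, enorm_rpow_eq_ofReal hp0.le] at h3
      have e2 : (2 : ℝ≥0∞) ^ (p - 1) = ENNReal.ofReal (2 ^ (p - 1)) := by
        rw [← ENNReal.ofReal_rpow_of_nonneg (by norm_num) (by linarith)]
        norm_num
      have e3 : I ^ θ = ENNReal.ofReal B := (ENNReal.ofReal_toReal hIθ).symm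
      have e4 : g x = ENNReal.ofReal (g x).toReal := (ENNReal.ofReal_toReal hgx).symm
      have h4 : ENNReal.ofReal (ρ * V) * ENNReal.ofReal (|w x| ^ p)
          ≤ ENNReal.ofReal (2 ^ (p - 1)) * (ENNReal.ofReal (r ^ α) * g x
            + I ^ θ * ENNReal.ofReal (ρ * V) ^ (1 - θ)) := by
        rw [← e2]; exact h3
      rw [e3, e4, ENNReal.ofReal_rpow_of_nonneg (by positivity) (by linarith),
        ← ENNReal.ofReal_mul (by positivity), ← ENNReal.ofReal_mul (by positivity),
        ← ENNReal.ofReal_mul (by positivity), ← ENNReal.ofReal_add (by positivity)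
          (by positivity), ← ENNReal.ofReal_mul (by positivity),
        ENNReal.ofReal_le_ofReal_iff (by positivity), hrα] at h4
      set γ := (g x).toReal with hγ
      have hγ0 : 0 ≤ γ := ENNReal.toReal_nonneg
      have e5 : (ρ * V) ^ (1 - θ) = ρ * V * (ρ ^ (-θ) * (1 / V ^ θ)) := by
        rw [Real.mul_rpow hρ.le hV0.le, Real.rpow_sub hρ, Real.rpow_sub hV0, Real.rpow_one,
          Real.rpow_one, Real.rpow_neg hρ.le]
        field_simp
      rw [e5] at h4
      have h5 : |w x| ^ p ≤ 2 ^ (p - 1) * ((1 / V) * (ρ ^ (1 - θ) * γ)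
          + (1 / V ^ θ) * (ρ ^ (-θ) * B)) := by
        refine le_of_mul_le_mul_left (h4.trans (le_of_eq ?_)) (mul_pos hρ hV0)
        field_simp
      refine h5.trans ?_
      rw [hK, mul_assoc]
      refine mul_le_mul_of_nonneg_left ?_ (by positivity)
      have a1 : 0 ≤ ρ ^ (1 - θ) * γ := by positivity
      have a2 : 0 ≤ ρ ^ (-θ) * B := by positivity
      have a3 : 0 ≤ 1 / V := by positivity
      have a4 : 0 ≤ 1 / V ^ θ := by positivity
      nlinarith [mul_nonneg a3 a2, mul_nonneg a4 a1]
    have hre2 : |w x| ^ (p / θ)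
        ≤ (2 * K) ^ (1 / θ) * B ^ ((1 - θ) / θ) * (g x).toReal := by
      have := Real.rpow_le_rpow (by positivity) hre (z := 1 / θ) (by positivity)
      rw [← Real.rpow_mul (abs_nonneg _), Real.mul_rpow (by positivity) (by positivity),
        Real.mul_rpow (x := B ^ (1 - θ)) (by positivity) (by positivity), ← Real.rpow_mul hB0.le,
        ← Real.rpow_mul ENNReal.toReal_nonneg, mul_one_div_cancel hθ0.ne', Real.rpow_one,
        mul_one_div, mul_one_div] at this
      rw [mul_assoc]
      exact this
    rw [enorm_rpow_eq_ofReal (by positivity)]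
    calc ENNReal.ofReal (|w x| ^ (p / θ))
        ≤ ENNReal.ofReal ((2 * K) ^ (1 / θ) * B ^ ((1 - θ) / θ) * (g x).toReal) :=
          ENNReal.ofReal_le_ofReal hre2
      _ = _ := by
          rw [ENNReal.ofReal_mul (by positivity), ENNReal.ofReal_toReal hgx]
  have hIΩ : I = ∫⁻ x in Ω, ‖w x‖ₑ ^ (p / θ) := by
    rw [hI, ← lintegral_add_compl _ hΩ]
    have : ∫⁻ x in Ωᶜ, ‖w x‖ₑ ^ (p / θ) = 0 := by
      rw [lintegral_congr_ae (g := fun _ => 0)]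
      · simp
      · filter_upwards [hw0] with x hx
        have : 0 < p / θ := by positivity
        simp [hx, this]
    rw [this, add_zero]
  -- Only `x ∈ Ω` matters because `w` vanishes outside, and `Ω × ℝᴺ` lies in the interaction domain.
  have hgΩ : ∫⁻ x in Ω, g x ≤ gagliardo Ω s p w := by
    have hmeas : AEMeasurable (fun z : EuclideanSpace ℝ (Fin N) × EuclideanSpace ℝ (Fin N) =>
        ENNReal.ofReal (|w z.1 - w z.2| ^ p / ‖z.1 - z.2‖ ^ α))
        ((volume.restrict Ω).prod volume) := by
      have h1 : AEMeasurable (fun z : EuclideanSpace ℝ (Fin N) × EuclideanSpace ℝ (Fin N) =>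
          w z.1) ((volume.restrict Ω).prod volume) :=
        hw.restrict.comp_fst.aemeasurable
      have h2 : AEMeasurable (fun z : EuclideanSpace ℝ (Fin N) × EuclideanSpace ℝ (Fin N) =>
          w z.2) ((volume.restrict Ω).prod volume) := hw.comp_snd.aemeasurable
      have h3 : AEMeasurable (fun z : EuclideanSpace ℝ (Fin N) × EuclideanSpace ℝ (Fin N) =>
          |w z.1 - w z.2|) ((volume.restrict Ω).prod volume) :=
        measurable_abs.comp_aemeasurable (h1.sub h2)
      exact ((h3.pow_const p).div (by fun_prop)).ennreal_ofReal
    rw [← lintegral_prod _ hmeas, gagliardo]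
    refine lintegral_mono' ?_ le_rfl
    have : (volume.restrict Ω).prod (volume : Measure (EuclideanSpace ℝ (Fin N)))
        = (volume.prod volume).restrict (Ω ×ˢ univ) := by
      rw [← Measure.prod_restrict, Measure.restrict_univ]
    rw [this]
    exact Measure.restrict_mono (fun z hz => Or.inl hz.1) le_rfl
  have hmain : I ≤ ENNReal.ofReal ((2 * K) ^ (1 / θ)) * I ^ (1 - θ) * gagliardo Ω s p w := by
    have hBI : ENNReal.ofReal (B ^ ((1 - θ) / θ)) = I ^ (1 - θ) := by
      rw [← ENNReal.ofReal_rpow_of_nonneg hB0.le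
        (div_nonneg (by linarith) hθ0.le), hB, ENNReal.ofReal_toReal hIθ, ← ENNReal.rpow_mul,
        mul_div_cancel₀ _ hθ0.ne']
    calc I = ∫⁻ x in Ω, ‖w x‖ₑ ^ (p / θ) := hIΩ
      _ ≤ ∫⁻ x in Ω, ENNReal.ofReal ((2 * K) ^ (1 / θ) * B ^ ((1 - θ) / θ)) * g x :=
          lintegral_mono fun x => hpt x
      _ = ENNReal.ofReal ((2 * K) ^ (1 / θ) * B ^ ((1 - θ) / θ)) * ∫⁻ x in Ω, g x :=
          lintegral_const_mul' _ _ ENNReal.ofReal_ne_top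
      _ ≤ ENNReal.ofReal ((2 * K) ^ (1 / θ) * B ^ ((1 - θ) / θ)) * gagliardo Ω s p w := by
          gcongr
      _ = _ := by rw [ENNReal.ofReal_mul (by positivity), hBI]
  have hsplit : I = I ^ (1 - θ) * I ^ θ := by
    rw [← ENNReal.rpow_add _ _ hI0 hfin, sub_add_cancel, ENNReal.rpow_one]
  have hne0 : I ^ (1 - θ) ≠ 0 := by
    simp [ENNReal.rpow_eq_zero_iff, hI0, hfin]
  have hnet : I ^ (1 - θ) ≠ ⊤ := ENNReal.rpow_ne_top_of_nonneg (by linarith) hfin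
  have hmain' : I ^ (1 - θ) * I ^ θ
      ≤ I ^ (1 - θ) * (ENNReal.ofReal ((2 * K) ^ (1 / θ)) * gagliardo Ω s p w) := by
    calc I ^ (1 - θ) * I ^ θ = I := hsplit.symm
      _ ≤ _ := hmain
      _ = _ := by ring
  exact (ENNReal.mul_le_mul_iff_right hne0 hnet).1 hmain'

end Sobolev

/-! ### Primitives and the algebraic inequality behind the dissipation -/

/-- The primitive of `g` that vanishes at `0`. -/
def primitive (g : ℝ → ℝ) (a : ℝ) : ℝ := ∫ r in (0 : ℝ)..a, g r

section Primitive

variable {g : ℝ → ℝ}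

@[simp] theorem primitive_zero : primitive g 0 = 0 := by simp [primitive]

theorem primitive_sub (hg : Continuous g) (a b : ℝ) :
    primitive g a - primitive g b = ∫ r in b..a, g r :=
  intervalIntegral.integral_interval_sub_left (hg.intervalIntegrable _ _)
    (hg.intervalIntegrable _ _)

theorem hasDerivAt_primitive (hg : Continuous g) (a : ℝ) : HasDerivAt (primitive g) (g a) a :=
  intervalIntegral.integral_hasDerivAt_right (hg.intervalIntegrable _ _)
    hg.stronglyMeasurable.stronglyMeasurableAtFilter hg.continuousAt

theorem continuous_primitive' (hg : Continuous g) : Continuous (primitive g) :=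
  continuous_iff_continuousAt.2 fun a => (hasDerivAt_primitive hg a).continuousAt

theorem contDiff_primitive (hg : ContDiff ℝ ∞ g) : ContDiff ℝ ∞ (primitive g) := by
  rw [contDiff_infty_iff_deriv]
  refine ⟨fun a => (hasDerivAt_primitive hg.continuous a).differentiableAt, ?_⟩
  have : deriv (primitive g) = g := funext fun a => (hasDerivAt_primitive hg.continuous a).deriv
  rwa [this]

theorem monotone_primitive (hg : Continuous g) (h0 : ∀ a, 0 ≤ g a) : Monotone (primitive g) := by
  intro a b hab
  have := primitive_sub hg b a
  have h2 : 0 ≤ ∫ r in a..b, g r := intervalIntegral.integral_nonneg hab fun r _ => h0 r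
  linarith

theorem abs_primitive_sub_le (hg : Continuous g) {L : ℝ} (hL : ∀ a, |g a| ≤ L) (a b : ℝ) :
    |primitive g a - primitive g b| ≤ L * |a - b| := by
  rw [primitive_sub hg]
  exact intervalIntegral.norm_integral_le_of_norm_le_const (f := g) (C := L) fun r _ => hL r

theorem exists_abs_primitive_le (hg : Continuous g) (hc : HasCompactSupport g) :
    ∃ K : ℝ, 0 ≤ K ∧ ∀ a, |primitive g a| ≤ K := by
  refine ⟨∫ r, |g r|, integral_nonneg fun _ => abs_nonneg _, fun a => ?_⟩
  have hi : Integrable g := hg.integrable_of_hasCompactSupport hc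
  calc |primitive g a| ≤ ∫ r in uIoc 0 a, |g r| := 
        intervalIntegral.norm_integral_le_integral_norm_uIoc (f := g)
    _ ≤ ∫ r, |g r| := setIntegral_le_integral hi.abs (Eventually.of_forall fun _ => abs_nonneg _)

/-- This is the tangent inequality for the convex primitive of a monotone function; it replaces the
chain rule in time. -/
theorem primitive_sub_le_of_monotone (hg : Continuous g) (hm : Monotone g) (a b : ℝ) :
    primitive g a - primitive g b ≤ g a * (a - b) := by
  rw [primitive_sub hg]
  rcases le_total b a with h | h
  · calc ∫ r in b..a, g r ≤ ∫ _ in b..a, g a :=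
          intervalIntegral.integral_mono_on h (hg.intervalIntegrable _ _) (by simp)
            fun r hr => hm hr.2
      _ = _ := by simp [mul_comm]
  · rw [intervalIntegral.integral_symm]
    have : ∫ _ in a..b, g a ≤ ∫ r in a..b, g r :=
      intervalIntegral.integral_mono_on h (by simp) (hg.intervalIntegrable _ _)
        fun r hr => hm hr.1
    simp only [intervalIntegral.integral_const, smul_eq_mul] at this
    linarith

theorem primitive_nonneg_of_monotone (hg : Continuous g) (hm : Monotone g) (h0 : g 0 = 0)
    (a : ℝ) : 0 ≤ primitive g a := by
  have := primitive_sub_le_of_monotone hg hm 0 a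
  simp only [primitive_zero, h0, zero_mul] at this
  linarith

theorem primitive_neg_of_even (h : ∀ a, g (-a) = g a) (a : ℝ) :
    primitive g (-a) = - primitive g a := by
  have := intervalIntegral.integral_comp_neg (a := 0) (b := a) g
  simp only [h, neg_zero] at this
  rw [primitive, primitive, this, intervalIntegral.integral_symm]

theorem primitive_neg_of_odd (h : ∀ a, g (-a) = - g a) (a : ℝ) :
    primitive g (-a) = primitive g a := by
  have := intervalIntegral.integral_comp_neg (a := 0) (b := a) g
  simp only [h, neg_zero, intervalIntegral.integral_neg] at this
  rw [primitive, primitive, intervalIntegral.integral_symm, ← this, neg_neg]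

/-- Hölder's inequality for `g^(1/p)` against 1 on the interval from `b` to `a`; the length enters
with exponent `p/p' = p - 1`. -/
theorem rpow_primitive_sub_le {p : ℝ} (hp : 1 < p) (hg : Continuous g) (h0 : ∀ a, 0 ≤ g a)
    {a b : ℝ} (hab : b < a) :
    (primitive (fun r => g r ^ (1 / p)) a - primitive (fun r => g r ^ (1 / p)) b) ^ p
      ≤ (a - b) ^ (p - 1) * (primitive g a - primitive g b) := by
  have hp0 : 0 < p := by linarith
  have hgp : Continuous fun r => g r ^ (1 / p) := by
    refine hg.rpow_const fun r => Or.inr ?_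
    positivity
  rw [primitive_sub hgp, primitive_sub hg, intervalIntegral.integral_of_le hab.le,
    intervalIntegral.integral_of_le hab.le]
  set μ : Measure ℝ := volume.restrict (Ioc b a) with hμ
  have hc := Real.HolderConjugate.conjExponent hp
  set q := p.conjExponent
  have hmem : ∀ {f : ℝ → ℝ} {r : ℝ≥0∞}, Continuous f → MemLp f r μ := by
    intro f r hf
    obtain ⟨C, hC⟩ := isCompact_Icc.exists_bound_of_continuousOn (s := Icc b a) hf.continuousOn
    refine MemLp.of_bound hf.aestronglyMeasurable C ?_
    refine (ae_restrict_iff' measurableSet_Ioc).2 (Eventually.of_forall fun x hx => ?_)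
    exact hC x (Ioc_subset_Icc_self hx)
  have h := integral_mul_le_Lp_mul_Lq_of_nonneg (μ := μ) hc
    (f := fun r => g r ^ (1 / p)) (g := fun _ => 1)
    (Eventually.of_forall fun r => Real.rpow_nonneg (h0 r) _)
    (Eventually.of_forall fun r => zero_le_one) (hmem hgp) (hmem continuous_const)
  have e1 : ∀ r, (g r ^ (1 / p)) ^ p = g r := fun r => by
    rw [← Real.rpow_mul (h0 r), one_div_mul_cancel hp0.ne', Real.rpow_one]
  simp only [mul_one, e1, Real.one_rpow, integral_const, smul_eq_mul] at h
  have e2 : μ.real univ = a - b := by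
    rw [hμ, measureReal_restrict_apply_univ, Real.volume_real_Ioc_of_le hab.le]
  rw [e2] at h
  have hI : 0 ≤ ∫ r, g r ∂μ := integral_nonneg h0
  have hab' : 0 < a - b := sub_pos.2 hab
  calc (∫ r, g r ^ (1 / p) ∂μ) ^ p
      ≤ ((∫ r, g r ∂μ) ^ (1 / p) * (a - b) ^ (1 / q)) ^ p :=
        Real.rpow_le_rpow (integral_nonneg fun r => Real.rpow_nonneg (h0 r) _) h hp0.le
    _ = (a - b) ^ (p - 1) * ∫ r, g r ∂μ := by
        rw [Real.mul_rpow (by positivity) (by positivity), ← Real.rpow_mul hI,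
          ← Real.rpow_mul hab'.le, one_div_mul_cancel hp0.ne', Real.rpow_one, mul_comm]
        congr 2
        have h1 := hc.inv_add_inv_eq_one
        have h2 : q⁻¹ = 1 - p⁻¹ := by linarith
        rw [one_div, h2, sub_mul, inv_mul_cancel₀ hp0.ne', one_mul]

/-- The algebraic inequality behind testing the equation with a monotone function of the
solution. -/
theorem abs_primitive_sub_rpow_le {p : ℝ} (hp : 1 < p) (hg : Continuous g) (h0 : ∀ a, 0 ≤ g a)
    (a b : ℝ) :
    |primitive (fun r => g r ^ (1 / p)) a - primitive (fun r => g r ^ (1 / p)) b| ^ p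
      ≤ signedPow p (a - b) * (primitive g a - primitive g b) := by
  have hp0 : 0 < p := by linarith
  have hgp : Continuous fun r => g r ^ (1 / p) := by
    refine hg.rpow_const fun r => Or.inr ?_
    positivity
  have hmono := monotone_primitive hgp fun r => Real.rpow_nonneg (h0 r) _
  have key : ∀ {a b : ℝ}, b < a → |primitive (fun r => g r ^ (1 / p)) a
      - primitive (fun r => g r ^ (1 / p)) b| ^ p
      ≤ signedPow p (a - b) * (primitive g a - primitive g b) := by
    intro a b hab
    have hab' : 0 < a - b := sub_pos.2 hab
    rw [abs_of_nonneg (sub_nonneg.2 (hmono hab.le))]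
    refine (rpow_primitive_sub_le hp hg h0 hab).trans (le_of_eq ?_)
    congr 1
    rw [signedPow, abs_of_pos hab']
    nth_rewrite 3 [← Real.rpow_one (a - b)]
    rw [← Real.rpow_add hab']
    congr 1
    ring
  rcases lt_trichotomy a b with h | rfl | h
  · have := key h
    rw [abs_sub_comm]
    refine this.trans (le_of_eq ?_)
    rw [signedPow, signedPow, abs_sub_comm]
    ring
  · simp [hp0.ne']
  · exact key h

end Primitive

/-! ### Smooth truncations of the power -/

/-- Smooth compactly supported approximations of `ν |a|^(ν - 1)`. -/
def cutoffPow (ν : ℝ) (k : ℕ) (a : ℝ) : ℝ :=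
  ν * (a ^ 2) ^ ((ν - 1) / 2) * Real.smoothTransition (k * a ^ 2 - 1)
    * Real.smoothTransition (k + 1 - a ^ 2)

section CutoffPow

variable {ν : ℝ}

theorem sq_rpow_half (a β : ℝ) : (a ^ 2) ^ (β / 2) = |a| ^ β := by
  rw [← sq_abs, ← Real.rpow_natCast, ← Real.rpow_mul (abs_nonneg _)]
  congr 1
  push_cast
  ring

theorem cutoffPow_neg (k : ℕ) (a : ℝ) : cutoffPow ν k (-a) = cutoffPow ν k a := by
  simp [cutoffPow]

theorem cutoffPow_nonneg (hν : 0 ≤ ν) (k : ℕ) (a : ℝ) : 0 ≤ cutoffPow ν k a := by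
  have h1 := Real.smoothTransition.nonneg (k * a ^ 2 - 1)
  have h2 := Real.smoothTransition.nonneg (k + 1 - a ^ 2)
  unfold cutoffPow
  positivity

theorem cutoffPow_le (hν : 0 ≤ ν) (k : ℕ) (a : ℝ) : cutoffPow ν k a ≤ ν * |a| ^ (ν - 1) := by
  rw [← sq_rpow_half, cutoffPow, mul_assoc]
  refine mul_le_of_le_one_right (by positivity) ?_
  exact mul_le_one₀ (Real.smoothTransition.le_one _) (Real.smoothTransition.nonneg _)
    (Real.smoothTransition.le_one _)

theorem tendsto_cutoffPow (hν : 1 < ν) (a : ℝ) :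
    Tendsto (fun k => cutoffPow ν k a) atTop (𝓝 (ν * |a| ^ (ν - 1))) := by
  -- The sequence is eventually constant: both cutoffs equal 1 once `k ≥ 2/a²` and `k ≥ a²`, and at
  -- `a = 0` every term vanishes.
  refine tendsto_const_nhds.congr' ?_
  rcases eq_or_ne a 0 with rfl | ha
  · refine Eventually.of_forall fun k => ?_
    have h1 : ν - 1 ≠ 0 := by linarith
    simp [cutoffPow, h1]
  · have ha2 : 0 < a ^ 2 := by positivity
    have h1 : ∀ᶠ k : ℕ in atTop, 2 / a ^ 2 ≤ k := tendsto_natCast_atTop_atTop.eventually_ge_atTop _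
    have h2 : ∀ᶠ k : ℕ in atTop, a ^ 2 ≤ k := tendsto_natCast_atTop_atTop.eventually_ge_atTop _
    filter_upwards [h1, h2] with k hk1 hk2
    rw [div_le_iff₀ ha2] at hk1
    rw [cutoffPow, Real.smoothTransition.one_of_one_le (by linarith),
      Real.smoothTransition.one_of_one_le (by linarith), sq_rpow_half, mul_one, mul_one]

/-- The only possible singularity is at 0, and there the inner cutoff vanishes on the neighbourhood
`k a² < 1`. -/
theorem contDiff_cutoffPow (k : ℕ) : ContDiff ℝ ∞ (cutoffPow ν k) := by
  rw [contDiff_iff_contDiffAt]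
  intro a
  rcases eq_or_ne a 0 with rfl | ha
  · refine (contDiffAt_const (c := (0 : ℝ))).congr_of_eventuallyEq ?_
    have : ∀ᶠ x : ℝ in 𝓝 0, k * x ^ 2 - 1 < 0 := by
      refine ContinuousAt.eventually_lt (by fun_prop) continuousAt_const ?_
      simp
    filter_upwards [this] with x hx
    rw [cutoffPow, Real.smoothTransition.zero_of_nonpos hx.le, mul_zero, zero_mul]
  · have h1 : ContDiffAt ℝ ∞ (fun a : ℝ => (a ^ 2) ^ ((ν - 1) / 2)) a :=
      (contDiffAt_id.pow 2).rpow_const_of_ne (by positivity)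
    have h2 : ContDiffAt ℝ ∞ (fun a : ℝ => Real.smoothTransition (k * a ^ 2 - 1)) a :=
      (Real.smoothTransition.contDiff (n := ⊤)).contDiffAt.comp a (by fun_prop)
    have h3 : ContDiffAt ℝ ∞ (fun a : ℝ => Real.smoothTransition (k + 1 - a ^ 2)) a :=
      (Real.smoothTransition.contDiff (n := ⊤)).contDiffAt.comp a (by fun_prop)
    exact ((contDiffAt_const.mul h1).mul h2).mul h3

theorem hasCompactSupport_cutoffPow (k : ℕ) : HasCompactSupport (cutoffPow ν k) := by
  refine HasCompactSupport.intro (isCompact_Icc (a := -((k : ℝ) + 1)) (b := k + 1)) fun x hx => ?_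
  rw [cutoffPow, Real.smoothTransition.zero_of_nonpos (x := (k : ℝ) + 1 - x ^ 2), mul_zero]
  have hk : (0 : ℝ) ≤ k := Nat.cast_nonneg k
  have h : (k : ℝ) + 1 < |x| := by
    by_contra! h
    exact hx (abs_le.1 h)
  rw [← sq_abs]
  nlinarith

end CutoffPow

/-! ### Convergence of the truncated energies and dissipation roots -/

section Limits

theorem tendsto_primitive {f : ℝ → ℝ} {g : ℕ → ℝ → ℝ} (hf : Continuous f)
    (hg : ∀ k, Continuous (g k)) (hle : ∀ k, ∀ r, 0 ≤ r → |g k r| ≤ f r)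
    (hlim : ∀ r, 0 ≤ r → Tendsto (fun k => g k r) atTop (𝓝 (f r))) {a : ℝ} (ha : 0 ≤ a) :
    Tendsto (fun k => primitive (g k) a) atTop (𝓝 (primitive f a)) := by
  refine intervalIntegral.tendsto_integral_filter_of_dominated_convergence f
    (Eventually.of_forall fun k => (hg k).aestronglyMeasurable)
    (Eventually.of_forall fun k => Eventually.of_forall fun x hx => hle k x ?_)
    (hf.intervalIntegrable _ _) (Eventually.of_forall fun x hx => hlim x ?_)
  all_goals
    rw [uIoc_of_le ha] at hx
    exact hx.1.le

theorem abs_primitive_le_primitive {f g : ℝ → ℝ} (hf : Continuous f) (hg : Continuous g)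
    (hle : ∀ r, 0 ≤ r → |g r| ≤ f r) {a : ℝ} (ha : 0 ≤ a) :
    |primitive g a| ≤ primitive f a := by
  refine (intervalIntegral.abs_integral_le_integral_abs ha).trans ?_
  exact intervalIntegral.integral_mono_on ha (hg.abs.intervalIntegrable _ _)
    (hf.intervalIntegrable _ _) fun x hx => hle x hx.1

theorem primitive_mul_abs_rpow (c : ℝ) {β : ℝ} (hβ : 0 ≤ β) {a : ℝ} (ha : 0 ≤ a) :
    primitive (fun r => c * |r| ^ β) a = c / (β + 1) * |a| ^ (β + 1) := by
  have : primitive (fun r => c * |r| ^ β) a = ∫ r in (0 : ℝ)..a, c * r ^ β := by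
    refine intervalIntegral.integral_congr fun r hr => ?_
    rw [uIcc_of_le ha] at hr
    simp only [abs_of_nonneg hr.1]
  rw [this, intervalIntegral.integral_const_mul, integral_rpow (Or.inl (by linarith)),
    Real.zero_rpow (by linarith), sub_zero, abs_of_nonneg ha]
  ring

theorem continuous_mul_abs_rpow (c : ℝ) {β : ℝ} (hβ : 0 ≤ β) :
    Continuous fun r : ℝ => c * |r| ^ β :=
  continuous_const.mul (continuous_abs.rpow_const fun _ => Or.inr hβ)

variable {ν : ℝ}

/-- The convex energy density, an approximation of `|a|^(ν + 1) / (ν + 1)`. -/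
def energyDensity (ν : ℝ) (k : ℕ) : ℝ → ℝ := primitive (primitive (cutoffPow ν k))

/-- The function to which the Sobolev inequality is applied, an approximation of a multiple of
`|a|^((ν - 1) / p) a`. -/
def dissipationRoot (p ν : ℝ) (k : ℕ) : ℝ → ℝ := primitive fun r => cutoffPow ν k r ^ (1 / p)

/-- Since the truncated power is even, its double primitive is even. Bounds and limits then need to
be proved on the half-line only. -/
theorem energyDensity_abs (k : ℕ) (a : ℝ) : energyDensity ν k |a| = energyDensity ν k a := by
  rcases abs_choice a with h | h
  · rw [h]
  · rw [h, energyDensity, primitive_neg_of_odd]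
    exact primitive_neg_of_even (cutoffPow_neg k)

theorem abs_dissipationRoot_abs (p : ℝ) (k : ℕ) (a : ℝ) :
    |dissipationRoot p ν k (|a|)| = |dissipationRoot p ν k a| := by
  rcases abs_choice a with h | h
  · rw [h]
  · rw [h, dissipationRoot, primitive_neg_of_even, abs_neg]
    intro r
    rw [cutoffPow_neg]

theorem abs_primitive_cutoffPow_le (hν : 1 < ν) (k : ℕ) {a : ℝ} (ha : 0 ≤ a) :
    |primitive (cutoffPow ν k) a| ≤ 1 * |a| ^ ν := by
  have h := abs_primitive_le_primitive (continuous_mul_abs_rpow ν (β := ν - 1) (by linarith))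
    (contDiff_cutoffPow (ν := ν) k).continuous (fun r _ => by
      rw [abs_of_nonneg (cutoffPow_nonneg (by linarith) k r)]
      exact cutoffPow_le (by linarith) k r) ha
  rwa [primitive_mul_abs_rpow _ (by linarith) ha, sub_add_cancel, div_self (by linarith)] at h

theorem tendsto_primitive_cutoffPow (hν : 1 < ν) {a : ℝ} (ha : 0 ≤ a) :
    Tendsto (fun k => primitive (cutoffPow ν k) a) atTop (𝓝 (1 * |a| ^ ν)) := by
  have h := tendsto_primitive (continuous_mul_abs_rpow ν (β := ν - 1) (by linarith))
    (fun k => (contDiff_cutoffPow (ν := ν) k).continuous) (fun k r _ => by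
      rw [abs_of_nonneg (cutoffPow_nonneg (by linarith) k r)]
      exact cutoffPow_le (by linarith) k r) (fun r _ => tendsto_cutoffPow hν r) ha
  rwa [primitive_mul_abs_rpow _ (by linarith) ha, sub_add_cancel, div_self (by linarith)] at h

theorem continuous_primitive_cutoffPow (k : ℕ) : Continuous (primitive (cutoffPow ν k)) :=
  continuous_primitive' (contDiff_cutoffPow k).continuous

theorem energyDensity_nonneg (hν : 1 < ν) (k : ℕ) (a : ℝ) : 0 ≤ energyDensity ν k a :=
  primitive_nonneg_of_monotone (continuous_primitive_cutoffPow k)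
    (monotone_primitive (contDiff_cutoffPow k).continuous
      fun r => cutoffPow_nonneg (by linarith) k r) primitive_zero a

theorem energyDensity_le (hν : 1 < ν) (k : ℕ) (a : ℝ) :
    energyDensity ν k a ≤ 1 / (ν + 1) * |a| ^ (ν + 1) := by
  have h := abs_primitive_le_primitive (continuous_mul_abs_rpow 1 (β := ν) (by linarith))
    (continuous_primitive_cutoffPow (ν := ν) k)
    (fun r hr => abs_primitive_cutoffPow_le hν k hr) (abs_nonneg a)
  rw [primitive_mul_abs_rpow _ (by linarith) (abs_nonneg a), abs_abs] at h
  rw [← energyDensity_abs]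
  exact (le_abs_self _).trans h

theorem tendsto_energyDensity (hν : 1 < ν) (a : ℝ) :
    Tendsto (fun k => energyDensity ν k a) atTop (𝓝 (1 / (ν + 1) * |a| ^ (ν + 1))) := by
  have h := tendsto_primitive (continuous_mul_abs_rpow 1 (β := ν) (by linarith))
    (fun k => continuous_primitive_cutoffPow (ν := ν) k)
    (fun k r hr => abs_primitive_cutoffPow_le hν k hr)
    (fun r hr => tendsto_primitive_cutoffPow hν hr) (abs_nonneg a)
  rw [primitive_mul_abs_rpow _ (by linarith) (abs_nonneg a), abs_abs] at h
  exact h.congr fun k => energyDensity_abs k a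

variable {p : ℝ}

theorem continuous_cutoffPow_rpow (hp : 0 < p) (k : ℕ) :
    Continuous fun r => cutoffPow ν k r ^ (1 / p) :=
  (contDiff_cutoffPow k).continuous.rpow_const fun _ => Or.inr (by positivity)

theorem cutoffPow_rpow_le (hp : 0 < p) (hν : 1 < ν) (k : ℕ) (r : ℝ) :
    |cutoffPow ν k r ^ (1 / p)| ≤ ν ^ (1 / p) * |r| ^ ((ν - 1) / p) := by
  have h0 := cutoffPow_nonneg (ν := ν) (by linarith) k r
  rw [abs_of_nonneg (Real.rpow_nonneg h0 _)]
  refine (Real.rpow_le_rpow h0 (cutoffPow_le (by linarith) k r) (by positivity)).trans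
    (le_of_eq ?_)
  rw [Real.mul_rpow (by linarith) (by positivity), ← Real.rpow_mul (abs_nonneg _), mul_one_div]

theorem tendsto_cutoffPow_rpow (hp : 0 < p) (hν : 1 < ν) (r : ℝ) :
    Tendsto (fun k => cutoffPow ν k r ^ (1 / p)) atTop
      (𝓝 (ν ^ (1 / p) * |r| ^ ((ν - 1) / p))) := by
  have := (tendsto_cutoffPow hν r).rpow_const (p := 1 / p) (Or.inr (by positivity))
  rwa [Real.mul_rpow (by linarith) (by positivity), ← Real.rpow_mul (abs_nonneg _),
    mul_one_div] at this

theorem abs_dissipationRoot_le (hp : 0 < p) (hν : 1 < ν) (k : ℕ) (a : ℝ) :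
    |dissipationRoot p ν k a|
      ≤ ν ^ (1 / p) / ((ν - 1) / p + 1) * |a| ^ ((ν - 1) / p + 1) := by
  have hβ : 0 ≤ (ν - 1) / p := div_nonneg (by linarith) hp.le
  have h := abs_primitive_le_primitive (continuous_mul_abs_rpow (ν ^ (1 / p)) hβ)
    (continuous_cutoffPow_rpow (ν := ν) hp k)
    (fun r _ => cutoffPow_rpow_le hp hν k r) (abs_nonneg a)
  rw [primitive_mul_abs_rpow _ hβ (abs_nonneg a), abs_abs] at h
  rw [← abs_dissipationRoot_abs]
  exact h

theorem tendsto_abs_dissipationRoot (hp : 0 < p) (hν : 1 < ν) (a : ℝ) :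
    Tendsto (fun k => |dissipationRoot p ν k a|) atTop
      (𝓝 (ν ^ (1 / p) / ((ν - 1) / p + 1) * |a| ^ ((ν - 1) / p + 1))) := by
  have hβ : 0 ≤ (ν - 1) / p := div_nonneg (by linarith) hp.le
  have h := tendsto_primitive (continuous_mul_abs_rpow (ν ^ (1 / p)) hβ)
    (fun k => continuous_cutoffPow_rpow (ν := ν) hp k)
    (fun k r _ => cutoffPow_rpow_le hp hν k r)
    (fun r _ => tendsto_cutoffPow_rpow hp hν r) (abs_nonneg a)
  rw [primitive_mul_abs_rpow _ hβ (abs_nonneg a), abs_abs] at h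
  have h' := h.abs
  have h0 : 0 ≤ ν ^ (1 / p) / ((ν - 1) / p + 1) * |a| ^ ((ν - 1) / p + 1) := by
    have : 0 < ν := by linarith
    positivity
  rw [abs_of_nonneg h0] at h'
  exact h'.congr fun k => abs_dissipationRoot_abs p k a

end Limits

/-! ### Test functions and finiteness of their Gagliardo energy -/

section TestFunctions

variable {N : ℕ} {Ω : Set (EuclideanSpace ℝ (Fin N))} {s p : ℝ}
  {w ψ : EuclideanSpace ℝ (Fin N) → ℝ}

/-- Majorant of the Gagliardo integrand of a bounded Lipschitz function. -/
def radialMajorant (N : ℕ) (s p A B r : ℝ) : ℝ :=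
  if r < 1 then A * r ^ (p - ((N : ℝ) + p * s)) else B * r ^ (-((N : ℝ) + p * s))

theorem measurable_radialMajorant {A B : ℝ} : Measurable (radialMajorant N s p A B) :=
  Measurable.ite measurableSet_Iio (by fun_prop) (by fun_prop)

/-- In polar coordinates the exponents become `p(1-s) - 1 > -1` near the origin, by `s < 1`, and `-1
- ps < -1` at infinity, by `s > 0`. -/
theorem integrable_radialMajorant [NeZero N] (hs0 : 0 < s) (hs1 : s < 1) (hp : 0 < p) (A B : ℝ) :
    Integrable (fun x : EuclideanSpace ℝ (Fin N) => radialMajorant N s p A B ‖x‖) := by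
  rw [integrable_fun_norm_addHaar (μ := volume) (f := radialMajorant N s p A B), finrank_euclideanSpace,
    Fintype.card_fin, ← Ioo_union_Ici_eq_Ioi (zero_lt_one' ℝ)]
  have hN : 1 ≤ N := Nat.one_le_iff_ne_zero.2 (NeZero.ne N)
  refine IntegrableOn.union ?_ ?_
  · have h : IntegrableOn (fun r : ℝ => A * r ^ (p * (1 - s) - 1)) (Ioo 0 1) := by
      refine Integrable.const_mul ?_ A
      refine (intervalIntegral.integrableOn_Ioo_rpow_iff zero_lt_one).2 ?_
      nlinarith
    refine h.congr_fun (fun r hr => ?_) measurableSet_Ioo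
    simp only [radialMajorant, if_pos hr.2, smul_eq_mul]
    rw [← Real.rpow_natCast, mul_left_comm, ← Real.rpow_add hr.1]
    congr 2
    push_cast [Nat.cast_sub hN]
    ring
  · have h : IntegrableOn (fun r : ℝ => B * r ^ (-1 - p * s)) (Ici 1) := by
      rw [integrableOn_Ici_iff_integrableOn_Ioi]
      refine Integrable.const_mul ?_ B
      refine integrableOn_Ioi_rpow_of_lt ?_ zero_lt_one
      nlinarith
    refine h.congr_fun (fun r hr => ?_) measurableSet_Ici
    have hr0 : (0 : ℝ) < r := zero_lt_one.trans_le hr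
    simp only [radialMajorant, if_neg (not_lt.2 (mem_Ici.1 hr)), smul_eq_mul]
    rw [← Real.rpow_natCast, mul_left_comm, ← Real.rpow_add hr0]
    congr 2
    push_cast [Nat.cast_sub hN]
    ring

/-- The Lipschitz bound is used at distance below 1 and the sup bound beyond. The resulting majorant
depends on `x - y` only, and each of `Ω × ℝᴺ` and `ℝᴺ × Ω` contributes `|Ω|` times its integral. -/
theorem gagliardo_lt_top_of_lipschitz [NeZero N] (hΩv : volume Ω < ⊤)
    (hs0 : 0 < s) (hs1 : s < 1) (hp : 0 < p) {L M : ℝ} (hL0 : 0 ≤ L)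
    (hL : ∀ x y, |ψ x - ψ y| ≤ L * ‖x - y‖) (hM : ∀ x, |ψ x| ≤ M) :
    gagliardo Ω s p ψ < ⊤ := by
  set k : EuclideanSpace ℝ (Fin N) → ℝ≥0∞ :=
    fun x => ENNReal.ofReal (radialMajorant N s p (L ^ p) ((2 * M) ^ p) ‖x‖) with hk
  have hkm : Measurable k := (measurable_radialMajorant.comp measurable_norm).ennreal_ofReal
  have hkfin : ∫⁻ x, k x < ⊤ :=
    (integrable_radialMajorant hs0 hs1 hp (L ^ p) ((2 * M) ^ p)).lintegral_lt_top
  have hkm2 : Measurable fun z : EuclideanSpace ℝ (Fin N) × EuclideanSpace ℝ (Fin N) =>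
      k (z.1 - z.2) := hkm.comp (measurable_fst.sub measurable_snd)
  have hM0 : 0 ≤ M := (abs_nonneg _).trans (hM 0)
  have hle : ∀ z : EuclideanSpace ℝ (Fin N) × EuclideanSpace ℝ (Fin N),
      ENNReal.ofReal (|ψ z.1 - ψ z.2| ^ p / ‖z.1 - z.2‖ ^ ((N : ℝ) + p * s)) ≤ k (z.1 - z.2) := by
    intro z
    refine ENNReal.ofReal_le_ofReal ?_
    rcases (norm_nonneg (z.1 - z.2)).eq_or_lt with h0 | h0
    · have : z.1 = z.2 := sub_eq_zero.1 (norm_eq_zero.1 h0.symm)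
      rw [this, sub_self, abs_zero, Real.zero_rpow hp.ne', zero_div, sub_self, norm_zero,
        radialMajorant, if_pos one_pos]
      positivity
    · set d := ‖z.1 - z.2‖
      unfold radialMajorant
      split_ifs with h1
      · rw [Real.rpow_sub h0, mul_div_assoc', ← Real.mul_rpow hL0 h0.le]
        gcongr
        exact hL _ _
      · rw [Real.rpow_neg h0.le, div_eq_mul_inv]
        gcongr
        calc |ψ z.1 - ψ z.2| ≤ |ψ z.1| + |ψ z.2| := abs_sub _ _
          _ ≤ 2 * M := by linarith [hM z.1, hM z.2]
  have hD : interactionDomain Ω = Ω ×ˢ univ ∪ univ ×ˢ Ω := by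
    ext z; simp [interactionDomain]
  have h1 : ∫⁻ z in Ω ×ˢ (univ : Set (EuclideanSpace ℝ (Fin N))), k (z.1 - z.2)
      = volume Ω * ∫⁻ x, k x := by
    rw [Measure.volume_eq_prod, ← Measure.prod_restrict, Measure.restrict_univ,
      lintegral_prod _ hkm2.aemeasurable]
    simp only [lintegral_sub_left_eq_self k, lintegral_const, Measure.restrict_apply_univ]
    rw [mul_comm]
  have h2 : ∫⁻ z in (univ : Set (EuclideanSpace ℝ (Fin N))) ×ˢ Ω, k (z.1 - z.2)
      = volume Ω * ∫⁻ x, k x := by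
    rw [Measure.volume_eq_prod, ← Measure.prod_restrict, Measure.restrict_univ,
      lintegral_prod_symm _ hkm2.aemeasurable]
    simp only [lintegral_sub_right_eq_self k, lintegral_const, Measure.restrict_apply_univ]
    rw [mul_comm]
  calc gagliardo Ω s p ψ ≤ ∫⁻ z in interactionDomain Ω, k (z.1 - z.2) :=
        lintegral_mono fun z => hle z
    _ ≤ (volume Ω * ∫⁻ x, k x) + volume Ω * ∫⁻ x, k x := by
        rw [hD]
        refine (lintegral_union_le _ _ _).trans ?_
        rw [h1, h2]
    _ < ⊤ := by
        rw [ENNReal.add_lt_top]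
        exact ⟨ENNReal.mul_lt_top hΩv hkfin, ENNReal.mul_lt_top hΩv hkfin⟩

/-- Test functions `C_c^∞(Ω)`. -/
structure IsTest (Ω : Set (EuclideanSpace ℝ (Fin N))) (ψ : EuclideanSpace ℝ (Fin N) → ℝ) :
    Prop where
  contDiff : ContDiff ℝ ∞ ψ
  hasCompactSupport : HasCompactSupport ψ
  tsupport_subset : tsupport ψ ⊆ Ω

theorem IsTest.eq_zero (h : IsTest Ω ψ) {x : EuclideanSpace ℝ (Fin N)} (hx : x ∉ Ω) : ψ x = 0 :=
  image_eq_zero_of_notMem_tsupport fun h' => hx (h.tsupport_subset h')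

theorem IsTest.exists_abs_le (h : IsTest Ω ψ) : ∃ M : ℝ, ∀ x, |ψ x| ≤ M :=
  h.hasCompactSupport.exists_bound_of_continuous h.contDiff.continuous

theorem IsTest.gagliardo_lt_top [NeZero N] (h : IsTest Ω ψ)
    (hΩv : volume Ω < ⊤) (hs0 : 0 < s) (hs1 : s < 1) (hp : 0 < p) :
    gagliardo Ω s p ψ < ⊤ := by
  obtain ⟨M, hM⟩ := h.exists_abs_le
  obtain ⟨L, hL⟩ := ContDiff.lipschitzWith_of_hasCompactSupport h.hasCompactSupport h.contDiff
    (by simp)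
  refine gagliardo_lt_top_of_lipschitz hΩv hs0 hs1 hp L.2 (fun x y => ?_) hM
  have := hL.dist_le_mul x y
  rwa [dist_eq_norm, dist_eq_norm] at this

theorem IsTest.const_mul (h : IsTest Ω ψ) (c : ℝ) : IsTest Ω fun x => c * ψ x where
  contDiff := contDiff_const.mul h.contDiff
  hasCompactSupport := h.hasCompactSupport.mul_left
  tsupport_subset := (tsupport_mul_subset_right (f := fun _ => c) (g := ψ)).trans h.tsupport_subset

/-- This stability is the reason for smooth truncations: composing the approximants of an element of
`W₀^{s,p}` with `h` gives test functions again. -/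
theorem IsTest.comp (h : IsTest Ω ψ) {f : ℝ → ℝ} (hf : ContDiff ℝ ∞ f) (h0 : f 0 = 0) :
    IsTest Ω (f ∘ ψ) where
  contDiff := hf.comp h.contDiff
  hasCompactSupport := h.hasCompactSupport.comp_left h0
  tsupport_subset := (closure_mono (Function.support_comp_subset h0 ψ)).trans h.tsupport_subset

theorem gagliardo_zero (hp : 0 < p) : gagliardo Ω s p (0 : EuclideanSpace ℝ (Fin N) → ℝ) = 0 := by
  simp [gagliardo, Real.zero_rpow hp.ne']

theorem IsTest.memW0 (h : IsTest Ω ψ) (hΩ : MeasurableSet Ω) (hp : 0 < p) : MemW0 Ω s p ψ where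
  memLp := h.contDiff.continuous.memLp_of_hasCompactSupport h.hasCompactSupport
  eq_zero_outside :=
    (ae_restrict_iff' hΩ.compl).2 (Eventually.of_forall fun _ hx => h.eq_zero hx)
  approx := ⟨fun _ => ψ, fun _ => ⟨h.contDiff, h.hasCompactSupport, h.tsupport_subset⟩,
    by simp, by simp [gagliardo_zero hp]⟩

theorem wdiff_const_mul (c : ℝ) : wdiff Ω s p (fun x => c * w x) = fun z => c * wdiff Ω s p w z := by
  ext z
  by_cases hz : z ∈ interactionDomain Ω
  · simp only [wdiff, indicator_of_mem hz]; ring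
  · simp [wdiff, indicator_of_notMem hz]

theorem wdiff_sub (v : EuclideanSpace ℝ (Fin N) → ℝ) :
    wdiff Ω s p (w - v) = wdiff Ω s p w - wdiff Ω s p v := by
  ext z
  by_cases hz : z ∈ interactionDomain Ω
  · simp only [wdiff, Pi.sub_apply, indicator_of_mem hz]; ring
  · simp [wdiff, indicator_of_notMem hz]

theorem gagliardo_const_mul (hΩ : MeasurableSet Ω) (hp : 0 < p) (c : ℝ) :
    gagliardo Ω s p (fun x => c * w x) = ‖c‖ₑ ^ p * gagliardo Ω s p w := by
  rw [gagliardo_eq_lintegral_wdiff hΩ hp, gagliardo_eq_lintegral_wdiff hΩ hp, wdiff_const_mul,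
    ← lintegral_const_mul' _ _ (by simp [hp.le])]
  refine lintegral_congr fun z => ?_
  rw [enorm_mul, ENNReal.mul_rpow_of_nonneg _ _ hp.le]

theorem IsTest.memParabolic [NeZero N] (h : IsTest Ω ψ) (hΩ : MeasurableSet Ω)
    (hΩv : volume Ω < ⊤) (hs0 : 0 < s) (hs1 : s < 1) (hp : 0 < p) {T : ℝ} {η : ℝ → ℝ}
    (hη : Continuous η) (hηc : HasCompactSupport η) :
    MemParabolic Ω s p T fun t x => η t * ψ x where
  memLp := by
    refine Continuous.memLp_of_hasCompactSupport ?_ ?_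
    · exact (hη.comp continuous_fst).mul (h.contDiff.continuous.comp continuous_snd)
    · refine HasCompactSupport.intro (hηc.isCompact.prod h.hasCompactSupport.isCompact) ?_
      rintro ⟨t, x⟩ hz
      simp only [Function.uncurry]
      by_contra hne
      exact hz ⟨subset_tsupport _ (left_ne_zero_of_mul hne),
        subset_tsupport _ (right_ne_zero_of_mul hne)⟩
  memW0 := Eventually.of_forall fun t => (h.const_mul (η t)).memW0 hΩ hp
  finite := by
    obtain ⟨M, hM⟩ := hηc.exists_bound_of_continuous hη
    have hle : ∀ t, gagliardo Ω s p (fun x => η t * ψ x)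
        ≤ ENNReal.ofReal M ^ p * gagliardo Ω s p ψ := by
      intro t
      rw [gagliardo_const_mul hΩ hp]
      gcongr
      rw [Real.enorm_eq_ofReal_abs]
      exact ENNReal.ofReal_le_ofReal (hM t)
    refine (lintegral_mono hle).trans_lt ?_
    rw [lintegral_const]
    refine ENNReal.mul_lt_top (ENNReal.mul_lt_top
      (ENNReal.rpow_lt_top_of_nonneg hp.le ENNReal.ofReal_ne_top)
      (h.gagliardo_lt_top hΩv hs0 hs1 hp)) ?_
    simp

end TestFunctions

/-! ### From weak derivatives in time to the fundamental theorem of calculus -/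

section WeakDerivative

theorem deriv_smoothTransition_of_neg {x : ℝ} (hx : x < 0) :
    deriv Real.smoothTransition x = 0 := by
  have : Real.smoothTransition =ᶠ[𝓝 x] fun _ => 0 := by
    filter_upwards [Iio_mem_nhds hx] with y hy
    exact Real.smoothTransition.zero_of_nonpos (le_of_lt hy)
  rw [this.deriv_eq, deriv_const]

theorem deriv_smoothTransition_of_one_lt {x : ℝ} (hx : 1 < x) :
    deriv Real.smoothTransition x = 0 := by
  have : Real.smoothTransition =ᶠ[𝓝 x] fun _ => 1 := by
    filter_upwards [Ioi_mem_nhds hx] with y hy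
    exact Real.smoothTransition.one_of_one_le (le_of_lt hy)
  rw [this.deriv_eq, deriv_const]

theorem contDiff_smoothTransition : ContDiff ℝ ∞ Real.smoothTransition :=
  Real.smoothTransition.contDiff (n := ⊤)

theorem continuous_deriv_smoothTransition : Continuous (deriv Real.smoothTransition) :=
  (contDiff_infty_iff_deriv.1 contDiff_smoothTransition).2.continuous

theorem hasDerivAt_smoothTransition (x : ℝ) :
    HasDerivAt Real.smoothTransition (deriv Real.smoothTransition x) x :=
  ((contDiff_infty_iff_deriv.1 contDiff_smoothTransition).1 x).hasDerivAt

theorem integrable_deriv_smoothTransition : Integrable (deriv Real.smoothTransition) := by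
  refine continuous_deriv_smoothTransition.integrable_of_hasCompactSupport ?_
  refine HasCompactSupport.intro (isCompact_Icc (a := (0 : ℝ)) (b := 1)) fun x hx => ?_
  rcases lt_or_ge x 0 with h | h
  · exact deriv_smoothTransition_of_neg h
  · refine deriv_smoothTransition_of_one_lt ?_
    by_contra! h'
    exact hx ⟨h, h'⟩

theorem integral_deriv_smoothTransition : ∫ x, deriv Real.smoothTransition x = 1 := by
  have h0 : Tendsto Real.smoothTransition atBot (𝓝 0) := by
    refine tendsto_const_nhds.congr' ?_
    filter_upwards [eventually_le_atBot 0] with x hx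
    exact (Real.smoothTransition.zero_of_nonpos hx).symm
  have h1 : Tendsto Real.smoothTransition atTop (𝓝 1) := by
    refine tendsto_const_nhds.congr' ?_
    filter_upwards [eventually_ge_atTop 1] with x hx
    exact (Real.smoothTransition.one_of_one_le hx).symm
  rw [integral_of_hasDerivAt_of_tendsto hasDerivAt_smoothTransition
    integrable_deriv_smoothTransition h0 h1, sub_zero]

/-- The derivative of a rescaled smooth step is an approximate identity. -/
theorem tendsto_integral_mul_deriv_step {T c : ℝ} {m : ℝ → ℝ} (hm : ContinuousOn m (Icc 0 T))
    (hc : c ∈ Ioo 0 T) {ε : ℕ → ℝ} (hε : ∀ n, 0 < ε n) (hε0 : Tendsto ε atTop (𝓝 0))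
    (hεT : ∀ n, c + ε n < T) :
    Tendsto (fun n => ∫ t in Ioo 0 T, m t * (deriv Real.smoothTransition ((t - c) / ε n) / ε n))
      atTop (𝓝 (m c)) := by
  -- Extending `m` by its boundary values makes it continuous and bounded on the line, so that `t =
  -- c + ε r` can be substituted over all of ℝ.
  have hT : 0 ≤ T := (hc.1.trans hc.2).le
  set m' : ℝ → ℝ := IccExtend hT ((Icc 0 T).domRestrict m) with hm'
  have hm'c : Continuous m' := continuous_IccExtend_iff.2 hm.domRestrict
  have hm'eq : ∀ t ∈ Icc 0 T, m' t = m t := fun t ht => by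
    rw [hm', IccExtend_of_mem _ _ ht]; rfl
  obtain ⟨M, hM⟩ : ∃ M, ∀ t, |m' t| ≤ M := by
    obtain ⟨M, hM⟩ := isCompact_Icc.exists_bound_of_continuousOn hm
    refine ⟨M, fun t => ?_⟩
    rw [hm', IccExtend, Function.comp_apply]
    exact hM _ (projIcc 0 T hT t).2
  have hcong : ∀ n, ∫ t in Ioo 0 T, m t * (deriv Real.smoothTransition ((t - c) / ε n) / ε n)
      = ∫ r, m' (c + ε n * r) * deriv Real.smoothTransition r := by
    intro n
    have h1 : ∫ t in Ioo 0 T, m t * (deriv Real.smoothTransition ((t - c) / ε n) / ε n)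
        = ∫ t in Ioo 0 T, m' t * (deriv Real.smoothTransition ((t - c) / ε n) / ε n) :=
      setIntegral_congr_fun measurableSet_Ioo fun t ht => by
        simp only [hm'eq t (Ioo_subset_Icc_self ht)]
    have h2 : ∫ t in Ioo 0 T, m' t * (deriv Real.smoothTransition ((t - c) / ε n) / ε n)
        = ∫ t, m' t * (deriv Real.smoothTransition ((t - c) / ε n) / ε n) := by
      refine setIntegral_eq_integral_of_forall_compl_eq_zero fun t ht => ?_
      have : deriv Real.smoothTransition ((t - c) / ε n) = 0 := by
        rcases le_or_gt t 0 with h | h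
        · refine deriv_smoothTransition_of_neg (div_neg_of_neg_of_pos ?_ (hε n))
          linarith [hc.1]
        · refine deriv_smoothTransition_of_one_lt ?_
          rw [lt_div_iff₀ (hε n), one_mul]
          have : T ≤ t := by
            by_contra! h'
            exact ht ⟨h, h'⟩
          linarith [hεT n]
      rw [this, zero_div, mul_zero]
    set g : ℝ → ℝ := fun r => m' (c + ε n * r) * (deriv Real.smoothTransition r / ε n) with hg
    have h3 : ∀ t, m' t * (deriv Real.smoothTransition ((t - c) / ε n) / ε n)
        = g ((t - c) / ε n) := fun t => by
      simp only [hg]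
      rw [mul_div_cancel₀ _ (hε n).ne', add_sub_cancel]
    rw [h1, h2]
    simp only [h3]
    rw [integral_sub_right_eq_self (fun t => g (t / ε n)) c, Measure.integral_comp_div,
      abs_of_pos (hε n), smul_eq_mul, ← integral_const_mul]
    refine integral_congr_ae (Eventually.of_forall fun r => ?_)
    simp only [hg]
    field_simp [(hε n).ne']
  simp only [hcong]
  have hlim : Tendsto (fun n => ∫ r, m' (c + ε n * r) * deriv Real.smoothTransition r) atTop
      (𝓝 (∫ r, m' c * deriv Real.smoothTransition r)) := by
    refine tendsto_integral_of_dominated_convergence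
      (fun r => M * |deriv Real.smoothTransition r|) (fun n => ?_)
      (integrable_deriv_smoothTransition.abs.const_mul M) (fun n => ?_) ?_
    · refine Continuous.aestronglyMeasurable ?_
      exact (hm'c.comp (by fun_prop)).mul continuous_deriv_smoothTransition
    · refine Eventually.of_forall fun r => ?_
      rw [Real.norm_eq_abs, abs_mul]
      gcongr
      exact hM _
    · refine Eventually.of_forall fun r => ?_
      refine Tendsto.mul_const _ ?_
      refine (hm'c.tendsto c).comp ?_
      simpa using (hε0.mul_const r).const_add c
  rwa [integral_const_mul, integral_deriv_smoothTransition, mul_one,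
    hm'eq c (Ioo_subset_Icc_self hc)] at hlim

/-- A continuous function with integrable weak derivative satisfies the fundamental theorem of
calculus. -/
theorem sub_eq_setIntegral_of_weak_deriv {T : ℝ} {m f : ℝ → ℝ} (hm : ContinuousOn m (Icc 0 T))
    (hf : IntegrableOn f (Ioo 0 T))
    (hw : ∀ η : ℝ → ℝ, ContDiff ℝ ∞ η → HasCompactSupport η → tsupport η ⊆ Ioo 0 T →
      ∫ t in Ioo 0 T, m t * deriv η t = ∫ t in Ioo 0 T, η t * f t)
    {a b : ℝ} (ha : 0 < a) (hab : a ≤ b) (hb : b < T) :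
    m b - m a = - ∫ t in Ioc a b, f t := by
  -- The factor `(T - b)/2` keeps `b + ε n < T`, so the time cutoffs below are supported in `(0,
  -- T)`.
  set ε : ℕ → ℝ := fun n => (T - b) / 2 / ((n : ℝ) + 1) with hεdef
  have hTb : 0 < T - b := sub_pos.2 hb
  have hε : ∀ n, 0 < ε n := fun n => by positivity
  have hε0 : Tendsto ε atTop (𝓝 0) :=
    tendsto_const_nhds.div_atTop
      (tendsto_atTop_add_const_right _ _ tendsto_natCast_atTop_atTop)
  have hεle : ∀ n, ε n ≤ (T - b) / 2 := fun n => by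
    refine div_le_self (by positivity) ?_
    have : (0 : ℝ) ≤ n := Nat.cast_nonneg n
    linarith
  -- A smooth plateau rising just after `a` and falling just after `b`. Its derivative is a
  -- difference of approximate identities, and its pointwise limit is exactly the indicator of `(a,
  -- b]`.
  set η : ℕ → ℝ → ℝ := fun n t => Real.smoothTransition ((t - a) / ε n)
    - Real.smoothTransition ((t - b) / ε n) with hη
  have hη1 : ∀ n t, |η n t| ≤ 1 := fun n t => by
    have h1 := Real.smoothTransition.nonneg ((t - a) / ε n)
    have h2 := Real.smoothTransition.nonneg ((t - b) / ε n)
    have h3 := Real.smoothTransition.le_one ((t - a) / ε n)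
    have h4 := Real.smoothTransition.le_one ((t - b) / ε n)
    rw [abs_le]
    constructor <;> simp only [hη] <;> linarith
  have hηs : ∀ n, ContDiff ℝ ∞ (η n) := fun n => by
    refine ContDiff.sub ?_ ?_
    · exact contDiff_smoothTransition.comp (by fun_prop)
    · exact contDiff_smoothTransition.comp (by fun_prop)
  have hη0 : ∀ n, ∀ t ∉ Icc a (b + ε n), η n t = 0 := fun n t ht => by
    simp only [hη]
    rcases lt_or_ge t a with h | h
    · rw [Real.smoothTransition.zero_of_nonpos
        (div_nonpos_of_nonpos_of_nonneg (by linarith) (hε n).le),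
        Real.smoothTransition.zero_of_nonpos
        (div_nonpos_of_nonpos_of_nonneg (by linarith) (hε n).le), sub_zero]
    · have h' : b + ε n < t := by
        by_contra! h'
        exact ht ⟨h, h'⟩
      rw [Real.smoothTransition.one_of_one_le, Real.smoothTransition.one_of_one_le, sub_self]
      · rw [le_div_iff₀ (hε n)]; linarith
      · rw [le_div_iff₀ (hε n)]; linarith
  have hηt : ∀ n, tsupport (η n) ⊆ Icc a (b + ε n) := fun n => by
    refine closure_minimal (fun t ht => ?_) isClosed_Icc
    by_contra h
    exact ht (hη0 n t h)
  have hηd : ∀ n t, deriv (η n) t = deriv Real.smoothTransition ((t - a) / ε n) / ε n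
      - deriv Real.smoothTransition ((t - b) / ε n) / ε n := fun n t => by
    have hd : ∀ c : ℝ, HasDerivAt (fun t => Real.smoothTransition ((t - c) / ε n))
        (deriv Real.smoothTransition ((t - c) / ε n) / ε n) t := fun c => by
      have := (hasDerivAt_smoothTransition ((t - c) / ε n)).comp t
        (((hasDerivAt_id t).sub_const c).div_const (ε n))
      simpa [div_eq_mul_inv, Function.comp_def] using this
    exact ((hd a).sub (hd b)).deriv
  have hw' : ∀ n, ∫ t in Ioo 0 T, m t * deriv (η n) t = ∫ t in Ioo 0 T, η n t * f t := fun n => by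
    refine hw (η n) (hηs n) (isCompact_Icc.of_isClosed_subset (isClosed_tsupport _) (hηt n))
      ((hηt n).trans fun t ht => ⟨ha.trans_le ht.1, ht.2.trans_lt ?_⟩)
    linarith [hεle n]
  have h_int : ∀ n, ∀ c : ℝ, IntegrableOn
      (fun t => m t * (deriv Real.smoothTransition ((t - c) / ε n) / ε n)) (Ioo 0 T) := by
    intro n c
    have hcont : Continuous fun t : ℝ => deriv Real.smoothTransition ((t - c) / ε n) / ε n :=
      (continuous_deriv_smoothTransition.comp (by fun_prop)).div_const _
    exact ((hm.mul hcont.continuousOn).integrableOn_Icc).mono_set Ioo_subset_Icc_self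
  have hL : Tendsto (fun n => ∫ t in Ioo 0 T, m t * deriv (η n) t) atTop (𝓝 (m a - m b)) := by
    have h1 := tendsto_integral_mul_deriv_step hm (c := a) ⟨ha, hab.trans_lt hb⟩ hε hε0
      (fun n => by linarith [hεle n])
    have h2 := tendsto_integral_mul_deriv_step hm (c := b) ⟨ha.trans_le hab, hb⟩ hε hε0
      (fun n => by linarith [hεle n])
    refine (h1.sub h2).congr fun n => ?_
    rw [← integral_sub (h_int n a) (h_int n b)]
    refine integral_congr_ae (Eventually.of_forall fun t => ?_)
    simp only [hηd]
    ring
  have hR : Tendsto (fun n => ∫ t in Ioo 0 T, η n t * f t) atTop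
      (𝓝 (∫ t in Ioo 0 T, (Ioc a b).indicator f t)) := by
    refine tendsto_integral_of_dominated_convergence (fun t => |f t|) (fun n => ?_)
      hf.abs (fun n => ?_) ?_
    · exact (hηs n).continuous.aestronglyMeasurable.mul hf.aestronglyMeasurable
    · refine Eventually.of_forall fun t => ?_
      rw [Real.norm_eq_abs, abs_mul]
      exact mul_le_of_le_one_left (abs_nonneg _) (hη1 n t)
    · refine Eventually.of_forall fun t => ?_
      have hstep0 : ∀ c, t ≤ c → ∀ n, Real.smoothTransition ((t - c) / ε n) = 0 := fun c hc n =>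
        Real.smoothTransition.zero_of_nonpos
          (div_nonpos_of_nonpos_of_nonneg (by linarith) (hε n).le)
      have hstep1 : ∀ c, c < t → ∀ᶠ n in atTop, Real.smoothTransition ((t - c) / ε n) = 1 := by
        intro c hc
        filter_upwards [hε0.eventually_lt_const (sub_pos.2 hc)] with n hn
        refine Real.smoothTransition.one_of_one_le ?_
        rw [le_div_iff₀ (hε n)]; linarith
      refine tendsto_const_nhds.congr' ?_
      rcases le_or_gt t a with h | h
      · refine Eventually.of_forall fun n => ?_
        rw [indicator_of_notMem fun h' => absurd h'.1 (not_lt.2 h)]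
        simp only [hη]
        rw [hstep0 a h n, hstep0 b (h.trans hab) n, sub_zero, zero_mul]
      · rcases le_or_gt t b with h' | h'
        · filter_upwards [hstep1 a h] with n hn
          rw [indicator_of_mem (show t ∈ Ioc a b from ⟨h, h'⟩)]
          simp only [hη]
          rw [hn, hstep0 b h' n, sub_zero, one_mul]
        · filter_upwards [hstep1 a h, hstep1 b h'] with n hn hn'
          rw [indicator_of_notMem fun h'' => absurd h''.2 (not_le.2 h')]
          simp only [hη]
          rw [hn, hn', sub_self, zero_mul]
  have hset : ∫ t in Ioo 0 T, (Ioc a b).indicator f t = ∫ t in Ioc a b, f t := by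
    rw [setIntegral_indicator measurableSet_Ioc]
    congr 2
    exact inter_eq_right.2 fun t ht => ⟨ha.trans ht.1, ht.2.trans_lt hb⟩
  rw [hset] at hR
  have := tendsto_nhds_unique (hL.congr hw') hR
  linarith

end WeakDerivative

/-! ### Auxiliary facts on `L^p` with real exponents -/

section Lebesgue

variable {X Y : Type*} [MeasurableSpace X] [MeasurableSpace Y] {μ : Measure X} {ν : Measure Y}
  {p : ℝ}

theorem eLpNorm_ofReal_eq (hp : 0 < p) (f : X → ℝ) :
    eLpNorm f (ENNReal.ofReal p) μ = (∫⁻ x, ‖f x‖ₑ ^ p ∂μ) ^ (1 / p) := by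
  rw [eLpNorm_eq_lintegral_rpow_enorm_toReal (by simpa using hp) ENNReal.ofReal_ne_top,
    ENNReal.toReal_ofReal hp.le]

theorem eLpNorm_ofReal_lt_top_iff (hp : 0 < p) {f : X → ℝ} :
    eLpNorm f (ENNReal.ofReal p) μ < ⊤ ↔ ∫⁻ x, ‖f x‖ₑ ^ p ∂μ < ⊤ := by
  rw [eLpNorm_lt_top_iff_lintegral_rpow_enorm_lt_top (by simpa using hp) ENNReal.ofReal_ne_top,
    ENNReal.toReal_ofReal hp.le]

theorem tendsto_eLpNorm_ofReal_zero_iff (hp : 0 < p) {ι : Type*} {l : Filter ι} {f : ι → X → ℝ} :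
    Tendsto (fun n => eLpNorm (f n) (ENNReal.ofReal p) μ) l (𝓝 0) ↔
      Tendsto (fun n => ∫⁻ x, ‖f n x‖ₑ ^ p ∂μ) l (𝓝 0) := by
  simp only [eLpNorm_ofReal_eq hp]
  constructor
  · intro h
    have := h.ennrpow_const p
    simpa only [← ENNReal.rpow_mul, one_div_mul_cancel hp.ne', ENNReal.rpow_one,
      ENNReal.zero_rpow_of_pos hp] using this
  · intro h
    have := h.ennrpow_const (1 / p)
    simpa only [ENNReal.zero_rpow_of_pos (one_div_pos.2 hp)] using this

/-- Because `(p - 1) p' = p`, the flux `|Du|^(p-2) Du` lies in the dual space of the one containing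
`Du`. -/
theorem memLp_signedPow (hp : 1 < p) {f : X → ℝ} (hf : MemLp f (ENNReal.ofReal p) μ) :
    MemLp (fun x => signedPow p (f x)) (ENNReal.ofReal p.conjExponent) μ := by
  have hc := Real.HolderConjugate.conjExponent hp
  refine ⟨(measurable_signedPow.comp_aemeasurable hf.1.aemeasurable).aestronglyMeasurable, ?_⟩
  rw [eLpNorm_ofReal_lt_top_iff hc.symm.pos]
  refine lt_of_eq_of_lt (lintegral_congr fun x => ?_) ((eLpNorm_ofReal_lt_top_iff hc.pos).1 hf.2)
  rw [enorm_rpow_eq_ofReal hc.symm.nonneg, enorm_rpow_eq_ofReal hc.nonneg, abs_signedPow hp,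
    ← Real.rpow_mul (abs_nonneg _), hc.sub_one_mul_conj]

theorem tendsto_integral_mul_of_tendsto_eLpNorm {p q : ℝ≥0∞} [p.HolderTriple q 1]
    {ι : Type*} {l : Filter ι} {F f : X → ℝ} {g : ι → X → ℝ} (hF : MemLp F p μ)
    (hf : MemLp f q μ) (hg : ∀ n, MemLp (g n) q μ)
    (h : Tendsto (fun n => eLpNorm (g n - f) q μ) l (𝓝 0)) :
    Tendsto (fun n => ∫ x, F x * g n x ∂μ) l (𝓝 (∫ x, F x * f x ∂μ)) := by
  refine tendsto_integral_of_L1' _ (hF.1.mul hf.1)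
    (Eventually.of_forall fun n => hF.integrable_mul (hg n)) ?_
  have hle : ∀ n, eLpNorm ((fun x => F x * g n x) - fun x => F x * f x) 1 μ
      ≤ eLpNorm F p μ * eLpNorm (g n - f) q μ := fun n => by
    have := eLpNorm_smul_le_mul_eLpNorm (p := p) (q := q) (r := 1) ((hg n).1.sub hf.1) hF.1
    refine le_of_eq_of_le (congrArg (fun φ => eLpNorm φ 1 μ) ?_) this
    ext x
    simp [mul_sub]
  have hlim := ENNReal.Tendsto.const_mul h (Or.inr hF.2.ne) (a := eLpNorm F p μ)
  rw [mul_zero] at hlim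
  exact tendsto_of_tendsto_of_tendsto_of_le_of_le tendsto_const_nhds hlim
    (fun _ => zero_le) hle

theorem tendsto_eLpNorm_comp_snd (hp : 0 < p) [IsFiniteMeasure μ] [SFinite ν] {ι : Type*}
    {l : Filter ι} {f : ι → Y → ℝ} (hf : ∀ n, AEStronglyMeasurable (f n) ν)
    (h : Tendsto (fun n => eLpNorm (f n) (ENNReal.ofReal p) ν) l (𝓝 0)) :
    Tendsto (fun n => eLpNorm (fun z : X × Y => f n z.2) (ENNReal.ofReal p) (μ.prod ν)) l
      (𝓝 0) := by
  rw [tendsto_eLpNorm_ofReal_zero_iff hp] at h ⊢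
  have e : ∀ n, ∫⁻ z, ‖f n z.2‖ₑ ^ p ∂(μ.prod ν) = (∫⁻ y, ‖f n y‖ₑ ^ p ∂ν) * μ univ := fun n => by
    rw [lintegral_prod _ ((hf n).enorm.pow_const p).comp_snd]
    simp only [lintegral_const]
  simp only [e]
  have := ENNReal.Tendsto.mul_const h (Or.inr (measure_ne_top μ univ)) (b := μ univ)
  rwa [zero_mul] at this

end Lebesgue

/-! ### Difference quotients as space-time fields, and composition with Lipschitz functions -/

section Fields

variable {N : ℕ} {Ω : Set (EuclideanSpace ℝ (Fin N))} {s p T : ℝ}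
  {w : EuclideanSpace ℝ (Fin N) → ℝ} {u : ℝ → EuclideanSpace ℝ (Fin N) → ℝ}

theorem aestronglyMeasurable_wdiff_uncurry {τ : Measure ℝ} [SFinite τ] (hΩ : MeasurableSet Ω)
    (hu : AEStronglyMeasurable (Function.uncurry u) (τ.prod volume)) :
    AEStronglyMeasurable (fun q : ℝ × EuclideanSpace ℝ (Fin N) × EuclideanSpace ℝ (Fin N) =>
      wdiff Ω s p (u q.1) q.2) (τ.prod volume) := by
  have h1 : AEStronglyMeasurable
      (fun q : ℝ × EuclideanSpace ℝ (Fin N) × EuclideanSpace ℝ (Fin N) => u q.1 q.2.1)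
      (τ.prod volume) :=
    hu.comp_quasiMeasurePreserving (QuasiMeasurePreserving.prodMap
      (Measure.QuasiMeasurePreserving.id τ)
      (Measure.quasiMeasurePreserving_fst (μ := volume) (ν := volume)))
  have h2 : AEStronglyMeasurable
      (fun q : ℝ × EuclideanSpace ℝ (Fin N) × EuclideanSpace ℝ (Fin N) => u q.1 q.2.2)
      (τ.prod volume) :=
    hu.comp_quasiMeasurePreserving (QuasiMeasurePreserving.prodMap
      (Measure.QuasiMeasurePreserving.id τ)
      (Measure.quasiMeasurePreserving_snd (μ := volume) (ν := volume)))
  have h3 : Measurable (fun q : ℝ × EuclideanSpace ℝ (Fin N) × EuclideanSpace ℝ (Fin N) =>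
      (‖q.2.1 - q.2.2‖ ^ (((N : ℝ) + p * s) / p))⁻¹) := by fun_prop
  have h4 := ((h1.sub h2).mul h3.aestronglyMeasurable).indicator
    (measurable_snd (measurableSet_interactionDomain hΩ))
  refine h4.congr (Eventually.of_forall fun q => ?_)
  by_cases hq : q.2 ∈ interactionDomain Ω
  · simp [wdiff, hq, div_eq_mul_inv]
  · simp [wdiff, hq]

theorem eLpNorm_wdiff (hΩ : MeasurableSet Ω) (hp : 0 < p) :
    eLpNorm (wdiff Ω s p w) (ENNReal.ofReal p) volume = gagliardo Ω s p w ^ (1 / p) := by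
  rw [eLpNorm_ofReal_eq hp, gagliardo_eq_lintegral_wdiff hΩ hp]

theorem memLp_wdiff (hΩ : MeasurableSet Ω) (hp : 0 < p) (hw : AEStronglyMeasurable w volume)
    (hfin : gagliardo Ω s p w < ⊤) : MemLp (wdiff Ω s p w) (ENNReal.ofReal p) volume := by
  refine ⟨aestronglyMeasurable_wdiff hΩ hw, ?_⟩
  rwa [eLpNorm_ofReal_lt_top_iff hp, ← gagliardo_eq_lintegral_wdiff hΩ hp]

theorem IsTest.memLp_wdiff [NeZero N] (h : IsTest Ω w) (hΩ : MeasurableSet Ω)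
    (hΩv : volume Ω < ⊤) (hs0 : 0 < s) (hs1 : s < 1) (hp : 0 < p) :
    MemLp (wdiff Ω s p w) (ENNReal.ofReal p) volume :=
  FracPLap.memLp_wdiff hΩ hp h.contDiff.continuous.aestronglyMeasurable
    (h.gagliardo_lt_top hΩv hs0 hs1 hp)

theorem MemParabolic.memLp_wdiff (h : MemParabolic Ω s p T u) (hΩ : MeasurableSet Ω)
    (hp : 0 < p) :
    MemLp (fun q : ℝ × EuclideanSpace ℝ (Fin N) × EuclideanSpace ℝ (Fin N) =>
      wdiff Ω s p (u q.1) q.2) (ENNReal.ofReal p)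
      ((volume.restrict (Ioo 0 T)).prod volume) := by
  have hm := aestronglyMeasurable_wdiff_uncurry (s := s) (p := p) hΩ h.memLp.1
  refine ⟨hm, ?_⟩
  rw [eLpNorm_ofReal_lt_top_iff hp, lintegral_prod _ (hm.enorm.pow_const p)]
  simpa only [gagliardo_eq_lintegral_wdiff hΩ hp] using h.finite

theorem abs_wdiff_comp_le {f : ℝ → ℝ} {L : ℝ} (hL : ∀ a b, |f a - f b| ≤ L * |a - b|)
    (z : EuclideanSpace ℝ (Fin N) × EuclideanSpace ℝ (Fin N)) :
    |wdiff Ω s p (f ∘ w) z| ≤ L * |wdiff Ω s p w z| := by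
  by_cases hz : z ∈ interactionDomain Ω
  · simp only [wdiff, indicator_of_mem hz, Function.comp_apply, abs_div]
    rw [mul_div_assoc']
    gcongr
    exact hL _ _
  · simp [wdiff, indicator_of_notMem hz]

theorem memLp_wdiff_comp {f : ℝ → ℝ} {L : ℝ} (hf : Continuous f)
    (hL : ∀ a b, |f a - f b| ≤ L * |a - b|) (hΩ : MeasurableSet Ω)
    (hw : AEStronglyMeasurable w volume)
    (h : MemLp (wdiff Ω s p w) (ENNReal.ofReal p) volume) :
    MemLp (wdiff Ω s p (f ∘ w)) (ENNReal.ofReal p) volume :=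
  (h.const_mul L).mono (aestronglyMeasurable_wdiff hΩ (hf.comp_aestronglyMeasurable hw))
    (Eventually.of_forall fun z => by
      rw [Real.norm_eq_abs, Real.norm_eq_abs]
      exact (abs_wdiff_comp_le hL z).trans ((le_abs_self _).trans (by simp [abs_mul])))

/-- Composition with a Lipschitz function is continuous along sequences that converge both a.e. and
in the Gagliardo seminorm. -/
theorem tendsto_eLpNorm_wdiff_comp {f : ℝ → ℝ} {L : ℝ} (hf : Continuous f) (hL0 : 0 ≤ L)
    (hL : ∀ a b, |f a - f b| ≤ L * |a - b|) (hΩ : MeasurableSet Ω) (hp : 1 < p)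
    {φ : ℕ → EuclideanSpace ℝ (Fin N) → ℝ} (hφ : ∀ n, AEStronglyMeasurable (φ n) volume)
    (hw : AEStronglyMeasurable w volume)
    (hwm : MemLp (wdiff Ω s p w) (ENNReal.ofReal p) volume)
    (hae : ∀ᵐ x, Tendsto (fun n => φ n x) atTop (𝓝 (w x)))
    (hlim : Tendsto (fun n => eLpNorm (wdiff Ω s p (φ n) - wdiff Ω s p w) (ENNReal.ofReal p)
      volume) atTop (𝓝 0)) :
    Tendsto (fun n => eLpNorm (wdiff Ω s p (f ∘ φ n) - wdiff Ω s p (f ∘ w)) (ENNReal.ofReal p)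
      volume) atTop (𝓝 0) := by
  have hp0 : 0 < p := by linarith
  set F : ℕ → EuclideanSpace ℝ (Fin N) × EuclideanSpace ℝ (Fin N) → ℝ :=
    fun n => wdiff Ω s p (f ∘ φ n) - wdiff Ω s p (f ∘ w) with hF
  set e : ℕ → EuclideanSpace ℝ (Fin N) × EuclideanSpace ℝ (Fin N) → ℝ :=
    fun n => wdiff Ω s p (φ n) - wdiff Ω s p w with he
  have hFm : ∀ n, AEStronglyMeasurable (F n) volume := fun n =>
    (aestronglyMeasurable_wdiff hΩ (hf.comp_aestronglyMeasurable (hφ n))).sub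
      (aestronglyMeasurable_wdiff hΩ (hf.comp_aestronglyMeasurable hw))
  have hem : ∀ n, AEStronglyMeasurable (e n) volume := fun n =>
    (aestronglyMeasurable_wdiff hΩ (hφ n)).sub (aestronglyMeasurable_wdiff hΩ hw)
  have hFle : ∀ n z, |F n z| ≤ 2 * L * |wdiff Ω s p w z| + L * |e n z| := by
    intro n z
    have h1 := abs_wdiff_comp_le (Ω := Ω) (s := s) (p := p) (w := φ n) hL z
    have h2 := abs_wdiff_comp_le (Ω := Ω) (s := s) (p := p) (w := w) hL z
    have h3 : |F n z| ≤ |wdiff Ω s p (f ∘ φ n) z| + |wdiff Ω s p (f ∘ w) z| := abs_sub _ _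
    have h4 : |wdiff Ω s p (φ n) z| ≤ |e n z| + |wdiff Ω s p w z| := by
      have := abs_add_le (e n z) (wdiff Ω s p w z)
      simpa [he] using this
    have h5 := mul_le_mul_of_nonneg_left h4 hL0
    linarith
  have hF0 : ∀ᵐ z, Tendsto (fun n => F n z) atTop (𝓝 0) := by
    have h1 : ∀ᵐ z : EuclideanSpace ℝ (Fin N) × EuclideanSpace ℝ (Fin N),
        Tendsto (fun n => φ n z.1) atTop (𝓝 (w z.1)) :=
      (Measure.quasiMeasurePreserving_fst (μ := volume) (ν := volume)).ae hae
    have h2 : ∀ᵐ z : EuclideanSpace ℝ (Fin N) × EuclideanSpace ℝ (Fin N),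
        Tendsto (fun n => φ n z.2) atTop (𝓝 (w z.2)) :=
      (Measure.quasiMeasurePreserving_snd (μ := volume) (ν := volume)).ae hae
    filter_upwards [h1, h2] with z hz1 hz2
    by_cases hz : z ∈ interactionDomain Ω
    · simp only [hF, wdiff, Pi.sub_apply, indicator_of_mem hz, Function.comp_apply]
      have h3 := (((hf.tendsto _).comp hz1).sub ((hf.tendsto _).comp hz2)).div_const
        (‖z.1 - z.2‖ ^ (((N : ℝ) + p * s) / p))
      have h4 := h3.sub_const ((f (w z.1) - f (w z.2)) / ‖z.1 - z.2‖ ^ (((N : ℝ) + p * s) / p))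
      rwa [sub_self] at h4
    · simp [hF, wdiff, indicator_of_notMem hz]
  -- `|F n|` has no fixed majorant, but its excess over `L |e n|` is bounded by `2L |Dw|` and tends
  -- to zero almost everywhere. Dominated convergence handles the excess, and the rest tends to zero
  -- in `L^p` by hypothesis.
  set d : ℕ → EuclideanSpace ℝ (Fin N) × EuclideanSpace ℝ (Fin N) → ℝ :=
    fun n z => max (|F n z| - L * |e n z|) 0 with hd
  have habs : ∀ {g : EuclideanSpace ℝ (Fin N) × EuclideanSpace ℝ (Fin N) → ℝ},
      AEStronglyMeasurable g volume → AEStronglyMeasurable (fun z => |g z|) volume :=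
    fun hg => hg.norm
  have hdm : ∀ n, AEStronglyMeasurable (d n) volume := fun n =>
    ((habs (hFm n)).sub ((habs (hem n)).const_mul L)).sup aestronglyMeasurable_const
  have hd0 : ∀ n z, 0 ≤ d n z := fun n z => le_max_right _ _
  have hdlim : Tendsto (fun n => eLpNorm (d n) (ENNReal.ofReal p) volume) atTop (𝓝 0) := by
    rw [tendsto_eLpNorm_ofReal_zero_iff hp0]
    have hb := (eLpNorm_ofReal_lt_top_iff hp0).1 (hwm.const_mul (2 * L)).2
    have := tendsto_lintegral_of_dominated_convergence' (μ := volume)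
      (F := fun n z => ‖d n z‖ₑ ^ p) (f := fun _ => 0)
      (fun z => ‖2 * L * wdiff Ω s p w z‖ₑ ^ p) (fun n => (hdm n).enorm.pow_const p)
      (fun n => Eventually.of_forall fun z => ?_) hb.ne ?_
    · simpa using this
    · refine ENNReal.rpow_le_rpow ?_ hp0.le
      rw [Real.enorm_eq_ofReal_abs, Real.enorm_eq_ofReal_abs]
      refine ENNReal.ofReal_le_ofReal ?_
      rw [abs_of_nonneg (hd0 n z), abs_mul, abs_of_nonneg (by positivity : (0 : ℝ) ≤ 2 * L)]
      refine max_le ?_ (by positivity)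
      linarith [hFle n z]
    · filter_upwards [hF0] with z hz
      have h1 : Tendsto (fun n => d n z) atTop (𝓝 0) := by
        refine squeeze_zero (fun n => hd0 n z) (fun n => ?_) (by simpa using hz.abs)
        refine max_le ?_ (abs_nonneg _)
        have : 0 ≤ L * |e n z| := by positivity
        linarith
      have h2 := (h1.enorm).ennrpow_const p
      simpa [hp0] using h2
  have hsum := hdlim.add (ENNReal.Tendsto.const_mul hlim
    (Or.inr (ENNReal.ofReal_ne_top (r := L))) (a := ENNReal.ofReal L))
  rw [mul_zero, add_zero] at hsum
  refine tendsto_of_tendsto_of_tendsto_of_le_of_le tendsto_const_nhds hsum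
    (fun _ => zero_le) fun n => ?_
  have h1 : eLpNorm (F n) (ENNReal.ofReal p) volume
      ≤ eLpNorm (d n + fun z => L * |e n z|) (ENNReal.ofReal p) volume := by
    refine eLpNorm_mono_real fun z => ?_
    have := le_max_left (|F n z| - L * |e n z|) 0
    simp only [Pi.add_apply, hd, Real.norm_eq_abs]
    linarith
  refine h1.trans ((eLpNorm_add_le (hdm n) ((habs (hem n)).const_mul L)
    (ENNReal.one_le_ofReal.2 hp.le)).trans ?_)
  have h2 : eLpNorm (fun z => L * |e n z|) (ENNReal.ofReal p) volume
      = ENNReal.ofReal L * eLpNorm (e n) (ENNReal.ofReal p) volume := by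
    have h3 := eLpNorm_const_smul L (fun z => |e n z|) (ENNReal.ofReal p) volume
    have h4 : eLpNorm (fun z => |e n z|) (ENNReal.ofReal p) volume
        = eLpNorm (e n) (ENNReal.ofReal p) volume := eLpNorm_norm (e n)
    rw [h4, Real.enorm_eq_ofReal hL0] at h3
    exact h3
  rw [h2]

end Fields

/-! ### The equation integrated in time against a frozen test function -/

section WeakForm

variable {N : ℕ} {Ω : Set (EuclideanSpace ℝ (Fin N))} {s p T : ℝ}
  {u₀ w ψ : EuclideanSpace ℝ (Fin N) → ℝ} {u : ℝ → EuclideanSpace ℝ (Fin N) → ℝ}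

theorem fracPLapForm_const_mul (hΩ : MeasurableSet Ω) (hp : 0 < p) (c : ℝ) :
    fracPLapForm Ω s p w (fun x => c * ψ x) = c * fracPLapForm Ω s p w ψ := by
  rw [fracPLapForm_eq_integral_wdiff hΩ hp, fracPLapForm_eq_integral_wdiff hΩ hp, wdiff_const_mul,
    mul_left_comm, ← integral_const_mul c]
  congr 1
  refine integral_congr_ae (Eventually.of_forall fun z => ?_)
  simp only
  ring

theorem IsEnergySolution.integrable (hu : IsEnergySolution Ω s p T u₀ u) (hΩv : volume Ω < ⊤)
    {t : ℝ} (ht : t ∈ Icc 0 T) : IntegrableOn (u t) Ω := by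
  have : IsFiniteMeasure (volume.restrict Ω) := ⟨by simpa using hΩv⟩
  exact (hu.memL2 t ht).integrable (by norm_num)

theorem tendsto_eLpNorm_one_of_two {X ι : Type*} [MeasurableSpace X] {μ : Measure X}
    [IsFiniteMeasure μ] {l : Filter ι} {f : ι → X → ℝ}
    (hf : ∀ᶠ i in l, AEStronglyMeasurable (f i) μ)
    (h : Tendsto (fun i => eLpNorm (f i) 2 μ) l (𝓝 0)) :
    Tendsto (fun i => eLpNorm (f i) 1 μ) l (𝓝 0) := by
  have h1 := ENNReal.Tendsto.mul_const h (b := μ univ ^ (1 / (1 : ℝ≥0∞).toReal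
    - 1 / (2 : ℝ≥0∞).toReal))
    (Or.inr (ENNReal.rpow_ne_top_of_nonneg (by norm_num) (measure_ne_top μ univ)))
  rw [zero_mul] at h1
  refine tendsto_of_tendsto_of_tendsto_of_le_of_le' tendsto_const_nhds h1
    (Eventually.of_forall fun _ => zero_le) ?_
  filter_upwards [hf] with i hi
  exact eLpNorm_le_eLpNorm_mul_rpow_measure_univ (by norm_num) hi

/-- On a finite measure space `L²` convergence implies `L¹` convergence, which Lipschitz integrands
preserve. Dependence of `F` on `x` lets one statement cover both the pairing with a test function
and the convex energies. -/
theorem tendsto_integral_of_lipschitz {X ι : Type*} [MeasurableSpace X] {μ : Measure X}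
    [IsFiniteMeasure μ] {l : Filter ι} {f : ι → X → ℝ} {g : X → ℝ} (F : X → ℝ → ℝ) {K : ℝ}
    (hK0 : 0 ≤ K) (hK : ∀ x a b, |F x a - F x b| ≤ K * |a - b|)
    (hf : ∀ᶠ i in l, AEStronglyMeasurable (f i) μ) (hg : AEStronglyMeasurable g μ)
    (hFf : ∀ᶠ i in l, Integrable (fun x => F x (f i x)) μ)
    (hFg : Integrable (fun x => F x (g x)) μ)
    (h : Tendsto (fun i => eLpNorm (f i - g) 2 μ) l (𝓝 0)) :
    Tendsto (fun i => ∫ x, F x (f i x) ∂μ) l (𝓝 (∫ x, F x (g x) ∂μ)) := by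
  refine tendsto_integral_of_L1' _ hFg.1 hFf ?_
  have h1 := ENNReal.Tendsto.const_mul (tendsto_eLpNorm_one_of_two
    (hf.mono fun i hi => hi.sub hg) h) (a := ENNReal.ofReal K) (Or.inr ENNReal.ofReal_ne_top)
  rw [mul_zero] at h1
  refine tendsto_of_tendsto_of_tendsto_of_le_of_le tendsto_const_nhds h1
    (fun _ => zero_le) fun i => ?_
  have h2 : eLpNorm (fun x => K * (f i - g) x) 1 μ = ENNReal.ofReal K * eLpNorm (f i - g) 1 μ := by
    have := eLpNorm_const_smul K (f i - g) 1 μ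
    rw [Real.enorm_eq_ofReal hK0] at this
    exact this
  rw [← h2]
  refine eLpNorm_mono fun x => ?_
  simp only [Pi.sub_apply, Real.norm_eq_abs, abs_mul, abs_of_nonneg hK0]
  exact hK x _ _

theorem IsEnergySolution.continuousOn_integral (hu : IsEnergySolution Ω s p T u₀ u)
    (hΩv : volume Ω < ⊤) (F : EuclideanSpace ℝ (Fin N) → ℝ → ℝ) {K : ℝ} (hK0 : 0 ≤ K)
    (hK : ∀ x a b, |F x a - F x b| ≤ K * |a - b|)
    (hF : ∀ t ∈ Icc 0 T, IntegrableOn (fun x => F x (u t x)) Ω) :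
    ContinuousOn (fun t => ∫ x in Ω, F x (u t x)) (Icc 0 T) := by
  have : IsFiniteMeasure (volume.restrict Ω) := ⟨by simpa using hΩv⟩
  intro t₀ ht₀
  exact tendsto_integral_of_lipschitz F hK0 hK
    (eventually_nhdsWithin_of_forall fun t ht => (hu.memL2 t ht).1) (hu.memL2 t₀ ht₀).1
    (eventually_nhdsWithin_of_forall fun t ht => hF t ht) (hF t₀ ht₀) (hu.continuous t₀ ht₀)

/-- The integrand `|Du|^(p-2) Du · f` of the weak formulation is integrable in space-time. -/
theorem IsEnergySolution.integrable_signedPow_mul (hu : IsEnergySolution Ω s p T u₀ u)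
    (hΩ : MeasurableSet Ω) (hp : 1 < p)
    {f : EuclideanSpace ℝ (Fin N) × EuclideanSpace ℝ (Fin N) → ℝ}
    (hf : MemLp f (ENNReal.ofReal p) volume) :
    Integrable (fun q : ℝ × EuclideanSpace ℝ (Fin N) × EuclideanSpace ℝ (Fin N) =>
      signedPow p (wdiff Ω s p (u q.1) q.2) * f q.2)
      ((volume.restrict (Ioo 0 T)).prod volume) := by
  have := (Real.HolderConjugate.conjExponent hp).symm.ennrealOfReal
  exact (memLp_signedPow hp (hu.memParabolic.memLp_wdiff hΩ (by linarith))).integrable_mul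
    (hf.comp_snd (volume.restrict (Ioo 0 T)))

theorem tsupport_mul_subset_prod {η : ℝ → ℝ} :
    tsupport (Function.uncurry fun t x => η t * ψ x) ⊆ tsupport η ×ˢ tsupport ψ := by
  refine closure_minimal ?_ ((isClosed_tsupport η).prod (isClosed_tsupport ψ))
  rintro ⟨t, x⟩ hz
  exact ⟨subset_tsupport _ (left_ne_zero_of_mul hz), subset_tsupport _ (right_ne_zero_of_mul hz)⟩

/-- The equation tested with `ψ ∈ C_c^∞(Ω)`, integrated in time. -/
theorem IsEnergySolution.sub_eq_of_isTest [NeZero N] (hu : IsEnergySolution Ω s p T u₀ u)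
    (hΩ : MeasurableSet Ω) (hΩv : volume Ω < ⊤) (hs0 : 0 < s) (hs1 : s < 1) (hp : 1 < p)
    (hψ : IsTest Ω ψ) {a b : ℝ} (ha : 0 < a) (hab : a ≤ b) (hb : b < T) :
    (∫ x in Ω, u b x * ψ x) - ∫ x in Ω, u a x * ψ x
      = - ∫ t in Ioc a b, (1 / 2) * ∫ z, signedPow p (wdiff Ω s p (u t) z) * wdiff Ω s p ψ z := by
  have hp0 : 0 < p := by linarith
  obtain ⟨M, hM⟩ := hψ.exists_abs_le
  have hM0 : 0 ≤ M := (abs_nonneg _).trans (hM 0)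
  have hm : ContinuousOn (fun t => ∫ x in Ω, u t x * ψ x) (Icc 0 T) := by
    refine hu.continuousOn_integral hΩv (fun x a => a * ψ x) hM0 (fun x a b => ?_)
      (fun t ht => ?_)
    · rw [← sub_mul, abs_mul, mul_comm]
      gcongr
      exact hM x
    · exact (hu.integrable hΩv ht).mul_bdd (c := M)
        hψ.contDiff.continuous.aestronglyMeasurable
        (Eventually.of_forall fun x => hM x)
  have hf : IntegrableOn (fun t => (1 / 2) * ∫ z, signedPow p (wdiff Ω s p (u t) z)
      * wdiff Ω s p ψ z) (Ioo 0 T) :=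
    (hu.integrable_signedPow_mul hΩ hp
      (hψ.memLp_wdiff hΩ hΩv hs0 hs1 hp0)).integral_prod_left.const_mul (1 / 2)
  refine sub_eq_setIntegral_of_weak_deriv hm hf (fun η hη hηc hηT => ?_) ha hab hb
  obtain ⟨ξ, -, hξt, hξ⟩ := hu.equation
  -- Testing with products `η(t) ψ(x)` identifies the weak derivative of `t ↦ ∫ u(t) ψ` with minus
  -- the form at `(u(t), ψ)`.
  have h1 := hξ _ (hψ.memParabolic hΩ hΩv hs0 hs1 hp0 (T := T) hη.continuous hηc)
  have hsub : tsupport (Function.uncurry fun t x => η t * ψ x) ⊆ tsupport η ×ˢ tsupport ψ :=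
    tsupport_mul_subset_prod
  have h2 := hξt (fun t x => η t * ψ x)
    ((hη.comp contDiff_fst).mul (hψ.contDiff.comp contDiff_snd))
    ((hηc.isCompact.prod hψ.hasCompactSupport.isCompact).of_isClosed_subset
      (isClosed_tsupport _) hsub)
    (hsub.trans (prod_mono hηT hψ.tsupport_subset))
  have h3 : ∫ t in Ioo 0 T, ∫ x in Ω, u t x * deriv (fun τ => η τ * ψ x) t
      = ∫ t in Ioo 0 T, (∫ x in Ω, u t x * ψ x) * deriv η t := by
    congr 1
    ext t
    rw [← integral_mul_const]
    congr 1
    ext x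
    rw [deriv_mul_const ((hη.differentiable (by simp)) t)]
    ring
  have h4 : ∫ t in Ioo 0 T, fracPLapForm Ω s p (u t) (fun x => η t * ψ x)
      = ∫ t in Ioo 0 T, η t * ((1 / 2) * ∫ z, signedPow p (wdiff Ω s p (u t) z)
        * wdiff Ω s p ψ z) := by
    congr 1
    ext t
    rw [fracPLapForm_const_mul hΩ hp0, fracPLapForm_eq_integral_wdiff hΩ hp0]
  rw [h2, h3, h4] at h1
  linarith

/-- The equation tested with a smooth bounded function of an element of `W₀^{s,p}(Ω)`, integrated
in time. -/
theorem IsEnergySolution.sub_eq_of_comp [NeZero N] (hu : IsEnergySolution Ω s p T u₀ u)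
    (hΩ : MeasurableSet Ω) (hΩv : volume Ω < ⊤) (hs0 : 0 < s) (hs1 : s < 1) (hp : 1 < p)
    (hw : MemW0 Ω s p w) (hwm : gagliardo Ω s p w < ⊤) {h : ℝ → ℝ} (hh : ContDiff ℝ ∞ h)
    (hh0 : h 0 = 0) {K L : ℝ} (hK : ∀ r, |h r| ≤ K) (hL : ∀ r r', |h r - h r'| ≤ L * |r - r'|)
    {a b : ℝ} (ha : 0 < a) (hab : a ≤ b) (hb : b < T) :
    ∫ x in Ω, (u b x - u a x) * h (w x)
      = - ∫ t in Ioc a b, (1 / 2) * ∫ z, signedPow p (wdiff Ω s p (u t) z)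
        * wdiff Ω s p (h ∘ w) z := by
  have hp0 : 0 < p := by linarith
  have hL0 : 0 ≤ L := by
    have := hL 1 0
    rw [sub_zero, abs_one, mul_one] at this
    exact (abs_nonneg _).trans this
  have hconj := (Real.HolderConjugate.conjExponent hp).symm.ennrealOfReal
  have haT : a ∈ Icc 0 T := ⟨ha.le, (hab.trans_lt hb).le⟩
  have hbT : b ∈ Icc 0 T := ⟨(ha.trans_le hab).le, hb.le⟩
  obtain ⟨φ, hφ, hφp, hφg⟩ := hw.approx
  have hφm : ∀ n, AEStronglyMeasurable (φ n) volume :=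
    fun n => (hφ n).1.continuous.aestronglyMeasurable
  have hφp' : Tendsto (fun n => eLpNorm (φ n - w) (ENNReal.ofReal p) volume) atTop (𝓝 0) := by
    simpa only [eLpNorm_sub_comm] using hφp
  -- Continuity of composition needs almost everywhere convergence as well, whence a subsequence.
  obtain ⟨ns, hns, hae⟩ := (tendstoInMeasure_of_tendsto_eLpNorm (by simpa using hp0) hφm
    hw.memLp.1 hφp').exists_seq_tendsto_ae
  have hwL : MemLp (wdiff Ω s p w) (ENNReal.ofReal p) volume := memLp_wdiff hΩ hp0 hw.memLp.1 hwm
  have hdiff : Tendsto (fun n => eLpNorm (wdiff Ω s p (φ (ns n)) - wdiff Ω s p w)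
      (ENNReal.ofReal p) volume) atTop (𝓝 0) := by
    have h1 := (hφg.ennrpow_const (1 / p)).comp hns.tendsto_atTop
    rw [ENNReal.zero_rpow_of_pos (one_div_pos.2 hp0)] at h1
    refine h1.congr fun n => ?_
    rw [Function.comp_apply, ← eLpNorm_wdiff hΩ hp0, wdiff_sub, eLpNorm_sub_comm]
  have hconv := tendsto_eLpNorm_wdiff_comp hh.continuous hL0 hL hΩ hp (fun n => hφm (ns n))
    hw.memLp.1 hwL hae hdiff
  have htest : ∀ n, IsTest Ω (h ∘ φ (ns n)) := fun n =>
    IsTest.comp ⟨(hφ (ns n)).1, (hφ (ns n)).2.1, (hφ (ns n)).2.2⟩ hh hh0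
  have hcL : MemLp (wdiff Ω s p (h ∘ w)) (ENNReal.ofReal p) volume :=
    memLp_wdiff_comp hh.continuous hL hΩ hw.memLp.1 hwL
  have hnL : ∀ n, MemLp (wdiff Ω s p (h ∘ φ (ns n))) (ENNReal.ofReal p) volume := fun n =>
    (htest n).memLp_wdiff hΩ hΩv hs0 hs1 hp0
  -- the space-time pairing
  set τ : Measure ℝ := volume.restrict (Ioc a b) with hτ
  have hτle : τ.prod (volume : Measure (EuclideanSpace ℝ (Fin N) × EuclideanSpace ℝ (Fin N)))
      ≤ (volume.restrict (Ioo 0 T)).prod volume := by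
    refine Measure.prod_mono (Measure.restrict_mono (fun t ht => ?_) le_rfl) le_rfl
    exact ⟨ha.trans ht.1, ht.2.trans_lt hb⟩
  have hJ : MemLp (fun q : ℝ × EuclideanSpace ℝ (Fin N) × EuclideanSpace ℝ (Fin N) =>
      signedPow p (wdiff Ω s p (u q.1) q.2)) (ENNReal.ofReal p.conjExponent) (τ.prod volume) :=
    (memLp_signedPow hp (hu.memParabolic.memLp_wdiff hΩ hp0)).mono_measure hτle
  have hpair : ∀ {f : EuclideanSpace ℝ (Fin N) × EuclideanSpace ℝ (Fin N) → ℝ},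
      MemLp f (ENNReal.ofReal p) volume →
      ∫ t in Ioc a b, (1 / 2) * ∫ z, signedPow p (wdiff Ω s p (u t) z) * f z
        = (1 / 2) * ∫ q, signedPow p (wdiff Ω s p (u q.1) q.2) * f q.2 ∂(τ.prod volume) := by
    intro f hf
    rw [integral_const_mul, integral_prod]
    exact hJ.integrable_mul (hf.comp_snd τ)
  have hR : Tendsto (fun n => ∫ t in Ioc a b, (1 / 2) * ∫ z,
      signedPow p (wdiff Ω s p (u t) z) * wdiff Ω s p (h ∘ φ (ns n)) z) atTop
      (𝓝 (∫ t in Ioc a b, (1 / 2) * ∫ z,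
        signedPow p (wdiff Ω s p (u t) z) * wdiff Ω s p (h ∘ w) z)) := by
    rw [hpair hcL]
    refine Tendsto.congr (fun n => (hpair (hnL n)).symm) ?_
    refine Tendsto.const_mul _ ?_
    have h9 := tendsto_eLpNorm_comp_snd (μ := τ) hp0
      (f := fun n => wdiff Ω s p (h ∘ φ (ns n)) - wdiff Ω s p (h ∘ w))
      (fun n => (hnL n).1.sub hcL.1) hconv
    exact tendsto_integral_mul_of_tendsto_eLpNorm (p := ENNReal.ofReal p.conjExponent)
      (q := ENNReal.ofReal p)
      (f := fun q : ℝ × EuclideanSpace ℝ (Fin N) × EuclideanSpace ℝ (Fin N) =>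
        wdiff Ω s p (h ∘ w) q.2)
      (g := fun n (q : ℝ × EuclideanSpace ℝ (Fin N) × EuclideanSpace ℝ (Fin N)) =>
        wdiff Ω s p (h ∘ φ (ns n)) q.2)
      hJ (hcL.comp_snd τ) (fun n => (hnL n).comp_snd τ) h9
  have hI : Integrable (fun x => u b x - u a x) (volume.restrict Ω) :=
    (hu.integrable hΩv hbT).sub (hu.integrable hΩv haT)
  -- The approximants converge to `w` in `L^p` only, which need not suffice against `u b - u a`. The
  -- boundedness of `h` supplies an integrable majorant instead.
  have hLim : Tendsto (fun n => ∫ x in Ω, (u b x - u a x) * h (φ (ns n) x)) atTop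
      (𝓝 (∫ x in Ω, (u b x - u a x) * h (w x))) := by
    refine tendsto_integral_of_dominated_convergence (fun x => |u b x - u a x| * K) (fun n => ?_)
      (hI.abs.mul_const K) (fun n => Eventually.of_forall fun x => ?_) ?_
    · exact hI.1.mul (hh.continuous.comp (hφ (ns n)).1.continuous).aestronglyMeasurable
    · rw [Real.norm_eq_abs, abs_mul]
      gcongr
      exact hK _
    · filter_upwards [ae_restrict_of_ae hae] with x hx
      exact ((hh.continuous.tendsto _).comp hx).const_mul _
  refine tendsto_nhds_unique hLim (hR.neg.congr fun n => ?_)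
  rw [← hu.sub_eq_of_isTest hΩ hΩv hs0 hs1 hp (htest n) ha hab hb]
  have hmul : ∀ t ∈ Icc 0 T, Integrable (fun x => u t x * (h ∘ φ (ns n)) x)
      (volume.restrict Ω) := fun t ht =>
    (hu.integrable hΩv ht).mul_bdd (c := K)
      (hh.continuous.comp (hφ (ns n)).1.continuous).aestronglyMeasurable
      (Eventually.of_forall fun x => hK _)
  rw [← integral_sub (hmul b hbT) (hmul a haT)]
  congr 1
  ext x
  simp only [Function.comp_apply]
  ring

end WeakForm

/-! ### Continuity of translations in time -/

section Translation

/-- Translation in time. -/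
def timeShift {Z : Type*} (σ : ℝ) (q : ℝ × Z) : ℝ × Z := (q.1 - σ, q.2)

theorem measurable_uncurry_timeShift {Z : Type*} [MeasurableSpace Z] :
    Measurable (Function.uncurry (timeShift (Z := Z))) := by
  unfold timeShift Function.uncurry
  fun_prop

theorem measurePreserving_timeShift {Z : Type*} [MeasureSpace Z] [SFinite (volume : Measure Z)]
    (σ : ℝ) : MeasurePreserving (timeShift (Z := Z) σ) volume volume :=
  (measurePreserving_sub_right volume σ).prod (MeasurePreserving.id volume)

variable {Z : Type*} [NormedAddCommGroup Z] [NormedSpace ℝ Z] [FiniteDimensional ℝ Z]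
  [MeasureSpace Z] [BorelSpace Z] [(volume : Measure Z).IsAddHaarMeasure]

theorem tendsto_eLpNorm_timeShift_sub {r : ℝ≥0∞} (hr1 : 1 ≤ r) (hr : r ≠ ⊤) {F : ℝ × Z → ℝ}
    (hF : MemLp F r volume) (σ₀ : ℝ) :
    Tendsto (fun σ => eLpNorm (F ∘ timeShift σ - F ∘ timeShift σ₀) r volume) (𝓝 σ₀) (𝓝 0) := by
  have : Fact (1 ≤ r) := ⟨hr1⟩
  let g : C(ℝ, C(ℝ × Z, ℝ × Z)) :=
    (ContinuousMap.mk (fun a : ℝ × ℝ × Z => timeShift a.1 a.2)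
      (by unfold timeShift; fun_prop)).curry
  have hcont : Continuous fun σ : ℝ => Lp.compMeasurePreserving (timeShift (Z := Z) σ)
      (measurePreserving_timeShift σ) (hF.toLp F) :=
    (continuous_const (y := hF.toLp F)).compMeasurePreservingLp g.continuous
      (fun σ => measurePreserving_timeShift σ) hr
  have h1 := hcont.tendsto σ₀
  simp only [Lp.toLp_compMeasurePreserving] at h1
  exact (Lp.tendsto_Lp_iff_tendsto_eLpNorm'' (fun σ => F ∘ timeShift σ)
    (fun σ => hF.comp_measurePreserving (measurePreserving_timeShift σ)) (F ∘ timeShift σ₀)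
    (hF.comp_measurePreserving (measurePreserving_timeShift σ₀))).1 h1

theorem continuous_integral_timeShift_mul {r r' : ℝ≥0∞} [r.HolderTriple r' 1]
    (hr1 : 1 ≤ r) (hr : r ≠ ⊤) {F P : ℝ × Z → ℝ} (hF : MemLp F r volume)
    (hP : MemLp P r' volume) :
    Continuous fun σ : ℝ => ∫ q, F (timeShift σ q) * P q := by
  have : r'.HolderTriple r 1 := ENNReal.HolderTriple.symm
  refine continuous_iff_continuousAt.2 fun σ₀ => ?_
  have h := tendsto_integral_mul_of_tendsto_eLpNorm (p := r') (q := r) hP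
    (hF.comp_measurePreserving (measurePreserving_timeShift σ₀))
    (fun σ => hF.comp_measurePreserving (measurePreserving_timeShift σ))
    (tendsto_eLpNorm_timeShift_sub hr1 hr hF σ₀)
  simpa only [Function.comp_apply, mul_comm, ContinuousAt] using h

/-- The shear `(σ, t, z) ↦ (σ, t - σ, z)` preserves the product measure, so Hölder's inequality on
the product gives joint integrability. This justifies exchanging the integrals over σ and `t`. -/
theorem integrable_timeShift_mul {Z : Type*} [MeasureSpace Z] [SFinite (volume : Measure Z)]
    {r r' : ℝ≥0∞} [r.HolderTriple r' 1] {F P : ℝ × Z → ℝ}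
    (hF : MemLp F r volume) (hP : MemLp P r' volume) (δ : ℝ) :
    Integrable (fun y : (ℝ × ℝ) × Z => F (y.1.2 - y.1.1, y.2) * P (y.1.2, y.2))
      (((volume.restrict (Ioc 0 δ)).prod volume).prod volume) := by
  set τ : Measure ℝ := volume.restrict (Ioc 0 δ) with hτ
  have hS : MeasurePreserving (fun y : ℝ × ℝ × Z => (y.1, timeShift y.1 y.2))
      (τ.prod volume) (τ.prod volume) :=
    (MeasurePreserving.id τ).skew_product (g := fun σ q => timeShift σ q)
      measurable_uncurry_timeShift
      (Eventually.of_forall fun σ => (measurePreserving_timeShift σ).map_eq)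
  have h1 : MemLp (fun y : ℝ × ℝ × Z => F (timeShift y.1 y.2)) r (τ.prod volume) :=
    (hF.comp_snd τ).comp_measurePreserving hS
  have h2 : Integrable (fun y : ℝ × ℝ × Z => F (timeShift y.1 y.2) * P y.2) (τ.prod volume) :=
    h1.integrable_mul (hP.comp_snd τ)
  exact (measurePreserving_prodAssoc τ volume volume).integrable_comp_of_integrable h2

theorem integral_average_timeShift_mul {Z : Type*} [MeasureSpace Z]
    [SFinite (volume : Measure Z)] {r r' : ℝ≥0∞} [r.HolderTriple r' 1] {F P : ℝ × Z → ℝ}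
    (hF : MemLp F r volume) (hP : MemLp P r' volume) (δ : ℝ) :
    Integrable (fun t => ∫ σ in Ioc 0 δ, ∫ z, F (t - σ, z) * P (t, z)) ∧
    ∫ t, ∫ σ in Ioc 0 δ, ∫ z, F (t - σ, z) * P (t, z)
      = ∫ σ in Ioc 0 δ, ∫ q, F (timeShift σ q) * P q := by
  have h1 := (integrable_timeShift_mul hF hP δ).integral_prod_left
  refine ⟨h1.integral_prod_right, ?_⟩
  rw [← integral_integral_swap (f := fun σ t => ∫ z, F (t - σ, z) * P (t, z)) h1]
  congr 1
  ext σ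
  have h2 : Integrable (fun q : ℝ × Z => F (timeShift σ q) * P q) volume :=
    (hF.comp_measurePreserving (measurePreserving_timeShift σ)).integrable_mul hP
  rw [Measure.volume_eq_prod] at h2 ⊢
  rw [integral_prod _ h2]
  rfl

end Translation

/-! ### The energy inequality -/

section Energy

variable {N : ℕ} {Ω : Set (EuclideanSpace ℝ (Fin N))} {s p T : ℝ}
  {u₀ w ψ : EuclideanSpace ℝ (Fin N) → ℝ} {u : ℝ → EuclideanSpace ℝ (Fin N) → ℝ}

/-- An element differs from some smooth approximant by a function of finite seminorm, and the
approximant itself has finite seminorm. -/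
theorem MemW0.gagliardo_lt_top [NeZero N] (hw : MemW0 Ω s p w) (hΩ : MeasurableSet Ω)
    (hΩv : volume Ω < ⊤) (hs0 : 0 < s) (hs1 : s < 1) (hp : 0 < p) : gagliardo Ω s p w < ⊤ := by
  obtain ⟨φ, hφ, -, hφg⟩ := hw.approx
  obtain ⟨n, hn⟩ := (hφg.eventually_lt_const ENNReal.zero_lt_top).exists
  have htest : IsTest Ω (φ n) := ⟨(hφ n).1, (hφ n).2.1, (hφ n).2.2⟩
  have h1 := htest.memLp_wdiff hΩ hΩv hs0 hs1 hp
  have h2 := FracPLap.memLp_wdiff hΩ hp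
    (hw.memLp.1.sub htest.contDiff.continuous.aestronglyMeasurable) hn
  have h3 := h2.add h1
  rw [wdiff_sub, sub_add_cancel] at h3
  rw [gagliardo_eq_lintegral_wdiff hΩ hp]
  exact (eLpNorm_ofReal_lt_top_iff hp).1 h3.2

theorem signedPow_div {x d : ℝ} (hd : 0 < d) :
    signedPow p (x / d) = signedPow p x / d ^ (p - 1) := by
  have : d ^ (p - 1) = d ^ (p - 2) * d := by
    nth_rewrite 3 [← Real.rpow_one d]
    rw [← Real.rpow_add hd]
    congr 1
    ring
  rw [signedPow, signedPow, abs_div, abs_of_pos hd, Real.div_rpow (abs_nonneg _) hd.le, this]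
  field_simp

/-- Both sides scale by the same power of the kernel, since `d^p = d^(p-1) · d`, so the inequality
for numbers passes to difference quotients. -/
theorem abs_wdiff_comp_rpow_le (hp : 1 < p) {f h : ℝ → ℝ}
    (hfh : ∀ a b, |f a - f b| ^ p ≤ signedPow p (a - b) * (h a - h b))
    (z : EuclideanSpace ℝ (Fin N) × EuclideanSpace ℝ (Fin N)) :
    |wdiff Ω s p (f ∘ w) z| ^ p ≤ signedPow p (wdiff Ω s p w z) * wdiff Ω s p (h ∘ w) z := by
  have hp0 : 0 < p := by linarith
  by_cases hz : z ∈ interactionDomain Ω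
  · simp only [wdiff, indicator_of_mem hz, Function.comp_apply]
    set d := ‖z.1 - z.2‖ ^ (((N : ℝ) + p * s) / p) with hd
    have hd0 : 0 ≤ d := by positivity
    rcases hd0.eq_or_lt with h0 | h0
    · rw [← h0]
      simp [hp0.ne']
    · rw [signedPow_div h0, abs_div, abs_of_pos h0, Real.div_rpow (abs_nonneg _) h0.le]
      have e : d ^ p = d ^ (p - 1) * d := by
        nth_rewrite 3 [← Real.rpow_one d]
        rw [← Real.rpow_add h0]
        congr 1
        ring
      rw [div_mul_div_comm, ← e]
      gcongr
      exact hfh _ _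
  · simp [wdiff, indicator_of_notMem hz, hp0.ne']

instance isAddHaarMeasure_volume_prod : (volume : Measure (EuclideanSpace ℝ (Fin N) ×
    EuclideanSpace ℝ (Fin N))).IsAddHaarMeasure :=
  inferInstanceAs ((volume : Measure (EuclideanSpace ℝ (Fin N))).prod
    volume).IsAddHaarMeasure

theorem IsEnergySolution.integrable_comp (hu : IsEnergySolution Ω s p T u₀ u)
    (hΩv : volume Ω < ⊤) {G : ℝ → ℝ} {K : ℝ} (hG : Continuous G) (hG0 : G 0 = 0)
    (hK : ∀ a b, |G a - G b| ≤ K * |a - b|) {t : ℝ} (ht : t ∈ Icc 0 T) :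
    IntegrableOn (fun x => G (u t x)) Ω := by
  refine Integrable.mono' ((hu.integrable hΩv ht).abs.const_mul K)
    (hG.comp_aestronglyMeasurable (hu.memL2 t ht).1) (Eventually.of_forall fun x => ?_)
  simpa [hG0] using hK (u t x) 0

theorem nonpos_of_hasDerivAt_of_nonpos {D : ℝ → ℝ} {D' a : ℝ} (hD : HasDerivAt D D' 0)
    (h0 : D 0 = 0) (ha : 0 < a) (hle : ∀ δ, 0 < δ → δ < a → D δ ≤ 0) : D' ≤ 0 := by
  refine le_of_tendsto hD.tendsto_slope_zero_right ?_
  filter_upwards [Ioo_mem_nhdsGT ha] with δ hδ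
  rw [zero_add, h0, sub_zero, smul_eq_mul]
  exact mul_nonpos_of_nonneg_of_nonpos (inv_nonneg.2 hδ.1.le) (hle δ hδ.1 hδ.2)

/-- The energy inequality, obtained by testing with a smooth nondecreasing function of the
solution. -/
theorem IsEnergySolution.energy_le [NeZero N] (hu : IsEnergySolution Ω s p T u₀ u)
    (hΩ : MeasurableSet Ω) (hΩv : volume Ω < ⊤) (hs0 : 0 < s) (hs1 : s < 1) (hp : 1 < p)
    {g : ℝ → ℝ} (hg : ContDiff ℝ ∞ g) (hgc : HasCompactSupport g) (hg0 : ∀ r, 0 ≤ g r)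
    {a b : ℝ} (ha : 0 < a) (hab : a < b) (hb : b ≤ T) :
    ENNReal.ofReal (∫ x in Ω, primitive (primitive g) (u b x))
      + ENNReal.ofReal (1 / 2) * (∫⁻ t in Ioo a b,
        gagliardo Ω s p (primitive (fun r => g r ^ (1 / p)) ∘ u t))
      ≤ ENNReal.ofReal (∫ x in Ω, primitive (primitive g) (u a x)) := by
  have hp0 : 0 < p := by linarith
  have hT : 0 < T := ha.trans (hab.trans_le hb)
  have hconj' := Real.HolderConjugate.conjExponent hp
  have hconj := hconj'.symm.ennrealOfReal
  set h := primitive g with hh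
  set G := primitive h with hG
  set f := primitive (fun r => g r ^ (1 / p)) with hf
  have hgcont := hg.continuous
  have hfcont : Continuous f :=
    continuous_primitive' (hgcont.rpow_const fun _ => Or.inr (by positivity))
  have hhs : ContDiff ℝ ∞ h := contDiff_primitive hg
  have hhm : Monotone h := monotone_primitive hgcont hg0
  have hGc : Continuous G := continuous_primitive' hhs.continuous
  obtain ⟨L, hL'⟩ := hgc.exists_bound_of_continuous hgcont
  have hL : ∀ r r', |h r - h r'| ≤ L * |r - r'| := abs_primitive_sub_le hgcont hL'
  obtain ⟨K, hK0, hK⟩ := exists_abs_primitive_le hgcont hgc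
  have hGK : ∀ r r', |G r - G r'| ≤ K * |r - r'| := abs_primitive_sub_le hhs.continuous hK
  have hGu : ∀ t ∈ Icc 0 T, IntegrableOn (fun x => G (u t x)) Ω := fun t ht =>
    hu.integrable_comp hΩv hGc primitive_zero hGK ht
  set E : ℝ → ℝ := fun t => ∫ x in Ω, G (u t x) with hE
  have hEc : ContinuousOn E (Icc 0 T) :=
    hu.continuousOn_integral hΩv (fun _ => G) hK0 (fun _ => hGK) hGu
  set E' : ℝ → ℝ := IccExtend hT.le ((Icc 0 T).domRestrict E) with hE'
  have hE'c : Continuous E' := continuous_IccExtend_iff.2 hEc.domRestrict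
  have hE'eq : ∀ t ∈ Icc 0 T, E' t = E t := fun t ht => by
    rw [hE', IccExtend_of_mem _ _ ht]; rfl
  -- the two space-time fields
  set U : ℝ × EuclideanSpace ℝ (Fin N) × EuclideanSpace ℝ (Fin N) → ℝ :=
    fun q => wdiff Ω s p (u q.1) q.2 with hU
  set V : ℝ × EuclideanSpace ℝ (Fin N) × EuclideanSpace ℝ (Fin N) → ℝ :=
    fun q => wdiff Ω s p (h ∘ u q.1) q.2 with hV
  have hres : ∀ A : Set ℝ, (volume : Measure (ℝ × EuclideanSpace ℝ (Fin N) ×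
      EuclideanSpace ℝ (Fin N))).restrict (A ×ˢ univ) = (volume.restrict A).prod volume := by
    intro A
    rw [Measure.volume_eq_prod, ← Measure.prod_restrict, Measure.restrict_univ]
  have hUL := hu.memParabolic.memLp_wdiff hΩ hp0
  have hum : AEStronglyMeasurable (Function.uncurry u)
      ((volume.restrict (Ioo 0 T)).prod volume) := hu.memParabolic.memLp.1
  have hVL : MemLp V (ENNReal.ofReal p) ((volume.restrict (Ioo 0 T)).prod volume) := by
    refine (hUL.const_mul L).mono (aestronglyMeasurable_wdiff_uncurry (u := fun t => h ∘ u t) hΩ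
      (hhs.continuous.comp_aestronglyMeasurable hum)) (Eventually.of_forall fun q => ?_)
    rw [Real.norm_eq_abs, Real.norm_eq_abs]
    exact (abs_wdiff_comp_le hL q.2).trans ((le_abs_self _).trans (by simp [abs_mul]))
  have hsub : Ioo a b ⊆ Ioo 0 T := Ioo_subset_Ioo ha.le hb
  -- Flux and test field are extended by zero to all times so that translations act on them. For `t`
  -- in `(a, b)` and `σ ≤ δ < a` the shifted time stays in `(0, T)`, where the cutoff of `F` is
  -- invisible.
  set F : ℝ × EuclideanSpace ℝ (Fin N) × EuclideanSpace ℝ (Fin N) → ℝ :=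
    (Ioo 0 T ×ˢ univ).indicator fun q => signedPow p (U q) with hF
  set P : ℝ × EuclideanSpace ℝ (Fin N) × EuclideanSpace ℝ (Fin N) → ℝ :=
    (Ioo a b ×ˢ univ).indicator V with hP
  have hFL : MemLp F (ENNReal.ofReal p.conjExponent) volume := by
    rw [hF, memLp_indicator_iff_restrict (measurableSet_Ioo.prod MeasurableSet.univ), hres]
    exact memLp_signedPow hp hUL
  have hPL : MemLp P (ENNReal.ofReal p) volume := by
    rw [hP, memLp_indicator_iff_restrict (measurableSet_Ioo.prod MeasurableSet.univ), hres]
    exact hVL.mono_measure (Measure.prod_mono (Measure.restrict_mono hsub le_rfl) le_rfl)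
  set Ψ : ℝ → ℝ := fun σ => ∫ q, F (timeShift σ q) * P q with hΨ
  have hΨc : Continuous Ψ := continuous_integral_timeShift_mul
    (ENNReal.one_le_ofReal.2 hconj'.symm.lt.le) ENNReal.ofReal_ne_top hFL hPL
  -- the equation tested at almost every time
  have hpt : ∀ δ, 0 < δ → δ < a → ∀ᵐ t ∂(volume.restrict (Ioo a b)),
      E' t - E' (t - δ) ≤ -(1 / 2) * ∫ σ in Ioc 0 δ, ∫ z, F (t - σ, z) * P (t, z) := by
    intro δ hδ0 hδa
    have hmem : ∀ᵐ t ∂(volume.restrict (Ioo a b)), MemW0 Ω s p (u t) :=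
      ae_mono (Measure.restrict_mono hsub le_rfl) hu.memParabolic.memW0
    filter_upwards [hmem, ae_restrict_mem measurableSet_Ioo] with t hw ht
    have htT : t ∈ Icc 0 T := Ioo_subset_Icc_self (hsub ht)
    have htδ : t - δ ∈ Icc 0 T := ⟨by linarith [ht.1], by linarith [htT.2]⟩
    -- The test function is `h(u(t))`, frozen at the final time of the window `(t - δ, t)`. It is
    -- admissible for almost every `t`, and no time regularity of `h(u)` is required.
    have h1 := hu.sub_eq_of_comp hΩ hΩv hs0 hs1 hp hw (hw.gagliardo_lt_top hΩ hΩv hs0 hs1 hp0)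
      hhs primitive_zero hK hL (a := t - δ) (b := t) (by linarith [ht.1]) (by linarith)
      (hsub ht).2
    have h2 : E t - E (t - δ) ≤ ∫ x in Ω, (u t x - u (t - δ) x) * h (u t x) := by
      simp only [hE]
      rw [← integral_sub (hGu t htT) (hGu _ htδ)]
      refine integral_mono ((hGu t htT).sub (hGu _ htδ)) ?_ fun x => ?_
      · exact ((hu.integrable hΩv htT).sub (hu.integrable hΩv htδ)).mul_bdd (c := K)
          (hhs.continuous.comp_aestronglyMeasurable (hu.memL2 t htT).1)
          (Eventually.of_forall fun x => hK _)
      · have := primitive_sub_le_of_monotone hhs.continuous hhm (u t x) (u (t - δ) x)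
        rw [mul_comm] at this
        exact this
    have h3 : ∫ τ in Ioc (t - δ) t, (1 / 2) * ∫ z, signedPow p (wdiff Ω s p (u τ) z)
        * wdiff Ω s p (h ∘ u t) z
        = (1 / 2) * ∫ σ in Ioc 0 δ, ∫ z, F (t - σ, z) * P (t, z) := by
      rw [integral_const_mul, ← intervalIntegral.integral_of_le (by linarith),
        ← intervalIntegral.integral_of_le hδ0.le]
      congr 1
      have := intervalIntegral.integral_comp_sub_left (a := 0) (b := δ)
        (fun τ => ∫ z, signedPow p (wdiff Ω s p (u τ) z) * wdiff Ω s p (h ∘ u t) z) t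
      rw [sub_zero] at this
      rw [← this]
      refine intervalIntegral.integral_congr fun σ hσ => ?_
      rw [uIcc_of_le hδ0.le] at hσ
      have hσT : t - σ ∈ Ioo 0 T :=
        ⟨by linarith [ht.1, hσ.2], by linarith [(hsub ht).2, hσ.1]⟩
      refine integral_congr_ae (Eventually.of_forall fun z => ?_)
      have hm1 : ((t - σ, z) : ℝ × EuclideanSpace ℝ (Fin N) × EuclideanSpace ℝ (Fin N))
          ∈ Ioo 0 T ×ˢ univ := ⟨hσT, mem_univ _⟩
      have hm2 : ((t, z) : ℝ × EuclideanSpace ℝ (Fin N) × EuclideanSpace ℝ (Fin N))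
          ∈ Ioo a b ×ˢ univ := ⟨ht, mem_univ _⟩
      simp only [hF, hP, indicator_of_mem hm1, indicator_of_mem hm2, hU, hV]
    rw [hE'eq t htT, hE'eq _ htδ]
    rw [h3] at h1
    rw [h1] at h2
    linarith
  -- integrate over `(a, b)`
  set D : ℝ → ℝ := fun δ => (primitive E' b - primitive E' a)
    - (primitive E' (b - δ) - primitive E' (a - δ)) + (1 / 2) * primitive Ψ δ with hD
  have hDle : ∀ δ, 0 < δ → δ < a → D δ ≤ 0 := by
    intro δ hδ0 hδa
    obtain ⟨hRi, hR⟩ := integral_average_timeShift_mul hFL hPL δ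
    have h1 : ∫ t in Ioo a b, ∫ σ in Ioc 0 δ, ∫ z, F (t - σ, z) * P (t, z)
        = primitive Ψ δ := by
      rw [primitive, intervalIntegral.integral_of_le hδ0.le, ← hR]
      refine setIntegral_eq_integral_of_forall_compl_eq_zero fun t ht => ?_
      have : ∀ z, P (t, z) = 0 := fun z => indicator_of_notMem (fun h' => ht h'.1) _
      simp [this]
    have hc2 : Continuous fun t => E' (t - δ) := hE'c.comp (by fun_prop)
    have hc1 : Continuous fun t => E' t - E' (t - δ) := hE'c.sub hc2
    have h2 : ∫ t in Ioo a b, (E' t - E' (t - δ))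
        = (primitive E' b - primitive E' a)
          - (primitive E' (b - δ) - primitive E' (a - δ)) := by
      rw [← integral_Ioc_eq_integral_Ioo, ← intervalIntegral.integral_of_le hab.le,
        intervalIntegral.integral_sub (hE'c.intervalIntegrable _ _)
          (hc2.intervalIntegrable _ _),
        intervalIntegral.integral_comp_sub_right (fun t => E' t) δ, primitive_sub hE'c,
        primitive_sub hE'c]
    have h3 := setIntegral_mono_ae_restrict (μ := volume) (s := Ioo a b)
      (hc1.continuousOn.integrableOn_Icc.mono_set Ioo_subset_Icc_self)
      ((hRi.integrableOn (s := Ioo a b)).const_mul (-(1 / 2))) (hpt δ hδ0 hδa)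
    rw [h2, integral_const_mul, h1] at h3
    simp only [hD]
    linarith
  have hDd : HasDerivAt D (E' b - E' a + (1 / 2) * Ψ 0) 0 := by
    have hd : ∀ c : ℝ, HasDerivAt (fun δ => primitive E' (c - δ)) (-E' c) 0 := fun c => by
      have h1 : HasDerivAt (primitive E') (E' c) (c - 0) := by
        rw [sub_zero]; exact hasDerivAt_primitive hE'c c
      have := h1.comp (0 : ℝ) ((hasDerivAt_id (0 : ℝ)).const_sub c)
      simpa [Function.comp_def] using this
    have h2 := (((hd b).sub (hd a)).const_sub (primitive E' b - primitive E' a)).add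
      ((hasDerivAt_primitive hΨc 0).const_mul (1 / 2))
    have e : E' b - E' a + (1 / 2) * Ψ 0 = -(-E' b - -E' a) + (1 / 2) * Ψ 0 := by ring
    rw [e]
    exact h2
  have hD0 : D 0 = 0 := by simp [hD]
  have hmain := nonpos_of_hasDerivAt_of_nonpos hDd hD0 ha hDle
  rw [hE'eq b ⟨(ha.trans hab).le, hb⟩, hE'eq a ⟨ha.le, hab.le.trans hb⟩] at hmain
  -- the dissipation
  have hFP : Integrable (fun q => F q * P q) volume := hFL.integrable_mul hPL
  have hlow : ∀ q : ℝ × EuclideanSpace ℝ (Fin N) × EuclideanSpace ℝ (Fin N),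
      (Ioo a b ×ˢ univ).indicator (fun q => |wdiff Ω s p (f ∘ u q.1) q.2| ^ p) q
        ≤ F q * P q := by
    intro q
    by_cases hq : q ∈ Ioo a b ×ˢ (univ : Set (EuclideanSpace ℝ (Fin N) ×
        EuclideanSpace ℝ (Fin N)))
    · have hq' : q ∈ Ioo 0 T ×ˢ (univ : Set (EuclideanSpace ℝ (Fin N) ×
        EuclideanSpace ℝ (Fin N))) := ⟨hsub hq.1, mem_univ _⟩
      simp only [hF, hP, indicator_of_mem hq, indicator_of_mem hq']
      exact abs_wdiff_comp_rpow_le hp (abs_primitive_sub_rpow_le hp hgcont hg0) q.2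
    · simp [hP, indicator_of_notMem hq]
  have hFP0 : ∀ q, 0 ≤ F q * P q := fun q =>
    (indicator_nonneg (fun _ _ => by positivity) q).trans (hlow q)
  have hΨ0 : Ψ 0 = ∫ q, F q * P q := by
    simp only [hΨ, timeShift, sub_zero]
  have hdiss : ∫⁻ t in Ioo a b, gagliardo Ω s p (f ∘ u t) ≤ ENNReal.ofReal (Ψ 0) := by
    have hfm : AEStronglyMeasurable (fun q : ℝ × EuclideanSpace ℝ (Fin N) ×
        EuclideanSpace ℝ (Fin N) => wdiff Ω s p (f ∘ u q.1) q.2)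
        ((volume.restrict (Ioo a b)).prod volume) :=
      aestronglyMeasurable_wdiff_uncurry (u := fun t => f ∘ u t) hΩ
        (hfcont.comp_aestronglyMeasurable (hum.mono_measure
          (Measure.prod_mono (Measure.restrict_mono hsub le_rfl) le_rfl)))
    rw [hΨ0, ofReal_integral_eq_lintegral_ofReal hFP (Eventually.of_forall hFP0)]
    simp only [gagliardo_eq_lintegral_wdiff hΩ hp0]
    rw [← lintegral_prod (fun q : ℝ × EuclideanSpace ℝ (Fin N) × EuclideanSpace ℝ (Fin N) =>
      ‖wdiff Ω s p (f ∘ u q.1) q.2‖ₑ ^ p) (hfm.enorm.pow_const p), ← hres,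
      ← lintegral_indicator (measurableSet_Ioo.prod MeasurableSet.univ)]
    refine lintegral_mono fun q => ?_
    by_cases hq : q ∈ Ioo a b ×ˢ (univ : Set (EuclideanSpace ℝ (Fin N) ×
        EuclideanSpace ℝ (Fin N)))
    · have := hlow q
      rw [indicator_of_mem hq] at this
      rw [indicator_of_mem hq, enorm_rpow_eq_ofReal hp0.le]
      exact ENNReal.ofReal_le_ofReal this
    · rw [indicator_of_notMem hq]
      exact zero_le
  have hEb : 0 ≤ E b := integral_nonneg fun x =>
    primitive_nonneg_of_monotone hhs.continuous hhm primitive_zero _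
  have hΨnn : 0 ≤ Ψ 0 := by
    rw [hΨ0]; exact integral_nonneg hFP0
  calc ENNReal.ofReal (E b) + ENNReal.ofReal (1 / 2) * (∫⁻ t in Ioo a b,
        gagliardo Ω s p (f ∘ u t))
      ≤ ENNReal.ofReal (E b) + ENNReal.ofReal (1 / 2) * ENNReal.ofReal (Ψ 0) := by gcongr
    _ = ENNReal.ofReal (E b + (1 / 2) * Ψ 0) := by
        rw [← ENNReal.ofReal_mul (by norm_num), ← ENNReal.ofReal_add hEb (by positivity)]
    _ ≤ ENNReal.ofReal (E a) := ENNReal.ofReal_le_ofReal (by linarith)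

end Energy

/-! ### Finite-time extinction and the decay of the power energy -/

section Extinction

/-- Finite-time extinction for the integrated form of `y' + c y^θ ≤ 0`, `θ < 1`. -/
theorem exists_extinction_time {c θ Y₀ : ℝ} (hc : 0 < c) (hθ0 : 0 < θ) (hθ1 : θ < 1)
    (hY₀ : 0 < Y₀) :
    ∃ Tstar : ℝ, 0 < Tstar ∧ ∀ (T : ℝ) (y : ℝ → ℝ), (∀ t, 0 < t → t ≤ T → 0 ≤ y t) →
      (∀ t, 0 < t → t ≤ T → y t ≤ Y₀) →
      (∀ a b, 0 < a → a < b → b ≤ T → y b + c * (b - a) * y b ^ θ ≤ y a) →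
      ∀ t, Tstar ≤ t → t ≤ T → y t = 0 := by
  set x : ℕ → ℝ := fun j => Y₀ * (1 / 2) ^ j with hx
  have hx0 : ∀ j, 0 < x j := fun j => by positivity
  have hxs : ∀ j, x (j + 1) = x j / 2 := fun j => by simp only [hx]; ring
  -- `τ j` is the time allowed for halving the bound `x j`: if `y` were still above `x j / 2`, the
  -- decay over this time would already amount to `x j`, leaving nothing.
  set τ : ℕ → ℝ := fun j => x j / (c * (x j / 2) ^ θ) with hτ
  have hτ0 : ∀ j, 0 < τ j := fun j => by have := hx0 j; positivity
  -- The waiting times are geometric with ratio `(1/2)^(1-θ)`, and `θ < 1` makes their sum finite.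
  have hτeq : ∀ j, τ j = Y₀ ^ (1 - θ) * 2 ^ θ / c * ((1 / 2) ^ (1 - θ)) ^ j := by
    intro j
    have h1 : τ j = x j ^ (1 - θ) * 2 ^ θ / c := by
      simp only [hτ]
      rw [Real.div_rpow (hx0 j).le (by norm_num), Real.rpow_sub (hx0 j), Real.rpow_one]
      field_simp
    have h2 : ((1 / 2 : ℝ) ^ j) ^ (1 - θ) = ((1 / 2) ^ (1 - θ)) ^ j := by
      rw [← Real.rpow_natCast, ← Real.rpow_natCast, ← Real.rpow_mul (by norm_num),
        ← Real.rpow_mul (by norm_num), mul_comm]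
    rw [h1, hx, Real.mul_rpow hY₀.le (by positivity), h2]
    ring
  have hsum : Summable τ := by
    simp only [funext hτeq]
    refine (summable_geometric_of_lt_one (by positivity) ?_).mul_left _
    exact Real.rpow_lt_one (by norm_num) (by norm_num) (by linarith)
  -- The summand 1 keeps every time used strictly positive, as the hypotheses on `y` require.
  refine ⟨1 + ∑' j, τ j, add_pos_of_pos_of_nonneg one_pos (tsum_nonneg fun j => (hτ0 j).le), ?_⟩
  intro T y hy0 hyle hdec t ht htT
  have key : ∀ j : ℕ, ∀ t, 1 + ∑ i ∈ Finset.range j, τ i ≤ t → t ≤ T → y t ≤ x j := by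
    intro j
    induction j with
    | zero =>
      intro t ht htT
      simp only [Finset.range_zero, Finset.sum_empty, add_zero] at ht
      simpa [hx] using hyle t (by linarith) htT
    | succ j ih =>
      intro t ht htT
      rw [Finset.sum_range_succ] at ht
      have hs : 0 ≤ ∑ i ∈ Finset.range j, τ i := Finset.sum_nonneg fun i _ => (hτ0 i).le
      have ha : 1 + ∑ i ∈ Finset.range j, τ i ≤ t - τ j := by linarith
      have hya := ih (t - τ j) ha (by linarith [hτ0 j])
      have hd := hdec (t - τ j) t (by linarith) (by linarith [hτ0 j]) htT
      by_contra! hlt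
      rw [hxs] at hlt
      have hxj := hx0 j
      have h1 : (x j / 2) ^ θ ≤ y t ^ θ := Real.rpow_le_rpow (by positivity) hlt.le hθ0.le
      have h2 : c * τ j * (x j / 2) ^ θ = x j := by
        simp only [hτ]
        have : 0 < (x j / 2) ^ θ := by positivity
        field_simp
      have h3 : c * τ j * (x j / 2) ^ θ ≤ c * τ j * y t ^ θ :=
        mul_le_mul_of_nonneg_left h1 (mul_pos hc (hτ0 j)).le
      rw [sub_sub_cancel] at hd
      linarith
  have htpos : 0 < t := by
    have : 0 ≤ ∑' j, τ j := tsum_nonneg fun j => (hτ0 j).le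
    linarith
  refine le_antisymm ?_ (hy0 t htpos htT)
  have hxlim : Tendsto x atTop (𝓝 0) := by
    have := (tendsto_pow_atTop_nhds_zero_of_lt_one (r := (1 / 2 : ℝ)) (by norm_num)
      (by norm_num)).const_mul Y₀
    rwa [mul_zero] at this
  refine ge_of_tendsto' hxlim fun j => key j t (le_trans ?_ ht) htT
  have := hsum.sum_le_tsum (Finset.range j) fun i _ => (hτ0 i).le
  linarith

variable {N : ℕ} {Ω : Set (EuclideanSpace ℝ (Fin N))} {s p T ν : ℝ}
  {u₀ w : EuclideanSpace ℝ (Fin N) → ℝ} {u : ℝ → EuclideanSpace ℝ (Fin N) → ℝ}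

/-- `∫_Ω |w|^(ν+1)`. -/
def powerEnergy (Ω : Set (EuclideanSpace ℝ (Fin N))) (ν : ℝ)
    (w : EuclideanSpace ℝ (Fin N) → ℝ) : ℝ≥0∞ := ∫⁻ x in Ω, ‖w x‖ₑ ^ (ν + 1)

theorem continuous_energyDensity (k : ℕ) : Continuous (energyDensity ν k) :=
  continuous_primitive' (continuous_primitive_cutoffPow k)

theorem exists_lipschitz_energyDensity (k : ℕ) :
    ∃ K : ℝ, 0 ≤ K ∧ ∀ a b, |energyDensity ν k a - energyDensity ν k b| ≤ K * |a - b| := by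
  obtain ⟨K, hK0, hK⟩ := exists_abs_primitive_le (contDiff_cutoffPow (ν := ν) k).continuous
    (hasCompactSupport_cutoffPow k)
  exact ⟨K, hK0, abs_primitive_sub_le (continuous_primitive_cutoffPow k) hK⟩

theorem ofReal_mul_abs_rpow {c a r : ℝ} (hc : 0 ≤ c) (hr : 0 ≤ r) :
    ENNReal.ofReal (c * |a| ^ r) = ENNReal.ofReal c * ‖a‖ₑ ^ r := by
  rw [ENNReal.ofReal_mul hc, enorm_rpow_eq_ofReal hr]

theorem ofReal_integral_energyDensity_le (hν : 1 < ν) (k : ℕ)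
    (hw : AEStronglyMeasurable w (volume.restrict Ω)) :
    ENNReal.ofReal (∫ x in Ω, energyDensity ν k (w x))
      ≤ ENNReal.ofReal (1 / (ν + 1)) * powerEnergy Ω ν w := by
  rw [powerEnergy, ← lintegral_const_mul' _ _ ENNReal.ofReal_ne_top,
    integral_eq_lintegral_of_nonneg_ae
      (Eventually.of_forall fun x => energyDensity_nonneg hν k (w x))
      ((continuous_energyDensity k).comp_aestronglyMeasurable hw)]
  refine ENNReal.ofReal_toReal_le.trans (lintegral_mono fun x => ?_)
  rw [← ofReal_mul_abs_rpow (by positivity) (by linarith)]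
  exact ENNReal.ofReal_le_ofReal (energyDensity_le hν k (w x))

theorem tendsto_lintegral_energyDensity (hν : 1 < ν)
    (hw : AEStronglyMeasurable w (volume.restrict Ω)) (hfin : powerEnergy Ω ν w ≠ ⊤) :
    Tendsto (fun k => ∫⁻ x in Ω, ENNReal.ofReal (energyDensity ν k (w x))) atTop
      (𝓝 (ENNReal.ofReal (1 / (ν + 1)) * powerEnergy Ω ν w)) := by
  rw [powerEnergy, ← lintegral_const_mul' _ _ ENNReal.ofReal_ne_top]
  refine tendsto_lintegral_of_dominated_convergence'
    (fun x => ENNReal.ofReal (1 / (ν + 1)) * ‖w x‖ₑ ^ (ν + 1)) (fun k => ?_)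
    (fun k => Eventually.of_forall fun x => ?_) ?_ (Eventually.of_forall fun x => ?_)
  · exact ((continuous_energyDensity k).comp_aestronglyMeasurable hw).aemeasurable.ennreal_ofReal
  · simp only
    rw [← ofReal_mul_abs_rpow (by positivity) (by linarith)]
    exact ENNReal.ofReal_le_ofReal (energyDensity_le hν k (w x))
  · rw [lintegral_const_mul' _ _ ENNReal.ofReal_ne_top]
    exact ENNReal.mul_ne_top ENNReal.ofReal_ne_top hfin
  · rw [← ofReal_mul_abs_rpow (by positivity) (by linarith)]
    exact ENNReal.tendsto_ofReal (tendsto_energyDensity hν (w x))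

theorem continuous_dissipationRoot (hp : 0 < p) (k : ℕ) : Continuous (dissipationRoot p ν k) :=
  continuous_primitive' (continuous_cutoffPow_rpow hp k)

/-- The constant in front of `|a|^((ν - 1) / p + 1)` in the limit of the dissipation roots. -/
def rootConst (p ν : ℝ) : ℝ := ν ^ (1 / p) / ((ν - 1) / p + 1)

theorem rootConst_pos (hp : 0 < p) (hν : 1 < ν) : 0 < rootConst p ν := by
  have h1 : 0 ≤ (ν - 1) / p := div_nonneg (by linarith) hp.le
  have h2 : 0 < ν := by linarith
  unfold rootConst
  positivity

theorem mul_abs_rpow_rpow {c β q r a : ℝ} (hc : 0 ≤ c) (hr : β * q = r) :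
    (c * |a| ^ β) ^ q = c ^ q * |a| ^ r := by
  rw [Real.mul_rpow hc (by positivity), ← Real.rpow_mul (abs_nonneg _), hr]

theorem enorm_dissipationRoot_rpow_le (hp : 0 < p) (hν : 1 < ν) {q : ℝ} (hq : 0 ≤ q)
    (hβ : ((ν - 1) / p + 1) * q = ν + 1) (k : ℕ) (a : ℝ) :
    ‖dissipationRoot p ν k a‖ₑ ^ q
      ≤ ENNReal.ofReal (rootConst p ν ^ q) * ‖a‖ₑ ^ (ν + 1) := by
  have hc := rootConst_pos hp hν
  rw [← ofReal_mul_abs_rpow (by positivity) (by linarith), enorm_rpow_eq_ofReal hq,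
    ← mul_abs_rpow_rpow hc.le hβ]
  refine ENNReal.ofReal_le_ofReal (Real.rpow_le_rpow (abs_nonneg _) ?_ hq)
  exact abs_dissipationRoot_le hp hν k a

theorem tendsto_enorm_dissipationRoot_rpow (hp : 0 < p) (hν : 1 < ν) {q : ℝ} (hq : 0 ≤ q)
    (hβ : ((ν - 1) / p + 1) * q = ν + 1) (a : ℝ) :
    Tendsto (fun k => ‖dissipationRoot p ν k a‖ₑ ^ q) atTop
      (𝓝 (ENNReal.ofReal (rootConst p ν ^ q) * ‖a‖ₑ ^ (ν + 1))) := by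
  have hc := rootConst_pos hp hν
  simp only [enorm_rpow_eq_ofReal hq]
  rw [← ofReal_mul_abs_rpow (by positivity) (by linarith), ← mul_abs_rpow_rpow hc.le hβ]
  exact ENNReal.tendsto_ofReal
    ((tendsto_abs_dissipationRoot hp hν a).rpow_const (Or.inr hq))

theorem tendsto_lintegral_dissipationRoot (hp : 0 < p) (hν : 1 < ν) {q : ℝ} (hq : 0 ≤ q)
    (hβ : ((ν - 1) / p + 1) * q = ν + 1)
    (hw : AEStronglyMeasurable w (volume.restrict Ω)) (hfin : powerEnergy Ω ν w ≠ ⊤) :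
    Tendsto (fun k => ∫⁻ x in Ω, ‖dissipationRoot p ν k (w x)‖ₑ ^ q) atTop
      (𝓝 (ENNReal.ofReal (rootConst p ν ^ q) * powerEnergy Ω ν w)) := by
  rw [powerEnergy, ← lintegral_const_mul' _ _ ENNReal.ofReal_ne_top]
  refine tendsto_lintegral_of_dominated_convergence'
    (fun x => ENNReal.ofReal (rootConst p ν ^ q) * ‖w x‖ₑ ^ (ν + 1)) (fun k => ?_)
    (fun k => Eventually.of_forall fun x => enorm_dissipationRoot_rpow_le hp hν hq hβ k _) ?_
    (Eventually.of_forall fun x => tendsto_enorm_dissipationRoot_rpow hp hν hq hβ _)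
  · exact ((continuous_dissipationRoot hp k).comp_aestronglyMeasurable hw).enorm.pow_const q
  · rw [lintegral_const_mul' _ _ ENNReal.ofReal_ne_top]
    exact ENNReal.mul_ne_top ENNReal.ofReal_ne_top hfin

/-- Fatou's lemma as the truncation is removed; finiteness of the power energy of `w` is thereby a
conclusion whenever `Y` is finite. -/
theorem powerEnergy_le_of_forall (hν : 1 < ν) {Y : ℝ≥0∞}
    (hI : ∀ k, IntegrableOn (fun x => energyDensity ν k (w x)) Ω)
    (hw : AEStronglyMeasurable w (volume.restrict Ω))
    (hk : ∀ k, ENNReal.ofReal (∫ x in Ω, energyDensity ν k (w x))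
      ≤ ENNReal.ofReal (1 / (ν + 1)) * Y) : powerEnergy Ω ν w ≤ Y := by
  have hc0 : ENNReal.ofReal (1 / (ν + 1)) ≠ 0 := by
    rw [Ne, ENNReal.ofReal_eq_zero, not_le]
    positivity
  rw [← ENNReal.mul_le_mul_iff_right hc0 ENNReal.ofReal_ne_top]
  have hfat : ∫⁻ x in Ω, liminf (fun k => ENNReal.ofReal (energyDensity ν k (w x))) atTop
      ≤ liminf (fun k => ∫⁻ x in Ω, ENNReal.ofReal (energyDensity ν k (w x))) atTop :=
    lintegral_liminf_le' fun k =>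
      ((continuous_energyDensity k).comp_aestronglyMeasurable hw).aemeasurable.ennreal_ofReal
  have hlim : ∀ x, liminf (fun k => ENNReal.ofReal (energyDensity ν k (w x))) atTop
      = ENNReal.ofReal (1 / (ν + 1)) * ‖w x‖ₑ ^ (ν + 1) := fun x => by
    rw [← ofReal_mul_abs_rpow (by positivity) (by linarith)]
    exact (ENNReal.tendsto_ofReal (tendsto_energyDensity hν (w x))).liminf_eq
  simp only [hlim] at hfat
  rw [lintegral_const_mul' _ _ ENNReal.ofReal_ne_top] at hfat
  refine hfat.trans ((liminf_le_liminf (Eventually.of_forall fun k => ?_)).trans_eq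
    (liminf_const (f := atTop) (ENNReal.ofReal (1 / (ν + 1)) * Y)))
  rw [← ofReal_integral_eq_lintegral_ofReal (hI k)
    (Eventually.of_forall fun x => energyDensity_nonneg hν k _)]
  exact hk k

/-- The order of limits matters: `L²` convergence to `u₀` controls the truncated energies, which are
Lipschitz, but not the full power. Time tends to 0 for fixed `k`, and only then `k → ∞`. -/
theorem IsEnergySolution.powerEnergy_le_initial [NeZero N] (hu : IsEnergySolution Ω s p T u₀ u)
    (hΩ : MeasurableSet Ω) (hΩv : volume Ω < ⊤) (hs0 : 0 < s) (hs1 : s < 1) (hp : 1 < p)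
    (hν : 1 < ν) (hu₀ : MemLp u₀ 2 (volume.restrict Ω)) {b : ℝ} (hb0 : 0 < b) (hb : b ≤ T) :
    powerEnergy Ω ν (u b) ≤ powerEnergy Ω ν u₀ := by
  have hfinm : IsFiniteMeasure (volume.restrict Ω) := ⟨by simpa using hΩv⟩
  have hbT : b ∈ Icc 0 T := ⟨hb0.le, hb⟩
  have hk : ∀ k, ENNReal.ofReal (∫ x in Ω, energyDensity ν k (u b x))
      ≤ ENNReal.ofReal (1 / (ν + 1)) * powerEnergy Ω ν u₀ := by
    intro k
    obtain ⟨K, hK0, hK⟩ := exists_lipschitz_energyDensity (ν := ν) k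
    have hI : ∀ t ∈ Icc 0 T, IntegrableOn (fun x => energyDensity ν k (u t x)) Ω := fun t ht =>
      hu.integrable_comp hΩv (continuous_energyDensity k) primitive_zero hK ht
    have hI0 : IntegrableOn (fun x => energyDensity ν k (u₀ x)) Ω := by
      refine Integrable.mono' ((hu₀.integrable (by norm_num)).abs.const_mul K)
        ((continuous_energyDensity k).comp_aestronglyMeasurable hu₀.1)
        (Eventually.of_forall fun x => ?_)
      have := hK (u₀ x) 0
      rwa [show energyDensity ν k 0 = 0 from primitive_zero, sub_zero, sub_zero] at this
    have hev : ∀ᶠ t in 𝓝[>] (0 : ℝ), t ∈ Ioo 0 b := Ioo_mem_nhdsGT hb0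
    have hevT : ∀ᶠ t in 𝓝[>] (0 : ℝ), t ∈ Icc 0 T :=
      hev.mono fun t ht => ⟨ht.1.le, ht.2.le.trans hb⟩
    have hlim := tendsto_integral_of_lipschitz (fun _ => energyDensity ν k) hK0 (fun _ => hK)
      (hevT.mono fun t ht => (hu.memL2 t ht).1) hu₀.1 (hevT.mono fun t ht => hI t ht) hI0
      hu.initial
    refine le_trans ?_ (ofReal_integral_energyDensity_le hν k hu₀.1)
    refine ge_of_tendsto (ENNReal.tendsto_ofReal hlim) ?_
    filter_upwards [hev] with t ht
    exact le_self_add.trans (hu.energy_le hΩ hΩv hs0 hs1 hp (contDiff_cutoffPow k)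
      (hasCompactSupport_cutoffPow k) (fun r => cutoffPow_nonneg (by linarith) k r) ht.1 ht.2 hb)
  exact powerEnergy_le_of_forall hν (fun k => by
    obtain ⟨K, -, hK⟩ := exists_lipschitz_energyDensity (ν := ν) k
    exact hu.integrable_comp hΩv (continuous_energyDensity k) primitive_zero hK hbT)
    (hu.memL2 b hbT).1 hk

theorem IsEnergySolution.powerEnergy_anti [NeZero N] (hu : IsEnergySolution Ω s p T u₀ u)
    (hΩ : MeasurableSet Ω) (hΩv : volume Ω < ⊤) (hs0 : 0 < s) (hs1 : s < 1) (hp : 1 < p)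
    (hν : 1 < ν) {a b : ℝ} (ha : 0 < a) (hab : a < b) (hb : b ≤ T) :
    powerEnergy Ω ν (u b) ≤ powerEnergy Ω ν (u a) := by
  have hbT : b ∈ Icc 0 T := ⟨(ha.trans hab).le, hb⟩
  have haT : a ∈ Icc 0 T := ⟨ha.le, hab.le.trans hb⟩
  refine powerEnergy_le_of_forall hν (fun k => ?_) (hu.memL2 b hbT).1 fun k => ?_
  · obtain ⟨K, -, hK⟩ := exists_lipschitz_energyDensity (ν := ν) k
    exact hu.integrable_comp hΩv (continuous_energyDensity k) primitive_zero hK hbT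
  · exact (le_self_add.trans (hu.energy_le hΩ hΩv hs0 hs1 hp (contDiff_cutoffPow k)
      (hasCompactSupport_cutoffPow k) (fun r => cutoffPow_nonneg (by linarith) k r) ha hab
      hb)).trans (ofReal_integral_energyDensity_le hν k (hu.memL2 a haT).1)

/-- The decay inequality `y' + c y^θ ≤ 0` for `y = ∫_Ω |u|^(ν+1)`, in integrated form. -/
theorem IsEnergySolution.powerEnergy_decay [NeZero N] (hu : IsEnergySolution Ω s p T u₀ u)
    (hΩ : MeasurableSet Ω) (hΩv : volume Ω < ⊤) (hs0 : 0 < s) (hs1 : s < 1) (hp : 1 < p)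
    (hν : 1 < ν) (hu₀ : MemLp u₀ 2 (volume.restrict Ω)) (hfin : powerEnergy Ω ν u₀ ≠ ⊤)
    {θ C : ℝ} (hθ : 0 < θ) (hC : 0 < C)
    (hβ : ((ν - 1) / p + 1) * (p / θ) = ν + 1)
    (hsob : ∀ w : EuclideanSpace ℝ (Fin N) → ℝ, AEStronglyMeasurable w volume →
      (∀ᵐ x ∂(volume.restrict Ωᶜ), w x = 0) → ∫⁻ x, ‖w x‖ₑ ^ (p / θ) ≠ ⊤ →
      (∫⁻ x, ‖w x‖ₑ ^ (p / θ)) ^ θ ≤ ENNReal.ofReal C * gagliardo Ω s p w)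
    {a b : ℝ} (ha : 0 < a) (hab : a < b) (hb : b ≤ T) :
    ENNReal.ofReal (1 / (ν + 1)) * powerEnergy Ω ν (u b)
      + ENNReal.ofReal (b - a) * (ENNReal.ofReal (1 / 2 / C) *
        (ENNReal.ofReal (rootConst p ν ^ (p / θ)) * powerEnergy Ω ν (u b)) ^ θ)
      ≤ ENNReal.ofReal (1 / (ν + 1)) * powerEnergy Ω ν (u a) := by
  have hp0 : 0 < p := by linarith
  have hq : 0 < p / θ := by positivity
  have hba : 0 < b - a := sub_pos.2 hab
  have hsub : Ioo a b ⊆ Ioo 0 T := Ioo_subset_Ioo ha.le hb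
  have hfint : ∀ t, 0 < t → t ≤ T → powerEnergy Ω ν (u t) ≠ ⊤ := fun t ht htT =>
    ((hu.powerEnergy_le_initial hΩ hΩv hs0 hs1 hp hν hu₀ ht htT).trans_lt hfin.lt_top).ne
  have hbT : b ∈ Icc 0 T := ⟨(ha.trans hab).le, hb⟩
  have haT : a ∈ Icc 0 T := ⟨ha.le, hab.le.trans hb⟩
  set A : ℕ → ℝ≥0∞ := fun k => ∫⁻ x in Ω, ENNReal.ofReal (energyDensity ν k (u b x)) with hA
  set S : ℕ → ℝ → ℝ≥0∞ :=
    fun k t => (∫⁻ x in Ω, ‖dissipationRoot p ν k (u t x)‖ₑ ^ (p / θ)) ^ θ with hS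
  set M := ENNReal.ofReal (1 / (ν + 1)) * powerEnergy Ω ν (u a) with hM
  set κ := ENNReal.ofReal (1 / 2 / C) with hκ
  have hSm : ∀ k, AEMeasurable (S k) (volume.restrict (Ioo a b)) := by
    intro k
    have h1 : AEStronglyMeasurable (Function.uncurry u)
        ((volume.restrict (Ioo a b)).prod (volume.restrict Ω)) :=
      hu.memParabolic.memLp.1.mono_measure
        (Measure.prod_mono (Measure.restrict_mono hsub le_rfl) Measure.restrict_le_self)
    have h2 := ((continuous_dissipationRoot (ν := ν) hp0 k).comp_aestronglyMeasurable
      h1).enorm.pow_const (p / θ)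
    exact h2.lintegral_prod_right'.pow_const θ
  have hSle : ∀ k, κ * ∫⁻ t in Ioo a b, S k t
      ≤ ENNReal.ofReal (1 / 2) * ∫⁻ t in Ioo a b, gagliardo Ω s p (dissipationRoot p ν k ∘ u t) := by
    intro k
    rw [← lintegral_const_mul' _ _ ENNReal.ofReal_ne_top,
      ← lintegral_const_mul' _ _ ENNReal.ofReal_ne_top]
    refine lintegral_mono_ae ?_
    have hmem : ∀ᵐ t ∂(volume.restrict (Ioo a b)), MemW0 Ω s p (u t) :=
      ae_mono (Measure.restrict_mono hsub le_rfl) hu.memParabolic.memW0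
    filter_upwards [hmem, ae_restrict_mem measurableSet_Ioo] with t hw ht
    have hout : ∀ᵐ x ∂(volume.restrict Ωᶜ), (dissipationRoot p ν k ∘ u t) x = 0 := by
      filter_upwards [hw.eq_zero_outside] with x hx
      rw [Function.comp_apply, hx]
      exact primitive_zero
    have hsplit : ∫⁻ x, ‖(dissipationRoot p ν k ∘ u t) x‖ₑ ^ (p / θ)
        = ∫⁻ x in Ω, ‖dissipationRoot p ν k (u t x)‖ₑ ^ (p / θ) := by
      rw [← lintegral_add_compl _ hΩ]
      have : ∫⁻ x in Ωᶜ, ‖(dissipationRoot p ν k ∘ u t) x‖ₑ ^ (p / θ) = 0 := by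
        rw [lintegral_congr_ae (g := fun _ => 0)]
        · simp
        · filter_upwards [hout] with x hx
          rw [hx, enorm_zero, ENNReal.zero_rpow_of_pos hq]
      rw [this, add_zero]
      rfl
    -- The finiteness required by the Sobolev inequality comes from the power energy, through the
    -- exponent identity `hβ`.
    have hle : ∫⁻ x in Ω, ‖dissipationRoot p ν k (u t x)‖ₑ ^ (p / θ) ≠ ⊤ := by
      refine ne_top_of_le_ne_top (ENNReal.mul_ne_top (ENNReal.ofReal_ne_top
        (r := rootConst p ν ^ (p / θ))) (hfint t (hsub ht).1 (hsub ht).2.le)) ?_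
      rw [powerEnergy, ← lintegral_const_mul' _ _ ENNReal.ofReal_ne_top]
      exact lintegral_mono fun x => enorm_dissipationRoot_rpow_le hp0 hν hq.le hβ k _
    have h1 := hsob (dissipationRoot p ν k ∘ u t)
      ((continuous_dissipationRoot hp0 k).comp_aestronglyMeasurable hw.memLp.1) hout
      (by rw [hsplit]; exact hle)
    rw [hsplit] at h1
    calc κ * S k t ≤ κ * (ENNReal.ofReal C * gagliardo Ω s p (dissipationRoot p ν k ∘ u t)) := by
          gcongr
      _ = _ := by
          rw [← mul_assoc, hκ, ← ENNReal.ofReal_mul (by positivity),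
            div_mul_cancel₀ _ hC.ne']
  have hen : ∀ k, A k + κ * ∫⁻ t in Ioo a b, S k t ≤ M := by
    intro k
    obtain ⟨K, hK0, hK⟩ := exists_lipschitz_energyDensity (ν := ν) k
    have hI := hu.integrable_comp hΩv (continuous_energyDensity k) primitive_zero hK hbT
    have h1 := hu.energy_le hΩ hΩv hs0 hs1 hp (contDiff_cutoffPow (ν := ν) k)
      (hasCompactSupport_cutoffPow k) (fun r => cutoffPow_nonneg (by linarith) k r) ha hab hb
    have h2 : A k = ENNReal.ofReal (∫ x in Ω, energyDensity ν k (u b x)) :=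
      (ofReal_integral_eq_lintegral_ofReal hI
        (Eventually.of_forall fun x => energyDensity_nonneg hν k _)).symm
    rw [h2]
    exact (add_le_add_right (hSle k) _).trans
      (h1.trans (ofReal_integral_energyDensity_le hν k (hu.memL2 a haT).1))
  set J := ENNReal.ofReal (1 / (ν + 1)) * powerEnergy Ω ν (u b)
      + ENNReal.ofReal (b - a) * (κ *
        (ENNReal.ofReal (rootConst p ν ^ (p / θ)) * powerEnergy Ω ν (u b)) ^ θ) with hJ
  have hAlim : Tendsto A atTop (𝓝 (ENNReal.ofReal (1 / (ν + 1)) * powerEnergy Ω ν (u b))) :=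
    tendsto_lintegral_energyDensity hν (hu.memL2 b hbT).1 (hfint b (ha.trans hab) hb)
  -- The limiting dissipation at time `t` is a power of the energy at `t`, which by monotonicity is
  -- at least that at `b`.
  have hpt : ∀ t ∈ Ioo a b,
      J ≤ liminf (fun k => A k + ENNReal.ofReal (b - a) * (κ * S k t)) atTop := by
    intro t ht
    have htT := hsub ht
    have h1 := (tendsto_lintegral_dissipationRoot hp0 hν hq.le hβ
      (hu.memL2 t (Ioo_subset_Icc_self htT)).1 (hfint t htT.1 htT.2.le)).ennrpow_const θ
    have h2 := hAlim.add (ENNReal.Tendsto.const_mul (ENNReal.Tendsto.const_mul h1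
      (Or.inr (ENNReal.ofReal_ne_top (r := 1 / 2 / C))))
      (Or.inr (ENNReal.ofReal_ne_top (r := b - a))))
    rw [h2.liminf_eq, hJ]
    gcongr
    exact hu.powerEnergy_anti hΩ hΩv hs0 hs1 hp hν htT.1 ht.2 hb
  -- The energy at `b` is kept inside the time integral, so one application of Fatou in `k` treats
  -- both terms; the common factor `b - a` is then cancelled.
  have hfat : ENNReal.ofReal (b - a) * J ≤ ENNReal.ofReal (b - a) * M := by
    calc ENNReal.ofReal (b - a) * J = ∫⁻ _ in Ioo a b, J := by
          rw [setLIntegral_const, Real.volume_Ioo, mul_comm]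
      _ ≤ ∫⁻ t in Ioo a b, liminf (fun k => A k + ENNReal.ofReal (b - a) * (κ * S k t)) atTop :=
          setLIntegral_mono' measurableSet_Ioo hpt
      _ ≤ liminf (fun k => ∫⁻ t in Ioo a b, (A k + ENNReal.ofReal (b - a) * (κ * S k t))) atTop :=
          lintegral_liminf_le' fun k => (((hSm k).const_mul κ).const_mul _).const_add _
      _ ≤ liminf (fun _ : ℕ => ENNReal.ofReal (b - a) * M) atTop := by
          refine liminf_le_liminf (Eventually.of_forall fun k => ?_)
          rw [lintegral_add_left measurable_const, setLIntegral_const, Real.volume_Ioo,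
            lintegral_const_mul' _ _ ENNReal.ofReal_ne_top,
            lintegral_const_mul' _ _ ENNReal.ofReal_ne_top, mul_comm (A k), ← mul_add]
          gcongr
          exact hen k
      _ = _ := liminf_const _
  refine (ENNReal.mul_le_mul_iff_right ?_ ENNReal.ofReal_ne_top).1 hfat
  simpa using hba

end Extinction

end

end FracPLap

/-! ### The extinction theorem -/

theorem theorem5p2 {N : ℕ} (Ω : Set (EuclideanSpace ℝ (Fin N)))
    (hΩ_open : IsOpen Ω) (hΩ_bdd : Bornology.IsBounded Ω)
    (s p ν : ℝ) (hs0 : 0 < s) (hs1 : s < 1)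
    (hp1 : 1 < p) (hp2 : p < 2 * (N : ℝ) / ((N : ℝ) + 2 * s))
    (hν : ν + 1 = (N : ℝ) * (2 - p) / (p * s))
    (u₀ : EuclideanSpace ℝ (Fin N) → ℝ)
    (hu₀ : MemLp u₀ (ENNReal.ofReal (ν + 1)) (volume.restrict Ω))
    (hu₀2 : MemLp u₀ 2 (volume.restrict Ω)) :
    ∃ Tstar : ℝ, 0 < Tstar ∧
      ∀ (T : ℝ) (u : ℝ → EuclideanSpace ℝ (Fin N) → ℝ), 0 < T →
        FracPLap.IsEnergySolution Ω s p T u₀ u →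
        (∀ᵐ t ∂(volume.restrict (Ioo 0 T)), ∀ᵐ x ∂(volume.restrict Ω), 0 ≤ u t x) →
        ∀ t : ℝ, Tstar ≤ t → t ≤ T → ∀ᵐ x ∂volume, u t x = 0 := by
  have hp0 : 0 < p := by linarith
  -- For `N = 0` the upper bound on `p` would read `p < 0`.
  have hN0 : (0 : ℝ) < N := by
    rcases Nat.eq_zero_or_pos N with rfl | h
    · norm_num at hp2
      linarith
    · exact_mod_cast h
  have hNne : NeZero N := ⟨by rintro rfl; simp at hN0⟩
  have hden : 0 < (N : ℝ) + 2 * s := by positivity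
  rw [lt_div_iff₀ hden] at hp2
  have hps : 0 < p * s := by positivity
  have hνN : (ν + 1) * (p * s) = N * (2 - p) := by
    rw [hν]; field_simp
  -- The bound on `p` reads `2ps < N(2 - p)`, and the right side is `(ν + 1)ps`. Since `p > 1`, the
  -- same bound gives `ps < N` next.
  have hν1 : 1 < ν := by nlinarith
  have hpN : p * s < N := by nlinarith
  have hΩ := hΩ_open.measurableSet
  have hΩv : volume Ω < ⊤ := hΩ_bdd.measure_lt_top
  obtain ⟨C, hC, hsob⟩ := FracPLap.exists_sobolev_const hs0 hp1.le hpN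
  set θ : ℝ := 1 - p * s / N with hθ
  have hθ0 : 0 < θ := by
    rw [hθ, sub_pos, div_lt_one hN0]; exact hpN
  have hθ1 : θ < 1 := by
    rw [hθ]; have := div_pos hps hN0; linarith
  -- The criticality of ν: it amounts to `(ν + 1)θ = ν - 1 + p`, which is the definition of ν
  -- rewritten.
  have hβ : ((ν - 1) / p + 1) * (p / θ) = ν + 1 := by
    have h1 : (ν + 1) * θ = ν - 1 + p := by
      rw [hθ, mul_sub, mul_one, mul_div_assoc', hνN]
      field_simp
      ring
    field_simp
    linarith
  have hν0 : 0 < ν + 1 := by linarith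
  have hfin : FracPLap.powerEnergy Ω ν u₀ ≠ ⊤ :=
    ((FracPLap.eLpNorm_ofReal_lt_top_iff hν0).1 hu₀.2).ne
  have hr := FracPLap.rootConst_pos hp0 hν1
  set B : ℝ := FracPLap.rootConst p ν ^ (p / θ) with hB
  have hB0 : 0 < B := by positivity
  -- The rate is the coefficient in the decay inequality after multiplication by `ν + 1`. It and the
  -- bound on the energy do not involve `T` or `u`; the added 1 keeps the bound positive when `u₀`
  -- vanishes.
  obtain ⟨Tstar, hT0, hTstar⟩ := FracPLap.exists_extinction_time
    (c := (ν + 1) * (1 / 2 / C * B ^ θ)) (θ := θ)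
    (Y₀ := (FracPLap.powerEnergy Ω ν u₀).toReal + 1) (by positivity) hθ0 hθ1 (by positivity)
  refine ⟨Tstar, hT0, fun T u hT hu _ t ht htT => ?_⟩
  have hle : ∀ t, 0 < t → t ≤ T →
      FracPLap.powerEnergy Ω ν (u t) ≤ FracPLap.powerEnergy Ω ν u₀ := fun t h1 h2 =>
    hu.powerEnergy_le_initial hΩ hΩv hs0 hs1 hp1 hν1 hu₀2 h1 h2
  have hft : ∀ t, 0 < t → t ≤ T → FracPLap.powerEnergy Ω ν (u t) ≠ ⊤ := fun t h1 h2 =>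
    ((hle t h1 h2).trans_lt hfin.lt_top).ne
  have hzero := hTstar T (fun t => (FracPLap.powerEnergy Ω ν (u t)).toReal)
    (fun _ _ _ => ENNReal.toReal_nonneg)
    (fun t h1 h2 => (ENNReal.toReal_mono hfin (hle t h1 h2)).trans (by linarith))
    (fun a b ha hab hb => by
      have h := hu.powerEnergy_decay hΩ hΩv hs0 hs1 hp1 hν1 hu₀2 hfin hθ0 hC hβ
        (fun w h1 h2 h3 => hsob Ω w hΩ h1 h2 h3) ha hab hb
      rw [← hB] at h
      have hba : 0 < b - a := sub_pos.2 hab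
      set y := (FracPLap.powerEnergy Ω ν (u b)).toReal with hy
      set y' := (FracPLap.powerEnergy Ω ν (u a)).toReal with hy'
      have hy0 : 0 ≤ y := ENNReal.toReal_nonneg
      have e1 : FracPLap.powerEnergy Ω ν (u b) = ENNReal.ofReal y :=
        (ENNReal.ofReal_toReal (hft b (ha.trans hab) hb)).symm
      have e2 : FracPLap.powerEnergy Ω ν (u a) = ENNReal.ofReal y' :=
        (ENNReal.ofReal_toReal (hft a ha (hab.le.trans hb))).symm
      rw [e1, e2, ← ENNReal.ofReal_mul (by positivity), ← ENNReal.ofReal_mul hB0.le,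
        ENNReal.ofReal_rpow_of_nonneg (by positivity) hθ0.le,
        ← ENNReal.ofReal_mul (by positivity), ← ENNReal.ofReal_mul hba.le,
        ← ENNReal.ofReal_add (by positivity) (by positivity),
        ← ENNReal.ofReal_mul (by positivity),
        ENNReal.ofReal_le_ofReal_iff (mul_nonneg (by positivity) ENNReal.toReal_nonneg),
        Real.mul_rpow hB0.le hy0] at h
      have h' := mul_le_mul_of_nonneg_left h hν0.le
      calc y + (ν + 1) * (1 / 2 / C * B ^ θ) * (b - a) * y ^ θ
          = (ν + 1) * (1 / (ν + 1) * y + (b - a) * (1 / 2 / C * (B ^ θ * y ^ θ))) := by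
            field_simp
        _ ≤ (ν + 1) * (1 / (ν + 1) * y') := h'
        _ = y' := by field_simp) t ht htT
  have ht0 : 0 < t := hT0.trans_le ht
  have hE0 : FracPLap.powerEnergy Ω ν (u t) = 0 :=
    ((ENNReal.toReal_eq_zero_iff _).1 hzero).resolve_right (hft t ht0 htT)
  have htT' : t ∈ Icc 0 T := ⟨ht0.le, htT⟩
  have hin : ∀ᵐ x ∂(volume.restrict Ω), u t x = 0 := by
    rw [FracPLap.powerEnergy,
      lintegral_eq_zero_iff' ((hu.memL2 t htT').1.enorm.pow_const _)] at hE0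
    filter_upwards [hE0] with x hx
    simpa [hν0, hν0.not_gt] using hx
  exact ae_of_ae_restrict_of_ae_restrict_compl Ω hin (hu.eq_zero_outside t htT')
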